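/- **Setup.** Let $M^*$ be a random element of a real vector space $\mathcal M$ (with a $\sigma$-algebra containing the singletons), $A\in\{0,1\}$ an annotation indicator, and $X,U,V$ random elements of measurable spaces $\mathcal X,\mathcal U,\mathcal V$, all defined on one standard Borel probability space. Put $M=A\,M^*$, $\tilde X=(X,U,V)$, and let $P$ be the law of the observed data $W=(M,A,X,U,V)$. Assume $[(U,M^*)\perp A]\mid X$, $[V\perp A]\mid (X,U,M^*)$, and $P(A=1\mid X)=\pi(X)$ a.s. for a measurable $\pi:\mathcal X\to[\eta,1]$ with $0<\eta<1$. Let $g:\mathcal M\times\mathcal V\to\mathbb R$ be measurable and homogeneous of degree one in its first argument ($g(cm,v)=c\,g(m,v)$ for $c>0$), put $\tilde M=g(M,V)$, $\tilde M^*=g(M^*,V)$, and assume $E[(\tilde M^*)^2]<\infty$. For a law $Q$ of $W$ put $\tilde\mu_Q(\tilde X)=E_Q[\tilde M\mid A=1,\tilde X]$ and consider the functional $$\theta(Q)=E_Q[\tilde\mu_Q(\tilde X)],\qquad\text{and put}\qquad \tau(Q)=E_Q\big[E_Q[\tilde M^2\mid A=1,\tilde X]\big].$$ **Models.** The nonparametric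 model $\mathcal P$ consists of all laws $Q$ of $W$ with $M=0$ $Q$-a.s. on $\{A=0\}$, $Q(A=1\mid\tilde X)>0$ $Q$-a.s., and $\tau(Q)<\infty$; the conditional probability $Q(A=1\mid \tilde X)$ is otherwise unrestricted. The semiparametric model with known annotation score is $\mathcal P_\pi=\{Q\in\mathcal P: Q(A=1\mid\tilde X)=\pi(X)\ Q\text{-a.s.}\}$. **Efficient influence functions.** A regular submodel of a model $\mathcal Q\in\{\mathcal P,\mathcal P_\pi\}$ through $P$ with score $h\in L^2(P)$ is a path $(P_t)_{t>0}$ such that $P_t\in\mathcal Q$ for all small $t$, $\int\big[\big(\sqrt{dP_t}-\sqrt{dP}\big)/t-\tfrac12 h\sqrt{dP}\big]^2\to0$ as $t\downarrow0$, and $\tau(P_t)$ is bounded for all small $t$. The tangent space of $\mathcal Q$ at $P$ is the closed linear span in $L^2(P)$ of all such scores. The efficient influence function (EIF) of $\theta$ at $P$ under $\mathcal Q$ is an element $\varphi$ of this tangent space with $\lim_{t\downarrow0}(\theta(P_t)-\theta(P))/t=E_P[\varphi h]$ for every regular submodel of $\mathcal Q$ through $P$, $h$ being its score. **Claim.** 1.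 $P\in\mathcal P_\pi$, and $\theta(P)=E[\tilde M^*]$. 2. If $(P_t)$ is a regular submodel of $\mathcal P$ through $P$ whose score $h$ is an annotation-mechanism score, i.e. $h=h(A,\tilde X)$ with $E_P[h\mid\tilde X]=0$, then $\lim_{t\downarrow0}(\theta(P_t)-\theta(P))/t=0$. 3. $\theta$ has exactly one EIF at $P$ under $\mathcal P$, and, for every $\varphi\in L^2(P)$, $\varphi$ is the EIF of $\theta$ at $P$ under $\mathcal P$ if and only if $\varphi$ is the EIF of $\theta$ at $P$ under $\mathcal P_\pi$. -/

import Mathlib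

open MeasureTheory ProbabilityTheory Filter Topology
open scoped ENNReal

noncomputable section

/-! ## Semiparametric theory: submodels, scores, tangent spaces, efficient influence functions -/

namespace Semiparam

variable {𝒲 : Type*} [MeasurableSpace 𝒲]

/-- The one-sided path `t ↦ γ t` of laws, `t ↓ 0`, is differentiable in quadratic mean at `P`
with score `h ∈ L²(P)`:
`∫ ((√dP_t - √dP) / t - (1/2) h √dP)² → 0` as `t ↓ 0`,
where `P_t = γ t` and densities are taken with respect to `P + P_t` (the integral does not
depend on the dominating measure; `P_t` need not be dominated by `P`). -/
def IsDQM (P : Measure 𝒲) (γ : ℝ → Measure 𝒲) (h : Lp ℝ 2 P) : Prop :=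
  Tendsto
    (fun t : ℝ => ∫ w,
      ((√((γ t).rnDeriv (P + γ t) w).toReal - √(P.rnDeriv (P + γ t) w).toReal) / t
        - 1 / 2 * h w * √(P.rnDeriv (P + γ t) w).toReal) ^ 2 ∂(P + γ t))
    (𝓝[>] 0) (𝓝 0)

/-- A regular one-dimensional submodel of the model `𝒬` through `P` with score `h`: a path of
laws that lie in `𝒬`, is differentiable in quadratic mean at `P` with score `h`, and along which
the moment functional `τ` stays bounded near `P`. -/
structure IsRegularSubmodel (𝒬 : Set (Measure 𝒲)) (τ : Measure 𝒲 → ℝ≥0∞) (P : Measure 𝒲)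
    (γ : ℝ → Measure 𝒲) (h : Lp ℝ 2 P) : Prop where
  mem : ∀ᶠ t in 𝓝[>] (0 : ℝ), γ t ∈ 𝒬
  dqm : IsDQM P γ h
  moment : ∃ C : ℝ≥0∞, C < ∞ ∧ ∀ᶠ t in 𝓝[>] (0 : ℝ), τ (γ t) ≤ C

/-- The tangent set of `𝒬` at `P`: the scores of all regular submodels. -/
def tangentSet (𝒬 : Set (Measure 𝒲)) (τ : Measure 𝒲 → ℝ≥0∞) (P : Measure 𝒲) :
    Set (Lp ℝ 2 P) :=
  {h | ∃ γ : ℝ → Measure 𝒲, IsRegularSubmodel 𝒬 τ P γ h}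

/-- The tangent space of `𝒬` at `P`: the closed linear span in `L²(P)` of the tangent set. -/
def tangentSpace (𝒬 : Set (Measure 𝒲)) (τ : Measure 𝒲 → ℝ≥0∞) (P : Measure 𝒲) :
    Submodule ℝ (Lp ℝ 2 P) :=
  (Submodule.span ℝ (tangentSet 𝒬 τ P)).topologicalClosure

/-- The pathwise derivative of `θ` along the path `γ` that starts at `P` exists and equals `d`. -/
def HasPathwiseDeriv (θ : Measure 𝒲 → ℝ) (P : Measure 𝒲) (γ : ℝ → Measure 𝒲) (d : ℝ) : Prop :=
  Tendsto (fun t : ℝ => (θ (γ t) - θ P) / t) (𝓝[>] 0) (𝓝 d)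

/-- `φ ∈ L²(P)` is an influence function (gradient) of `θ` at `P` in the model `𝒬`: the pathwise
derivative along every regular submodel with score `h` exists and equals `E_P[φ h]`. -/
def IsInfluenceFunction (𝒬 : Set (Measure 𝒲)) (τ : Measure 𝒲 → ℝ≥0∞) (θ : Measure 𝒲 → ℝ)
    (P : Measure 𝒲) (φ : Lp ℝ 2 P) : Prop :=
  ∀ (γ : ℝ → Measure 𝒲) (h : Lp ℝ 2 P), IsRegularSubmodel 𝒬 τ P γ h →
    HasPathwiseDeriv θ P γ (∫ w, φ w * h w ∂P)

/-- `φ` is the efficient influence function (canonical gradient) of `θ` at `P` in the model `𝒬`: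
an influence function that lies in the tangent space. -/
def IsEIF (𝒬 : Set (Measure 𝒲)) (τ : Measure 𝒲 → ℝ≥0∞) (θ : Measure 𝒲 → ℝ)
    (P : Measure 𝒲) (φ : Lp ℝ 2 P) : Prop :=
  IsInfluenceFunction 𝒬 τ θ P φ ∧ φ ∈ tangentSpace 𝒬 τ P

end Semiparam

/-! ## Missing-at-random structured data -/

namespace MARS

/-- Observed data `W = (M, A, X, U, V)`: structured data, annotation indicator, covariates,
unstructured data, context variable. -/
abbrev Obs (𝓜 𝒳 𝒰 𝒱 : Type*) := 𝓜 × Bool × 𝒳 × 𝒰 × 𝒱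

variable {𝓜 𝒳 𝒰 𝒱 : Type*}

/-- The event `A = 1`. -/
def annotated : Set (Obs 𝓜 𝒳 𝒰 𝒱) := {w | w.2.1 = true}

/-- `M̃ = g(M, V)`. -/
def tildeM (g : 𝓜 → 𝒱 → ℝ) (w : Obs 𝓜 𝒳 𝒰 𝒱) : ℝ := g w.1 w.2.2.2.2

variable [MeasurableSpace 𝓜] [MeasurableSpace 𝒳] [MeasurableSpace 𝒰] [MeasurableSpace 𝒱]

/-- The σ-algebra generated by `X̃ = (X, U, V)`. -/
abbrev sigmaX : MeasurableSpace (Obs 𝓜 𝒳 𝒰 𝒱) :=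
  MeasurableSpace.comap (fun w => w.2.2) inferInstance

/-- The σ-algebra generated by `(A, X̃)`. -/
abbrev sigmaAX : MeasurableSpace (Obs 𝓜 𝒳 𝒰 𝒱) :=
  MeasurableSpace.comap (fun w => w.2) inferInstance

/-- `P(A = 1 ∣ X̃)`. -/
def annotationProb (P : Measure (Obs 𝓜 𝒳 𝒰 𝒱)) : Obs 𝓜 𝒳 𝒰 𝒱 → ℝ :=
  P⟦annotated | sigmaX⟧

/-- `μ̃(X̃) = E_P[M̃ ∣ A = 1, X̃]`. -/
def tildeMu (g : 𝓜 → 𝒱 → ℝ) (P : Measure (Obs 𝓜 𝒳 𝒰 𝒱)) : Obs 𝓜 𝒳 𝒰 𝒱 → ℝ :=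
  P[|annotated][tildeM g | sigmaX]

/-- The point-identified MAR-S mean functional `θ(P) = E_P[μ̃(X̃)]`. -/
def theta (g : 𝓜 → 𝒱 → ℝ) (P : Measure (Obs 𝓜 𝒳 𝒰 𝒱)) : ℝ :=
  ∫ w, tildeMu g P w ∂P

/-- `E_P[E_P[M̃² ∣ A = 1, X̃]]`, the identified second moment of `M̃*`. -/
def secondMoment (g : 𝓜 → 𝒱 → ℝ) (P : Measure (Obs 𝓜 𝒳 𝒰 𝒱)) : ℝ≥0∞ :=
  ∫⁻ w, (condLExp sigmaX P[|annotated] (fun w' => ENNReal.ofReal (tildeM g w' ^ 2))) w ∂P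

/-- The nonparametric model: all laws of `(M, A, X, U, V)` with `M = 0` when `A = 0`, such that
`P(A = 1 ∣ X̃) > 0` almost surely (so that `μ̃(X̃)` is defined) and `M̃*` has a finite (identified)
second moment. Nothing else is restricted; in particular `P(A = 1 ∣ X̃)` is free. -/
def nonparametricModel [Zero 𝓜] (g : 𝓜 → 𝒱 → ℝ) : Set (Measure (Obs 𝓜 𝒳 𝒰 𝒱)) :=
  {P | IsProbabilityMeasure P ∧
    (∀ᵐ w ∂P, w.2.1 = false → w.1 = 0) ∧
    (∀ᵐ w ∂P, 0 < annotationProb P w) ∧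
    secondMoment g P < ∞}

/-- The semiparametric model with known annotation score function `π`: the laws in the
nonparametric model with `P(A = 1 ∣ X̃) = π(X)`. -/
def knownScoreModel [Zero 𝓜] (g : 𝓜 → 𝒱 → ℝ) (π : 𝒳 → ℝ) :
    Set (Measure (Obs 𝓜 𝒳 𝒰 𝒱)) :=
  {P | P ∈ nonparametricModel g ∧ annotationProb P =ᵐ[P] fun w => π w.2.2.1}

/-- The annotation-mechanism scores at `P`: `h(A, X̃) ∈ L²(P)` with `E_P[h(A, X̃) ∣ X̃] = 0`. -/
def annotationScores (P : Measure (Obs 𝓜 𝒳 𝒰 𝒱)) : Set (Lp ℝ 2 P) :=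
  {h | AEStronglyMeasurable[sigmaAX] h P ∧ P[h | sigmaX] =ᵐ[P] 0}

end MARS

end

/-! Write `m` for the σ-algebra of X̃, `e` for the propensity P(A = 1 ∣ X̃), `f` for M̃ and μ for
its regression on X̃ given A = 1. The candidate gradient is the augmented inverse propensity
weighted score `aipw`, 1_A (f - μ)/e + μ, centered at θ(P). It is an influence function under the
large model, hence under the small one, and it already lies in the tangent space of the small one.
An influence function in the tangent space is unique (`IsEIF.unique`), so one element is the EIF of
both models. Its orthogonality to scores h(A, X̃) with conditional mean zero makes the derivative
vanish along them.

The hard part is differentiability along an arbitrary regular path: P_t need not be dominated by P,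
its propensity e_t is merely positive, and only τ(P_t) is bounded. For bounded `f`
(`abs_integral_condExp_sub_le`), put b = μ_t - μ. Then E_t[μ_t] - E_t[aipw] = E_t[b (1 - 1_A/e)],
the integrand has P-mean zero, and E_P|b| = O(t), so this difference is o(t). No lower bound on e_t
is needed. For general `f` (`tendsto_integral_condExp_div`), truncate at a level K. The tail N
contributes E_t[1_A N/e_t], whose increment is bounded in `abs_setIntegral_inv_mul_sub_le` by
Hellinger distances with weights of small mass: the tail event, its conditional probability given
`m`, and the event e_t < η/2. Each distance is t times a small number because h² is integrable. The
propensities are compared through `integral_mul_sub_sq_le_hellingerSq`.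

For the tangent space, the linear path (1 + t k) dP with bounded k keeps the propensity as soon as k
is orthogonal to r(X̃)(e - 1_A) for bounded r. The centered scores of truncated functions are such
k, and they converge in L²(P) to the candidate (`aipw_sub_mem_closure`).

For the observed law, the two conditional independences chain to P(A = 1 ∣ X, U, M*, V) = π(X), so
inverse weighting by π on A = 1 recovers the moments of M̃*. -/

open MeasureTheory ProbabilityTheory Filter Topology
open scoped ENNReal

/-! ### Cauchy–Schwarz, uniform integrability and the Hellinger distance -/

namespace Semiparam

variable {𝒲 : Type*} [MeasurableSpace 𝒲]

lemma abs_integral_mul_le {μ : Measure 𝒲} {f g : 𝒲 → ℝ} (hf : MemLp f 2 μ) (hg : MemLp g 2 μ) :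
    |∫ x, f x * g x ∂μ| ≤ √(∫ x, f x ^ 2 ∂μ) * √(∫ x, g x ^ 2 ∂μ) := by
  have h := integral_mul_norm_le_Lp_mul_Lq (μ := μ) (f := f) (g := g) (p := 2) (q := 2)
    Real.HolderConjugate.two_two (by simpa using hf) (by simpa using hg)
  simp only [Real.norm_eq_abs, ← Real.sqrt_eq_rpow, Real.rpow_two, sq_abs] at h
  refine le_trans ?_ h
  simpa only [abs_mul] using abs_integral_le_integral_abs (μ := μ) (f := fun x => f x * g x)

/-- Weights of small mass carry little of the integral of an integrable function. -/
lemma exists_forall_integral_weight_mul_lt {μ : Measure 𝒲} [IsFiniteMeasure μ] {F : 𝒲 → ℝ}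
    (hF : Integrable F μ) (hF0 : ∀ x, 0 ≤ F x) {ε : ℝ} (hε : 0 < ε) :
    ∃ δ > 0, ∀ w : 𝒲 → ℝ, AEStronglyMeasurable w μ → (∀ᵐ x ∂μ, 0 ≤ w x ∧ w x ≤ 1) →
      ∫ x, w x ∂μ < δ → ∫ x, w x * F x ∂μ < ε := by
  have hlim : Tendsto (fun n : ℕ => ∫ x, {x | (n : ℝ) < F x}.indicator F x ∂μ) atTop (𝓝 0) := by
    have : ∫ x, (0 : 𝒲 → ℝ) x ∂μ = 0 := by simp
    rw [← this]
    refine tendsto_integral_of_dominated_convergence (fun x => |F x|) ?_ hF.abs ?_ ?_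
    · intro n
      exact hF.aestronglyMeasurable.indicator₀
        (nullMeasurableSet_lt aemeasurable_const hF.aemeasurable)
    · intro n
      filter_upwards with x
      by_cases h : x ∈ {x | (n : ℝ) < F x} <;> simp [h]
    · filter_upwards with x
      obtain ⟨N, hN⟩ := exists_nat_ge (F x)
      refine tendsto_const_nhds.congr' ?_
      filter_upwards [eventually_ge_atTop N] with n hn
      rw [Set.indicator_of_notMem]
      · rfl
      · simp only [Set.mem_ofPred_eq, not_lt]
        exact hN.trans (by exact_mod_cast hn)
  obtain ⟨n, hn⟩ := (hlim.eventually (gt_mem_nhds (half_pos hε))).exists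
  -- The bound is `w F ≤ n w + F 1_{F > n}`, whose second term integrates to less than `ε / 2`. The
  -- `+ 1` covers `n = 0`.
  refine ⟨ε / 2 / (n + 1), by positivity, fun w hw hw1 hlt => ?_⟩
  have hwint : Integrable w μ := by
    refine Integrable.of_bound hw 1 ?_
    filter_upwards [hw1] with x hx
    rw [Real.norm_eq_abs, abs_of_nonneg hx.1]; exact hx.2
  have hS : Integrable ({x | (n : ℝ) < F x}.indicator F) μ :=
    hF.indicator₀ (nullMeasurableSet_lt aemeasurable_const hF.aemeasurable)
  calc ∫ x, w x * F x ∂μ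
      ≤ ∫ x, ((n : ℝ) * w x + {x | (n : ℝ) < F x}.indicator F x) ∂μ := by
        refine integral_mono_ae ?_ ((hwint.const_mul _).add hS) ?_
        · refine hF.bdd_mul hw (c := 1) ?_
          filter_upwards [hw1] with x hx
          rw [Real.norm_eq_abs, abs_of_nonneg hx.1]; exact hx.2
        · filter_upwards [hw1] with x hx
          by_cases h : (n : ℝ) < F x
          · simp only [Set.indicator_of_mem (show x ∈ {x | (n : ℝ) < F x} from h)]
            have := mul_le_of_le_one_left (hF0 x) hx.2
            have := mul_nonneg (Nat.cast_nonneg (α := ℝ) n) hx.1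
            linarith
          · simp only [Set.indicator_of_notMem (show x ∉ {x | (n : ℝ) < F x} from h)]
            have := mul_le_mul_of_nonneg_left (not_lt.1 h) hx.1
            linarith
    _ = n * ∫ x, w x ∂μ + ∫ x, {x | (n : ℝ) < F x}.indicator F x ∂μ := by
        rw [integral_add (hwint.const_mul _) hS, integral_const_mul]
    _ < ε := by
        have h1 : (n : ℝ) * ∫ x, w x ∂μ ≤ n * (ε / 2 / (n + 1)) := by gcongr
        have h2 : (n : ℝ) * (ε / 2 / (n + 1)) ≤ ε / 2 := by
          rw [mul_div_assoc', div_le_iff₀ (by positivity)]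
          nlinarith
        linarith

/-! ### Hellinger distance -/

/-- The square root of the density of `Q` with respect to `ν`. -/
noncomputable def rootDensity (Q ν : Measure 𝒲) (w : 𝒲) : ℝ := √(Q.rnDeriv ν w).toReal

@[fun_prop]
lemma measurable_rootDensity (Q ν : Measure 𝒲) : Measurable (rootDensity Q ν) :=
  (Measure.measurable_rnDeriv _ _).ennreal_toReal.sqrt

lemma rootDensity_sq (Q ν : Measure 𝒲) (w : 𝒲) :
    rootDensity Q ν w ^ 2 = (Q.rnDeriv ν w).toReal := Real.sq_sqrt ENNReal.toReal_nonneg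

variable {P Q ν : Measure 𝒲}

lemma integral_mul_rootDensity_sq [SigmaFinite Q] [SigmaFinite ν] (h : Q ≪ ν) (f : 𝒲 → ℝ) :
    ∫ x, f x * rootDensity Q ν x ^ 2 ∂ν = ∫ x, f x ∂Q := by
  rw [← integral_rnDeriv_smul h]
  simp [rootDensity_sq, mul_comm]

lemma integrable_mul_rootDensity_sq [SigmaFinite Q] [SigmaFinite ν] (h : Q ≪ ν) {f : 𝒲 → ℝ}
    (hf : Integrable f Q) : Integrable (fun x => f x * rootDensity Q ν x ^ 2) ν := by
  refine ((integrable_rnDeriv_smul_iff h).2 hf).congr (ae_of_all _ fun x => ?_)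
  simp [rootDensity_sq, mul_comm]

lemma memLp_mul_rootDensity [SigmaFinite Q] [SigmaFinite ν] (h : Q ≪ ν) {f : 𝒲 → ℝ}
    (hfm : Measurable f) (hf : Integrable (fun x => f x ^ 2) Q) :
    MemLp (fun x => f x * rootDensity Q ν x) 2 ν := by
  refine (memLp_two_iff_integrable_sq (by fun_prop)).2 ?_
  simpa only [mul_pow] using integrable_mul_rootDensity_sq h hf

/-- The weighted squared Hellinger distance `∫ w (√dQ - √dP)²`. -/
noncomputable def hellingerSq (P Q : Measure 𝒲) (w : 𝒲 → ℝ) : ℝ :=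
  ∫ x, w x * (rootDensity Q (P + Q) x - rootDensity P (P + Q) x) ^ 2 ∂(P + Q)

lemma absolutelyContinuous_add_left (P Q : Measure 𝒲) : P ≪ P + Q :=
  Measure.AbsolutelyContinuous.rfl.add_right Q

lemma absolutelyContinuous_add_right (P Q : Measure 𝒲) : Q ≪ P + Q := by
  rw [add_comm]; exact absolutelyContinuous_add_left Q P

lemma memLp_rootDensity [IsFiniteMeasure Q] [SigmaFinite ν] (h : Q ≪ ν) :
    MemLp (rootDensity Q ν) 2 ν := by
  simpa using memLp_mul_rootDensity h (f := fun _ => (1 : ℝ)) measurable_const (by simp)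

lemma hellingerSq_nonneg {w : 𝒲 → ℝ} (hw : ∀ x, 0 ≤ w x) : 0 ≤ hellingerSq P Q w :=
  integral_nonneg fun x => mul_nonneg (hw x) (sq_nonneg _)

/-- The difference of two expectations is bounded by the Hellinger distance. -/
lemma abs_integral_sub_integral_le_hellinger [IsFiniteMeasure P] [IsFiniteMeasure Q]
    {w f : 𝒲 → ℝ} (hw : Measurable w) (hw01 : ∀ x, 0 ≤ w x ∧ w x ≤ 1) (hf : Measurable f)
    (hP : Integrable (fun x => w x * f x ^ 2) P) (hQ : Integrable (fun x => w x * f x ^ 2) Q) :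
    |∫ x, w x * f x ∂Q - ∫ x, w x * f x ∂P| ≤
      √(hellingerSq P Q w) * (√(∫ x, w x * f x ^ 2 ∂Q) + √(∫ x, w x * f x ^ 2 ∂P)) := by
  set ν := P + Q with hν
  have hPν : P ≪ ν := absolutelyContinuous_add_left P Q
  have hQν : Q ≪ ν := absolutelyContinuous_add_right P Q
  set p := rootDensity P ν
  set q := rootDensity Q ν
  have hsq : ∀ x, (√(w x) * f x) ^ 2 = w x * f x ^ 2 := fun x => by
    rw [mul_pow, Real.sq_sqrt (hw01 x).1]
  have hmeas : Measurable fun x => √(w x) * f x := by fun_prop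
  have hvP : MemLp (fun x => √(w x) * f x * p x) 2 ν :=
    memLp_mul_rootDensity hPν hmeas (by simpa only [hsq] using hP)
  have hvQ : MemLp (fun x => √(w x) * f x * q x) 2 ν :=
    memLp_mul_rootDensity hQν hmeas (by simpa only [hsq] using hQ)
  have hu : MemLp (fun x => √(w x) * (q x - p x)) 2 ν := by
    refine MemLp.mono ((memLp_rootDensity hQν).sub (memLp_rootDensity hPν)) (by fun_prop) ?_
    filter_upwards with x
    rw [norm_mul, Real.norm_of_nonneg (Real.sqrt_nonneg _)]
    exact mul_le_of_le_one_left (norm_nonneg _) (Real.sqrt_le_one.2 (hw01 x).2)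
  have hint : ∀ {R : Measure 𝒲} [IsFiniteMeasure R], Integrable (fun x => w x * f x ^ 2) R →
      Integrable (fun x => w x * f x) R := by
    intro R _ hR
    refine (hR.add (integrable_const (1 : ℝ))).mono (by fun_prop) ?_
    filter_upwards with x
    rw [norm_mul, Real.norm_of_nonneg (hw01 x).1]
    refine le_trans ?_ (le_abs_self _)
    have h1 := hw01 x
    simp only [Pi.add_apply, Real.norm_eq_abs]
    have : |f x| ≤ f x ^ 2 + 1 := by nlinarith [sq_abs (f x), sq_nonneg (|f x| - 1)]
    nlinarith
  -- Here q² - p² = (q - p)(q + p), with the weight split evenly as `√w * √w` between the two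
  -- Cauchy–Schwarz factors.
  have e1 : ∫ x, w x * f x ∂Q - ∫ x, w x * f x ∂P =
      ∫ x, (√(w x) * (q x - p x)) * (√(w x) * f x * q x) ∂ν +
        ∫ x, (√(w x) * (q x - p x)) * (√(w x) * f x * p x) ∂ν := by
    have i1 := hu.integrable_mul hvQ
    have i2 := hu.integrable_mul hvP
    simp only [Pi.mul_def] at i1 i2
    rw [← integral_mul_rootDensity_sq hQν, ← integral_mul_rootDensity_sq hPν,
      ← integral_sub (integrable_mul_rootDensity_sq hQν (hint hQ))
        (integrable_mul_rootDensity_sq hPν (hint hP)), ← integral_add i1 i2]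
    congr 1 with x
    have := Real.mul_self_sqrt (hw01 x).1
    linear_combination (-(q x - p x) * f x * q x - (q x - p x) * f x * p x) * this
  have e2 : ∫ x, (√(w x) * (q x - p x)) ^ 2 ∂ν = hellingerSq P Q w := by
    unfold hellingerSq
    congr 1 with x
    rw [mul_pow, Real.sq_sqrt (hw01 x).1]
  have e3 : ∀ {κ : Measure 𝒲} [IsFiniteMeasure κ], κ ≪ ν →
      ∫ x, (√(w x) * f x * rootDensity κ ν x) ^ 2 ∂ν = ∫ x, w x * f x ^ 2 ∂κ := by
    intro κ _ hκ
    rw [← integral_mul_rootDensity_sq hκ]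
    congr 1 with x
    rw [mul_pow, hsq]
  have c1 := abs_integral_mul_le hu hvQ
  have c2 := abs_integral_mul_le hu hvP
  rw [e2, e3 hQν] at c1
  rw [e2, e3 hPν] at c2
  rw [e1, mul_add]
  exact (abs_add_le _ _).trans (add_le_add c1 c2)

end Semiparam

/-! ### First-order consequences of differentiability in quadratic mean -/

namespace Semiparam

variable {𝒲 : Type*} [MeasurableSpace 𝒲] {P Q : Measure 𝒲}

/-- The squared error of the linear approximation of the root densities. -/
noncomputable def dqmError (P Q : Measure 𝒲) (h : 𝒲 → ℝ) (t : ℝ) : ℝ :=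
  ∫ w, ((rootDensity Q (P + Q) w - rootDensity P (P + Q) w) / t
    - 1 / 2 * h w * rootDensity P (P + Q) w) ^ 2 ∂(P + Q)

lemma isDQM_iff {γ : ℝ → Measure 𝒲} {h : Lp ℝ 2 P} :
    IsDQM P γ h ↔ Tendsto (fun t => dqmError P (γ t) h t) (𝓝[>] 0) (𝓝 0) := Iff.rfl

lemma dqmError_nonneg (P Q : Measure 𝒲) (h : 𝒲 → ℝ) (t : ℝ) : 0 ≤ dqmError P Q h t :=
  integral_nonneg fun _ => sq_nonneg _

section

variable [IsFiniteMeasure P] [IsFiniteMeasure Q] {h : 𝒲 → ℝ}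

lemma memLp_dqmError (hh : Measurable h) (hh2 : Integrable (fun x => h x ^ 2) P) (t : ℝ) :
    MemLp (fun w => (rootDensity Q (P + Q) w - rootDensity P (P + Q) w) / t
      - 1 / 2 * h w * rootDensity P (P + Q) w) 2 (P + Q) := by
  have h1 := memLp_mul_rootDensity (absolutelyContinuous_add_left P Q) hh hh2
  have h2 := (memLp_rootDensity (absolutelyContinuous_add_right P Q)).sub
    (memLp_rootDensity (absolutelyContinuous_add_left P Q))
  have := (h2.const_mul t⁻¹).sub (h1.const_mul (1 / 2))
  refine this.congr_norm (by fun_prop) (ae_of_all _ fun x => ?_)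
  congr 1
  simp only [Pi.sub_apply]
  ring

/-- Along a path with score `h` the weighted Hellinger distance is of first order. -/
lemma hellingerSq_le (hh : Measurable h) (hh2 : Integrable (fun x => h x ^ 2) P) {t : ℝ}
    (ht : 0 < t) {w : 𝒲 → ℝ} (hw : Measurable w) (hw01 : ∀ x, 0 ≤ w x ∧ w x ≤ 1) :
    hellingerSq P Q w ≤ t ^ 2 * (2 * dqmError P Q h t + 1 / 2 * ∫ x, w x * h x ^ 2 ∂P) := by
  have hPν := absolutelyContinuous_add_left P Q
  have hd := (memLp_dqmError (Q := Q) hh hh2 t).integrable_sq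
  have hwh : Integrable (fun x => w x * h x ^ 2) P := by
    refine hh2.bdd_mul hw.aestronglyMeasurable (c := 1) (ae_of_all _ fun x => ?_)
    rw [Real.norm_of_nonneg (hw01 x).1]; exact (hw01 x).2
  have hwi := integrable_mul_rootDensity_sq hPν hwh
  rw [← integral_mul_rootDensity_sq hPν, hellingerSq, dqmError, ← integral_const_mul,
    ← integral_const_mul, ← integral_add (hd.const_mul _) (hwi.const_mul _), ← integral_const_mul]
  refine integral_mono_of_nonneg (ae_of_all _ fun x => mul_nonneg (hw01 x).1 (sq_nonneg _))
    (((hd.const_mul _).add (hwi.const_mul _)).const_mul _) (ae_of_all _ fun x => ?_)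
  simp only
  set q := rootDensity Q (P + Q) x
  set p := rootDensity P (P + Q) x
  obtain ⟨h0, h1⟩ := hw01 x
  set d := (q - p) / t - 1 / 2 * h x * p with hdd
  -- The root densities move by `t` times score plus error, so (x + y)² ≤ 2x² + 2y² separates the
  -- two contributions; the weight is kept only on the score.
  have hq : q - p = t * (d + 1 / 2 * h x * p) := by rw [hdd]; field_simp; ring
  rw [hq, mul_pow]
  have h2 : (d + 1 / 2 * h x * p) ^ 2 ≤ 2 * d ^ 2 + 1 / 2 * h x ^ 2 * p ^ 2 := by
    nlinarith [sq_nonneg (d - 1 / 2 * h x * p)]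
  have h3 : w x * (d + 1 / 2 * h x * p) ^ 2 ≤ 2 * d ^ 2 + 1 / 2 * (w x * h x ^ 2 * p ^ 2) := by
    have := mul_le_mul_of_nonneg_left h2 h0
    nlinarith [mul_le_of_le_one_left (sq_nonneg d) h1]
  calc w x * (t ^ 2 * (d + 1 / 2 * h x * p) ^ 2)
      = t ^ 2 * (w x * (d + 1 / 2 * h x * p) ^ 2) := by ring
    _ ≤ _ := by gcongr

end

/-- Expectations of bounded functions are differentiable along the path, uniformly. -/
lemma abs_integral_sub_sub_le [IsProbabilityMeasure P] [IsFiniteMeasure Q] {h : 𝒲 → ℝ} (hh : Measurable h)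
    (hh2 : Integrable (fun x => h x ^ 2) P) {t : ℝ} (ht : 0 < t) {f : 𝒲 → ℝ} (hf : Measurable f)
    {K : ℝ} (hK : ∀ x, |f x| ≤ K) :
    |∫ x, f x ∂Q - ∫ x, f x ∂P - t * ∫ x, f x * h x ∂P| ≤
      K * (t * (2 * √(dqmError P Q h t) +
        t * (2 * dqmError P Q h t + 1 / 2 * ∫ x, h x ^ 2 ∂P))) := by
  have hPν := absolutelyContinuous_add_left P Q
  have hQν := absolutelyContinuous_add_right P Q
  have hK0 : 0 ≤ K := by
    obtain ⟨x⟩ := P.nonempty_of_neZero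
    exact (abs_nonneg _).trans (hK x)
  have hfi : ∀ {κ : Measure 𝒲} [IsFiniteMeasure κ], Integrable f κ := fun {κ} _ =>
    Integrable.of_bound hf.aestronglyMeasurable K (ae_of_all _ hK)
  have hhL : MemLp h 2 P := (memLp_two_iff_integrable_sq hh.aestronglyMeasurable).2 hh2
  have hfh : Integrable (fun x => f x * h x) P :=
    (hhL.integrable (by norm_num)).bdd_mul hf.aestronglyMeasurable (ae_of_all _ hK)
  have hdL := memLp_dqmError (Q := Q) hh hh2 t
  have hpL := memLp_rootDensity hPν
  have hd := hdL.integrable_sq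
  have hdp := hdL.abs.integrable_mul hpL.abs
  simp only [Pi.mul_def, Pi.abs_def] at hdp
  have hhp := integrable_mul_rootDensity_sq hPν hh2
  have cs := abs_integral_mul_le hdL.abs hpL.abs
  have hp1 : ∫ x, |rootDensity P (P + Q) x| ^ 2 ∂(P + Q) = 1 := by
    simpa [sq_abs] using integral_mul_rootDensity_sq hPν (fun _ => 1)
  simp only [Pi.abs_apply] at cs
  rw [hp1, Real.sqrt_one, mul_one] at cs
  simp only [sq_abs] at cs
  have cs := (le_abs_self _).trans cs
  have hqp : Integrable (fun x => f x * rootDensity Q (P + Q) x ^ 2 -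
      f x * rootDensity P (P + Q) x ^ 2) (P + Q) :=
    (integrable_mul_rootDensity_sq hQν hfi).sub (integrable_mul_rootDensity_sq hPν hfi)
  rw [← integral_mul_rootDensity_sq hQν, ← integral_mul_rootDensity_sq hPν f,
    ← integral_mul_rootDensity_sq hPν (fun x => f x * h x),
    ← integral_mul_rootDensity_sq hPν (fun x => h x ^ 2), ← integral_const_mul,
    ← integral_sub (integrable_mul_rootDensity_sq hQν hfi)
      (integrable_mul_rootDensity_sq hPν hfi),
    ← integral_sub hqp ((integrable_mul_rootDensity_sq hPν hfh).const_mul t)]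
  refine (abs_integral_le_integral_abs).trans ?_
  have hbound : Integrable (fun x => K * (t * (2 * (|(rootDensity Q (P + Q) x -
      rootDensity P (P + Q) x) / t - 1 / 2 * h x * rootDensity P (P + Q) x| *
      |rootDensity P (P + Q) x|) + t * (2 * ((rootDensity Q (P + Q) x -
      rootDensity P (P + Q) x) / t - 1 / 2 * h x * rootDensity P (P + Q) x) ^ 2 +
      1 / 2 * (h x ^ 2 * rootDensity P (P + Q) x ^ 2))))) (P + Q) :=
    (((hdp.const_mul 2).add (((hd.const_mul 2).add (hhp.const_mul (1 / 2))).const_mul t)).const_mul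
      t).const_mul K
  refine (integral_mono_of_nonneg (ae_of_all _ fun x => abs_nonneg _) hbound
    (ae_of_all _ fun x => ?_)).trans ?_
  · simp only
    set q := rootDensity Q (P + Q) x
    set p := rootDensity P (P + Q) x
    set d := (q - p) / t - 1 / 2 * h x * p with hdd
    have hq : q = p + t * (d + 1 / 2 * h x * p) := by rw [hdd]; field_simp; ring
    -- The linear term `t h p²` cancels. What remains is `2 t d p`, controlled by Cauchy–Schwarz
    -- since p² has integral one, and a term of order t².
    have e : f x * q ^ 2 - f x * p ^ 2 - t * (f x * h x * p ^ 2) =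
        f x * (t * (2 * (d * p) + t * (d + 1 / 2 * h x * p) ^ 2)) := by
      rw [hq]; ring
    rw [e, abs_mul, abs_mul, abs_of_pos ht]
    have h2 : (d + 1 / 2 * h x * p) ^ 2 ≤ 2 * d ^ 2 + 1 / 2 * (h x ^ 2 * p ^ 2) := by
      nlinarith [sq_nonneg (d - 1 / 2 * h x * p)]
    have h3 : |2 * (d * p) + t * (d + 1 / 2 * h x * p) ^ 2| ≤
        2 * (|d| * |p|) + t * (2 * d ^ 2 + 1 / 2 * (h x ^ 2 * p ^ 2)) := by
      refine (abs_add_le _ _).trans (add_le_add ?_ ?_)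
      · rw [abs_mul, abs_mul, abs_two]
      · rw [abs_of_nonneg (by positivity)]; gcongr
    exact mul_le_mul (hK x) (by gcongr) (by positivity) hK0
  · have hin := ((hd.const_mul 2).add (hhp.const_mul (1 / 2))).const_mul t
    simp only [Pi.add_apply] at hin
    rw [integral_const_mul, integral_const_mul,
      integral_add (hdp.const_mul 2) hin,
      integral_const_mul, integral_const_mul, integral_add (hd.const_mul 2) (hhp.const_mul (1 / 2)),
      integral_const_mul, integral_const_mul]
    gcongr
    · exact cs
    · exact le_rfl

end Semiparam

/-! ### Propensities and regressions conditional on the annotated event -/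

namespace Semiparam

variable {𝒲 : Type*} {m m0 : MeasurableSpace 𝒲} {Q : Measure 𝒲} {A : Set 𝒲} {e : 𝒲 → ℝ}

/-- `e` is an everywhere positive version of the conditional probability of `A` given `m`. -/
structure IsPropensity (m : MeasurableSpace 𝒲) {m0 : MeasurableSpace 𝒲} (A : Set 𝒲)
    (Q : Measure 𝒲) (e : 𝒲 → ℝ) : Prop where
  measurable : Measurable[m] e
  pos : ∀ x, 0 < e x
  le_one : ∀ x, e x ≤ 1
  condExp_eq : Q⟦A | m⟧ =ᵐ[Q] e

namespace IsPropensity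

/-- On the σ-algebra `m`, conditional probability is exactly a density; all the exchanges between
integrals over `A` and `e`-weighted integrals come from here. -/
lemma trim_restrict_eq [IsProbabilityMeasure Q] (he : IsPropensity m A Q e) (hm : m ≤ m0)
    (hA : MeasurableSet A) :
    (Q.restrict A).trim hm = (Q.withDensity fun x => ENNReal.ofReal (e x)).trim hm := by
  refine @Measure.ext _ m _ _ fun s hs => ?_
  have hei : Integrable e Q := Integrable.of_bound (he.measurable.mono hm le_rfl).aestronglyMeasurable
    1 (ae_of_all _ fun x => by rw [Real.norm_of_nonneg (he.pos x).le]; exact he.le_one x)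
  rw [trim_measurableSet_eq hm hs, trim_measurableSet_eq hm hs, Measure.restrict_apply (hm s hs),
    withDensity_apply _ (hm s hs), ← ofReal_integral_eq_lintegral_ofReal hei.integrableOn
      (ae_of_all _ fun x => (he.pos x).le),
    ← setIntegral_congr_ae (hm s hs) (he.condExp_eq.mono fun x hx _ => hx),
    setIntegral_condExp hm ((integrable_const _).indicator hA) hs, setIntegral_indicator hA,
    setIntegral_const, smul_eq_mul, mul_one, ofReal_measureReal]

variable [IsProbabilityMeasure Q] (he : IsPropensity m A Q e) (hm : m ≤ m0)
  (hA : MeasurableSet A)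

include he hm hA

lemma setLIntegral_eq {r : 𝒲 → ℝ≥0∞} (hr : Measurable[m] r) :
    ∫⁻ x in A, r x ∂Q = ∫⁻ x, ENNReal.ofReal (e x) * r x ∂Q := by
  rw [← lintegral_trim hm hr, he.trim_restrict_eq hm hA, lintegral_trim hm hr,
    lintegral_withDensity_eq_lintegral_mul _ (he.measurable.mono hm le_rfl).ennreal_ofReal
      (hr.mono hm le_rfl)]
  rfl

lemma setIntegral_eq {g : 𝒲 → ℝ} (hg : Measurable[m] g) :
    ∫ x in A, g x ∂Q = ∫ x, e x * g x ∂Q := by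
  rw [integral_trim hm hg.stronglyMeasurable, he.trim_restrict_eq hm hA,
    ← integral_trim hm hg.stronglyMeasurable,
    integral_withDensity_eq_integral_toReal_smul (he.measurable.mono hm le_rfl).ennreal_ofReal
      (ae_of_all _ fun x => ENNReal.ofReal_lt_top)]
  simp [ENNReal.toReal_ofReal (he.pos _).le]

lemma integrableOn_iff {g : 𝒲 → ℝ} (hg : Measurable[m] g) :
    IntegrableOn g A Q ↔ Integrable (fun x => e x * g x) Q := by
  have hg' := (hg.mono hm le_rfl).aestronglyMeasurable (μ := Q)
  have he' := (he.measurable.mono hm le_rfl).aestronglyMeasurable (μ := Q)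
  have := he.setLIntegral_eq hm hA (r := fun x => ‖g x‖ₑ) (measurable_enorm.comp hg)
  simp only [IntegrableOn, Integrable, hg'.restrict, true_and, HasFiniteIntegral,
    this]
  have h2 : ∀ x, ‖e x * g x‖ₑ = ENNReal.ofReal (e x) * ‖g x‖ₑ := fun x => by
    rw [enorm_mul, Real.enorm_of_nonneg (he.pos x).le]
  simp only [h2, iff_and_self]
  exact fun _ => he'.mul hg'

/-- Positivity of `e` is what makes objects defined only up to `Q[|A]`-null sets, such as the
regression, well defined up to `Q`-null sets once they are `m`-measurable. -/
lemma measure_eq_zero {s : Set 𝒲} (hs : MeasurableSet[m] s) (h : Q (s ∩ A) = 0) : Q s = 0 := by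
  have h1 := he.setLIntegral_eq hm hA (r := s.indicator fun _ => 1)
    (Measurable.indicator measurable_const hs)
  rw [lintegral_indicator_const (hm s hs), one_mul, Measure.restrict_apply (hm s hs), h, eq_comm,
    lintegral_eq_zero_iff] at h1
  · rw [measure_eq_zero_iff_ae_notMem]
    filter_upwards [h1] with x hx hxs
    simp [hxs, (he.pos x).not_ge] at hx
  · exact (he.measurable.mono hm le_rfl).ennreal_ofReal.mul
      (measurable_const.indicator (hm s hs))

lemma measure_ne_zero : Q A ≠ 0 := fun h => by
  simpa using he.measure_eq_zero hm hA .univ (by simpa using h)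

lemma isProbabilityMeasure_cond : IsProbabilityMeasure Q[|A] :=
  cond_isProbabilityMeasure (he.measure_ne_zero hm hA)

lemma integrable_cond_iff {f : 𝒲 → ℝ} : Integrable f Q[|A] ↔ IntegrableOn f A Q := by
  rw [ProbabilityTheory.cond, integrable_smul_measure]
  · rfl
  · simp
  · simpa using he.measure_ne_zero hm hA

omit [IsProbabilityMeasure Q] he hm hA in
lemma integral_cond_eq (f : 𝒲 → ℝ) :
    ∫ x, f x ∂Q[|A] = (Q A).toReal⁻¹ * ∫ x in A, f x ∂Q := by
  rw [ProbabilityTheory.cond, integral_smul_measure, smul_eq_mul, ENNReal.toReal_inv]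

lemma setIntegral_eq_iff_cond {f g : 𝒲 → ℝ} :
    ∫ x in A, f x ∂Q = ∫ x in A, g x ∂Q ↔ ∫ x, f x ∂Q[|A] = ∫ x, g x ∂Q[|A] := by
  rw [integral_cond_eq, integral_cond_eq, mul_right_inj' (inv_ne_zero _)]
  exact ENNReal.toReal_ne_zero.2 ⟨he.measure_ne_zero hm hA, measure_ne_top _ _⟩

/-- This is the tower property under `Q[|A]`; the normalizing constant `Q A` cancels. -/
lemma integrableOn_mul_condExp {f g : 𝒲 → ℝ} (hg : Measurable[m] g) (hf : IntegrableOn f A Q)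
    (hgf : IntegrableOn (fun x => g x * f x) A Q) :
    IntegrableOn (fun x => g x * (Q[|A])[f | m] x) A Q ∧
      ∫ x in A, g x * (Q[|A])[f | m] x ∂Q = ∫ x in A, g x * f x ∂Q := by
  have := he.isProbabilityMeasure_cond hm hA
  rw [← he.integrable_cond_iff hm hA] at hf hgf ⊢
  rw [he.setIntegral_eq_iff_cond hm hA]
  have h := condExp_mul_of_stronglyMeasurable_left hg.stronglyMeasurable hgf hf
  constructor
  · exact integrable_condExp.congr h
  · rw [← integral_condExp hm (f := fun x => g x * f x)]
    exact integral_congr_ae h.symm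

/-- The inverse propensity weighted form of the mean of the regression function. -/
lemma integral_condExp_eq {f : 𝒲 → ℝ} (hf : IntegrableOn f A Q)
    (hfe : IntegrableOn (fun x => (e x)⁻¹ * f x) A Q) :
    Integrable ((Q[|A])[f | m]) Q ∧
      ∫ x, (Q[|A])[f | m] x ∂Q = ∫ x in A, (e x)⁻¹ * f x ∂Q := by
  have hmu : Measurable[m] ((Q[|A])[f | m]) := stronglyMeasurable_condExp.measurable
  obtain ⟨h1, h2⟩ := he.integrableOn_mul_condExp hm hA he.measurable.inv hf hfe
  have hmeas := he.measurable.inv.mul hmu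
  have hcancel : (fun x => e x * ((e x)⁻¹ * (Q[|A])[f | m] x)) = (Q[|A])[f | m] := by
    ext x
    rw [← mul_assoc, mul_inv_cancel₀ (he.pos x).ne', one_mul]
  constructor
  · rw [← hcancel]
    exact (he.integrableOn_iff hm hA hmeas).1 h1
  · simp only [Pi.inv_apply] at h2
    rw [← h2]
    have := he.setIntegral_eq hm hA hmeas
    simp only [Pi.mul_apply, Pi.inv_apply] at this
    rw [this, hcancel]

/-- The regression and `F` define the same measure on `m` under `Q[|A]`, so they have the same
integral against the `m`-measurable weight 1/e. Passing from `A` to the whole space multiplies by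
`e` and removes that weight. -/
lemma lintegral_condLExp_eq {F : 𝒲 → ℝ≥0∞} (hF : Measurable F) :
    ∫⁻ x, condLExp m Q[|A] F x ∂Q = ∫⁻ x in A, ENNReal.ofReal (e x)⁻¹ * F x ∂Q := by
  have := he.isProbabilityMeasure_cond hm hA
  have hr : Measurable[m] (condLExp m Q[|A] F) := measurable_condLExp m _ F
  have hei : Measurable[m] fun x => ENNReal.ofReal (e x)⁻¹ := he.measurable.inv.ennreal_ofReal
  have key : (Q[|A].withDensity (condLExp m Q[|A] F)).trim hm = (Q[|A].withDensity F).trim hm := by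
    refine @Measure.ext _ m _ _ fun s hs => ?_
    rw [trim_measurableSet_eq hm hs, trim_measurableSet_eq hm hs, withDensity_apply _ (hm s hs),
      withDensity_apply _ (hm s hs), setLIntegral_condLExp hm _ _ hs]
  have h2 : ∫⁻ x, condLExp m Q[|A] F x * ENNReal.ofReal (e x)⁻¹ ∂Q[|A] =
      ∫⁻ x, F x * ENNReal.ofReal (e x)⁻¹ ∂Q[|A] := by
    have h3 := lintegral_trim hm (μ := Q[|A].withDensity F) hei
    rw [← key, lintegral_trim hm hei,
      lintegral_withDensity_eq_lintegral_mul _ hF (hei.mono hm le_rfl),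
      lintegral_withDensity_eq_lintegral_mul _ (hr.mono hm le_rfl) (hei.mono hm le_rfl)] at h3
    exact h3
  have hc : ∀ G : 𝒲 → ℝ≥0∞, ∫⁻ x, G x ∂Q[|A] = (Q A)⁻¹ * ∫⁻ x in A, G x ∂Q := fun G => by
    rw [ProbabilityTheory.cond, lintegral_smul_measure, smul_eq_mul]
  have h4 := he.setLIntegral_eq hm hA (hr.mul hei)
  simp only [Pi.mul_apply] at h4
  rw [hc, hc, ENNReal.mul_right_inj (ENNReal.inv_ne_zero.2 (measure_ne_top _ _))
      (ENNReal.inv_ne_top.2 (he.measure_ne_zero hm hA)),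
    h4] at h2
  simp only [mul_comm (F _)] at h2
  rw [← h2]
  refine lintegral_congr fun x => ?_
  rw [mul_left_comm, ← ENNReal.ofReal_mul (he.pos x).le, mul_inv_cancel₀ (he.pos x).ne',
    ENNReal.ofReal_one, mul_one]

end IsPropensity

lemma exists_isPropensity [IsProbabilityMeasure Q] (hA : MeasurableSet A)
    (hpos : ∀ᵐ x ∂Q, 0 < (Q⟦A | m⟧) x) : ∃ e, IsPropensity m A Q e := by
  have hmeas : Measurable[m] (Q⟦A | m⟧) := stronglyMeasurable_condExp.measurable
  have hle : ∀ᵐ x ∂Q, (Q⟦A | m⟧) x ≤ 1 := by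
    by_cases hm : m ≤ m0
    · have := condExp_mono (m := m) (μ := Q) (f := A.indicator fun _ => (1 : ℝ)) (g := fun _ => 1)
        ((integrable_const _).indicator hA) (integrable_const _)
        (ae_of_all _ fun x => Set.indicator_le_self' (by simp) x)
      rwa [condExp_const hm] at this
    · simp [condExp_of_not_le hm]
  set s : Set 𝒲 := {x | 0 < (Q⟦A | m⟧) x ∧ (Q⟦A | m⟧) x ≤ 1} with hs
  have hsm : MeasurableSet[m] s :=
    (measurableSet_lt measurable_const hmeas).inter (measurableSet_le hmeas measurable_const)
  classical
  -- Off the full-measure set `s` the value is arbitrary in (0, 1]; `1` makes the bounds hold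
  -- everywhere.
  refine ⟨s.piecewise (Q⟦A | m⟧) fun _ => 1,
    Measurable.piecewise hsm hmeas measurable_const, fun x => ?_, fun x => ?_, ?_⟩
  · by_cases h : x ∈ s
    · simpa [h] using h.1
    · simp [h]
  · by_cases h : x ∈ s
    · simpa [h] using h.2
    · simp [h]
  · filter_upwards [hpos, hle] with x h1 h2
    rw [Set.piecewise_eq_of_mem _ _ _ (show x ∈ s from ⟨h1, h2⟩)]

end Semiparam

/-! ### Expansion of the functional for bounded functions -/

namespace Semiparam

variable {𝒲 : Type*} {m m0 : MeasurableSpace 𝒲} {P Q : Measure 𝒲} {A : Set 𝒲} {e e' : 𝒲 → ℝ}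

/-- The augmented inverse propensity weighted score of `f`, not centered. -/
noncomputable def aipw (m : MeasurableSpace 𝒲) {m0 : MeasurableSpace 𝒲} (A : Set 𝒲)
    (P : Measure 𝒲) (e f : 𝒲 → ℝ) (x : 𝒲) : ℝ :=
  A.indicator (fun x => (e x)⁻¹ * (f x - (P[|A])[f | m] x)) x + (P[|A])[f | m] x

/-- The bound `K` holds `Q[|A]`-a.e. and the exceptional set is `m`-measurable, so it is `Q`-null by
`measure_eq_zero`. Clamping to [-K, K] then gives a version bounded everywhere, which the uniform
expansions along paths require. -/
lemma IsPropensity.exists_bounded_condExp [IsProbabilityMeasure Q] (he : IsPropensity m A Q e)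
    (hm : m ≤ m0) (hA : MeasurableSet A) {f : 𝒲 → ℝ} (hf : Measurable f) {K : ℝ}
    (hK : ∀ x, |f x| ≤ K) :
    ∃ μ : 𝒲 → ℝ, Measurable[m] μ ∧ (∀ x, |μ x| ≤ K) ∧ μ =ᵐ[Q] (Q[|A])[f | m] ∧
      ∀ g : 𝒲 → ℝ, Measurable[m] g → ∀ C, (∀ x, |g x| ≤ C) →
        ∫ x in A, g x * (f x - μ x) ∂Q = 0 := by
  have hK0 : 0 ≤ K := by
    obtain ⟨x⟩ := Q.nonempty_of_neZero
    exact (abs_nonneg _).trans (hK x)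
  have hprob := he.isProbabilityMeasure_cond hm hA
  have hmu : Measurable[m] ((Q[|A])[f | m]) := stronglyMeasurable_condExp.measurable
  have hbd : ∀ᵐ x ∂Q[|A], |(Q[|A])[f | m] x| ≤ K :=
    ae_bdd_abs_condExp_of_ae_bdd_abs (ae_of_all _ hK)
  have hbd' : ∀ᵐ x ∂Q, |(Q[|A])[f | m] x| ≤ K := by
    have hs : MeasurableSet[m] {x | ¬ |(Q[|A])[f | m] x| ≤ K} :=
      (measurableSet_le (measurable_norm.comp hmu) measurable_const).compl
    refine he.measure_eq_zero hm hA hs ?_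
    have : Q[|A] {x | ¬ |(Q[|A])[f | m] x| ≤ K} = 0 := hbd
    rw [cond_apply hA, mul_eq_zero, Set.inter_comm] at this
    exact this.resolve_left (ENNReal.inv_ne_zero.2 (measure_ne_top _ _))
  have hae : (fun x => max (-K) (min K ((Q[|A])[f | m] x))) =ᵐ[Q] (Q[|A])[f | m] := by
    filter_upwards [hbd'] with x hx
    rw [min_eq_right (abs_le.1 hx).2, max_eq_right (abs_le.1 hx).1]
  have hmm : Measurable[m] fun x => max (-K) (min K ((Q[|A])[f | m] x)) :=
    measurable_const.max (measurable_const.min hmu)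
  refine ⟨_, hmm, fun x => abs_le.2 ⟨le_max_left _ _, max_le (by linarith) (min_le_left _ _)⟩, hae,
    fun g hg C hC => ?_⟩
  have hfi : IntegrableOn f A Q :=
    (Integrable.of_bound hf.aestronglyMeasurable K (ae_of_all _ hK)).integrableOn
  have hgf : IntegrableOn (fun x => g x * f x) A Q :=
    hfi.bdd_mul (hg.mono hm le_rfl).aestronglyMeasurable (ae_of_all _ hC)
  obtain ⟨h1, h2⟩ := he.integrableOn_mul_condExp hm hA hg hfi hgf
  calc _ = ∫ x in A, (g x * f x - g x * (Q[|A])[f | m] x) ∂Q := by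
        refine integral_congr_ae ?_
        filter_upwards [ae_restrict_of_ae hae] with x hx
        rw [hx, mul_sub]
    _ = 0 := by rw [integral_sub hgf h1, h2, sub_self]

/-- The first order remainder of a path with score `h`. -/
noncomputable def pathRemainder (P Q : Measure 𝒲) (h : 𝒲 → ℝ) (t : ℝ) : ℝ :=
  t * (2 * √(dqmError P Q h t) + t * (2 * dqmError P Q h t + 1 / 2 * ∫ x, h x ^ 2 ∂P))

/-- The inverse weight 1_A/e has conditional mean one given `m`. -/
lemma integral_mul_one_sub_indicator [IsProbabilityMeasure P] (he : IsPropensity m A P e)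
    (hm : m ≤ m0) (hA : MeasurableSet A) {η : ℝ} (hη : 0 < η) (heη : ∀ x, η ≤ e x) {b : 𝒲 → ℝ}
    (hb : Measurable[m] b) {C : ℝ} (hC : ∀ x, |b x| ≤ C) :
    ∫ x, b x * (1 - A.indicator (fun x => (e x)⁻¹) x) ∂P = 0 := by
  have hbi : Integrable b P :=
    Integrable.of_bound (hb.mono hm le_rfl).aestronglyMeasurable C (ae_of_all _ hC)
  have hei : Measurable[m] fun x => b x * (e x)⁻¹ := hb.mul he.measurable.inv
  have hbe : Integrable (fun x => b x * (e x)⁻¹) P := by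
    refine hbi.mul_bdd (he.measurable.inv.mono hm le_rfl).aestronglyMeasurable (c := η⁻¹)
      (ae_of_all _ fun x => ?_)
    rw [Real.norm_of_nonneg (inv_nonneg.2 (he.pos x).le)]
    exact inv_anti₀ hη (heη x)
  have h1 := he.setIntegral_eq hm hA hei
  rw [← integral_indicator hA] at h1
  have h2 : ∀ x, b x * (1 - A.indicator (fun x => (e x)⁻¹) x) =
      b x - A.indicator (fun x => b x * (e x)⁻¹) x := by
    intro x
    by_cases hx : x ∈ A <;> simp [hx]; ring
  simp only [h2]
  rw [integral_sub hbi (hbe.indicator hA), h1, sub_eq_zero]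
  congr 1 with x
  have := (he.pos x).ne'
  field_simp

/-- Expansion of the inverse propensity weighted functional of a bounded function. -/
lemma abs_integral_condExp_sub_le [IsProbabilityMeasure P] [IsProbabilityMeasure Q]
    (he : IsPropensity m A P e) (he' : IsPropensity m A Q e')
    (hm : m ≤ m0) (hA : MeasurableSet A) {η : ℝ} (hη : 0 < η) (heη : ∀ x, η ≤ e x)
    {h : 𝒲 → ℝ} (hh : Measurable h) (hh2 : Integrable (fun x => h x ^ 2) P) {t : ℝ} (ht : 0 < t)
    {f : 𝒲 → ℝ} (hf : Measurable f) {K : ℝ} (hK : ∀ x, |f x| ≤ K) :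
    |∫ x, (Q[|A])[f | m] x ∂Q - ∫ x, (P[|A])[f | m] x ∂P - t * ∫ x, aipw m A P e f x * h x ∂P| ≤
      (η⁻¹ * (2 * K) + K) * pathRemainder P Q h t +
      (2 * K * (1 + η⁻¹) * pathRemainder P Q h t +
      t * (√(2 * K * (1 + η⁻¹) * ((1 + η⁻¹) * (η⁻¹ *
        (2 * K * pathRemainder P Q h t + t * (2 * K * ∫ x, |h x| ∂P))))) *
        √(∫ x, h x ^ 2 ∂P))) := by
  obtain ⟨μ, hμ, hμK, hμe, hμ0⟩ := he.exists_bounded_condExp hm hA hf hK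
  obtain ⟨ν, hν, hνK, hνe, hν0⟩ := he'.exists_bounded_condExp hm hA hf hK
  have hμ' := hμ.mono hm le_rfl
  have hν' := hν.mono hm le_rfl
  have heM := he.measurable.mono hm le_rfl
  have hK0 : 0 ≤ K := by
    obtain ⟨x⟩ := P.nonempty_of_neZero
    exact (abs_nonneg _).trans (hK x)
  have hinv : ∀ x, |(e x)⁻¹| ≤ η⁻¹ := fun x => by
    rw [abs_of_nonneg (inv_nonneg.2 (he.pos x).le)]
    exact inv_anti₀ hη (heη x)
  have hη' : 0 ≤ η⁻¹ := by positivity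
  have bd : ∀ {κ : Measure 𝒲} [IsFiniteMeasure κ] {F : 𝒲 → ℝ}, Measurable F → ∀ C,
      (∀ x, |F x| ≤ C) → Integrable F κ := fun hF C hC =>
    Integrable.of_bound hF.aestronglyMeasurable C (ae_of_all _ hC)
  -- A bounded version of the uncentered `aipw` score, to which `abs_integral_sub_sub_le` applies.
  set ψ : 𝒲 → ℝ := fun x => A.indicator (fun x => (e x)⁻¹ * (f x - μ x)) x + μ x with hψ
  have hI : Measurable (A.indicator fun x => (e x)⁻¹ * (f x - μ x)) :=
    (heM.inv.mul (hf.sub hμ')).indicator hA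
  have hIK : ∀ x, |A.indicator (fun x => (e x)⁻¹ * (f x - μ x)) x| ≤ η⁻¹ * (2 * K) := fun x => by
    by_cases hx : x ∈ A
    · rw [Set.indicator_of_mem hx, abs_mul]
      exact mul_le_mul (hinv x) ((abs_sub _ _).trans (by linarith [hK x, hμK x])) (abs_nonneg _) hη'
    · rw [Set.indicator_of_notMem hx, abs_zero]; positivity
  have hψm : Measurable ψ := hI.add hμ'
  have hψK : ∀ x, |ψ x| ≤ η⁻¹ * (2 * K) + K := fun x =>
    (abs_add_le _ _).trans (add_le_add (hIK x) (hμK x))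
  have hψP : ∫ x, ψ x ∂P = ∫ x, (P[|A])[f | m] x ∂P := by
    have h0 := hμ0 _ he.measurable.inv _ hinv
    simp only [Pi.inv_apply] at h0
    rw [hψ, integral_add (bd hI _ hIK) (bd hμ' _ hμK), integral_indicator hA, h0, zero_add]
    exact integral_congr_ae hμe
  have hψh : ∫ x, aipw m A P e f x * h x ∂P = ∫ x, ψ x * h x ∂P := by
    refine integral_congr_ae ?_
    filter_upwards [hμe] with x hx
    by_cases hxA : x ∈ A <;> simp [aipw, hψ, hx, hxA]
  set b : 𝒲 → ℝ := fun x => ν x - μ x with hb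
  have hbm : Measurable[m] b := hν.sub hμ
  have hbm' := hbm.mono hm le_rfl
  have hbK : ∀ x, |b x| ≤ 2 * K := fun x => (abs_sub _ _).trans (by linarith [hνK x, hμK x])
  -- The second-order remainder: `c` has `P`-mean zero and the same `Q`-mean as `ν - ψ`, since the
  -- residual `f - ν` is orthogonal under `Q` on `A` to the `m`-measurable weight 1/e. Only the
  -- propensity of `P` is inverted.
  set c : 𝒲 → ℝ := fun x => b x * (1 - A.indicator (fun x => (e x)⁻¹) x) with hc
  have hcm : Measurable c := hbm'.mul (measurable_const.sub (heM.inv.indicator hA))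
  have hcb : ∀ x, |c x| ≤ |b x| * (1 + η⁻¹) := fun x => by
    rw [hc, abs_mul]
    refine mul_le_mul_of_nonneg_left ((abs_sub _ _).trans ?_) (abs_nonneg _)
    rw [abs_one]
    gcongr
    by_cases hx : x ∈ A
    · rw [Set.indicator_of_mem hx]; exact hinv x
    · rw [Set.indicator_of_notMem hx, abs_zero]; exact hη'
  have hcK : ∀ x, |c x| ≤ 2 * K * (1 + η⁻¹) := fun x =>
    (hcb x).trans (mul_le_mul_of_nonneg_right (hbK x) (by positivity))
  have hcP : ∫ x, c x ∂P = 0 := integral_mul_one_sub_indicator he hm hA hη heη hbm hbK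
  have hcQ : ∫ x, c x ∂Q = ∫ x, (Q[|A])[f | m] x ∂Q - ∫ x, ψ x ∂Q := by
    have h0 := hν0 _ he.measurable.inv _ hinv
    rw [← integral_indicator hA] at h0
    have hJ : Measurable (A.indicator fun x => (e x)⁻¹ * (f x - ν x)) :=
      (heM.inv.mul (hf.sub hν')).indicator hA
    have hJK : ∀ x, |A.indicator (fun x => (e x)⁻¹ * (f x - ν x)) x| ≤ η⁻¹ * (2 * K) := fun x => by
      by_cases hx : x ∈ A
      · rw [Set.indicator_of_mem hx, abs_mul]
        exact mul_le_mul (hinv x) ((abs_sub _ _).trans (by linarith [hK x, hνK x]))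
          (abs_nonneg _) hη'
      · rw [Set.indicator_of_notMem hx, abs_zero]; positivity
    have h1 : Integrable (fun x => A.indicator (fun x => (e x)⁻¹ * (f x - ν x)) x) Q := bd hJ _ hJK
    simp only [Pi.inv_apply] at h0
    have h2 : Integrable (fun x => ν x - ψ x) Q := (bd hν' _ hνK).sub (bd hψm _ hψK)
    rw [← integral_congr_ae hνe, ← integral_sub (bd hν' _ hνK) (bd hψm _ hψK),
      ← add_zero (∫ x, ν x - ψ x ∂Q), ← h0, ← integral_add h2 h1]
    congr 1 with x
    by_cases hx : x ∈ A <;> simp [hc, hb, hψ, hx]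
    ring
  have hhL : MemLp h 2 P := (memLp_two_iff_integrable_sq hh.aestronglyMeasurable).2 hh2
  have hbL1 : ∫ x, |b x| ∂P ≤
      η⁻¹ * (2 * K * pathRemainder P Q h t + t * (2 * K * ∫ x, |h x| ∂P)) := by
    -- Testing `f - ν` on `A` against the sign of `b` gives zero under `Q` and minus the integral of
    -- `|b|` over `A` under `P`. Expanding this bounded test function along the path shows that `b`
    -- is of first order in L¹(P).
    set σ : 𝒲 → ℝ := fun x => if 0 ≤ b x then 1 else -1 with hσ
    have hσm : Measurable[m] σ :=
      Measurable.ite (measurableSet_le measurable_const hbm) measurable_const measurable_const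
    have hσ1 : ∀ x, |σ x| ≤ 1 := fun x => by
      by_cases hx : 0 ≤ b x <;> simp [hσ, hx]
    have hσb : ∀ x, |b x| = σ x * b x := fun x => by
      by_cases hx : 0 ≤ b x
      · simp [hσ, hx, abs_of_nonneg hx]
      · simp [hσ, hx, abs_of_neg (not_le.1 hx)]
    set F : 𝒲 → ℝ := A.indicator fun x => σ x * (f x - ν x) with hF
    have hFm : Measurable F := ((hσm.mono hm le_rfl).mul (hf.sub hν')).indicator hA
    have hFK : ∀ x, |F x| ≤ 2 * K := fun x => by
      by_cases hx : x ∈ A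
      · rw [hF, Set.indicator_of_mem hx, abs_mul]
        exact (mul_le_of_le_one_left (abs_nonneg _) (hσ1 x)).trans
          ((abs_sub _ _).trans (by linarith [hK x, hνK x]))
      · rw [hF, Set.indicator_of_notMem hx, abs_zero]; positivity
    have hFQ : ∫ x, F x ∂Q = 0 := by
      rw [hF, integral_indicator hA]; exact hν0 _ hσm _ hσ1
    have hFP : ∫ x, F x ∂P = - ∫ x in A, |b x| ∂P := by
      have h0 := hμ0 _ hσm _ hσ1
      rw [hF, integral_indicator hA, ← sub_zero (∫ x in A, _ ∂P), ← h0, ← integral_neg,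
        ← integral_sub]
      · congr 1 with x
        rw [hσb, hb]; ring
      · refine (bd (C := 2 * K) ((hσm.mono hm le_rfl).mul (hf.sub hν')) fun x => ?_).integrableOn
        simp only [Pi.mul_apply, Pi.sub_apply]
        rw [abs_mul]
        exact (mul_le_of_le_one_left (abs_nonneg _) (hσ1 x)).trans
          ((abs_sub _ _).trans (by linarith [hK x, hνK x]))
      · refine (bd (C := 2 * K) ((hσm.mono hm le_rfl).mul (hf.sub hμ')) fun x => ?_).integrableOn
        simp only [Pi.mul_apply, Pi.sub_apply]
        rw [abs_mul]
        exact (mul_le_of_le_one_left (abs_nonneg _) (hσ1 x)).trans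
          ((abs_sub _ _).trans (by linarith [hK x, hμK x]))
    have h3 := abs_integral_sub_sub_le (Q := Q) hh hh2 ht hFm hFK
    rw [hFQ, hFP] at h3
    have hFh : |∫ x, F x * h x ∂P| ≤ 2 * K * ∫ x, |h x| ∂P := by
      rw [← integral_const_mul]
      refine (abs_integral_le_integral_abs).trans (integral_mono_of_nonneg
        (ae_of_all _ fun x => abs_nonneg _) ((hhL.integrable (by norm_num)).abs.const_mul _)
        (ae_of_all _ fun x => ?_))
      simp only [abs_mul]
      exact mul_le_mul_of_nonneg_right (hFK x) (abs_nonneg _)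
    have h4 : ∫ x in A, |b x| ∂P ≤ 2 * K * pathRemainder P Q h t + t * (2 * K * ∫ x, |h x| ∂P) := by
      have h5 := (abs_le.1 h3).2
      have h6 := mul_le_mul_of_nonneg_left (le_of_abs_le hFh) ht.le
      rw [pathRemainder]
      linarith
    have h7 : η * ∫ x, |b x| ∂P ≤ ∫ x in A, |b x| ∂P := by
      have h8 := he.setIntegral_eq hm hA (measurable_norm.comp hbm)
      simp only [Function.comp_apply, Real.norm_eq_abs] at h8
      rw [h8, ← integral_const_mul]
      refine integral_mono_of_nonneg (ae_of_all _ fun x => mul_nonneg hη.le (abs_nonneg _)) ?_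
        (ae_of_all _ fun x => mul_le_mul_of_nonneg_right (heη x) (abs_nonneg _))
      refine bd (heM.mul (measurable_norm.comp hbm')) (2 * K) fun x => ?_
      rw [abs_mul, abs_abs, abs_of_pos (he.pos x)]
      exact (mul_le_of_le_one_left (abs_nonneg _) (he.le_one x)).trans (hbK x)
    rw [inv_mul_eq_div, le_div_iff₀ hη, mul_comm]
    exact h7.trans h4
  have hch : |∫ x, c x * h x ∂P| ≤ √(2 * K * (1 + η⁻¹) * ((1 + η⁻¹) * (η⁻¹ *
        (2 * K * pathRemainder P Q h t + t * (2 * K * ∫ x, |h x| ∂P))))) *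
        √(∫ x, h x ^ 2 ∂P) := by
    have hcL : MemLp c 2 P := MemLp.of_bound hcm.aestronglyMeasurable _ (ae_of_all _ hcK)
    refine (abs_integral_mul_le hcL hhL).trans ?_
    gcongr
    -- Boundedness turns the L¹ bound into an L² bound: ∫ c² ≤ sup |c| · ∫ |c|. The rate √t
    -- suffices, because this factor gets multiplied by `t`.
    calc ∫ x, c x ^ 2 ∂P ≤ ∫ x, 2 * K * (1 + η⁻¹) * ((1 + η⁻¹) * |b x|) ∂P := by
          refine integral_mono hcL.integrable_sq
            (((bd (κ := P) hbm' _ hbK).abs.const_mul _).const_mul _) fun x => ?_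
          simp only
          rw [← sq_abs, sq]
          exact mul_le_mul (hcK x) (by rw [mul_comm]; exact hcb x) (abs_nonneg _) (by positivity)
      _ = 2 * K * (1 + η⁻¹) * ((1 + η⁻¹) * ∫ x, |b x| ∂P) := by
          rw [integral_const_mul, integral_const_mul]
      _ ≤ _ := by gcongr
  have r1 := abs_integral_sub_sub_le (Q := Q) hh hh2 ht hψm hψK
  have r2 := abs_integral_sub_sub_le (Q := Q) hh hh2 ht hcm hcK
  rw [hψP] at r1
  rw [hcP, hcQ] at r2
  rw [hψh]
  simp only [pathRemainder] at hch ⊢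
  have r3 := mul_le_mul_of_nonneg_left hch ht.le
  rw [← abs_of_pos ht, ← abs_mul, abs_of_pos ht] at r3
  rw [abs_le] at r1 r2 r3 ⊢
  constructor <;> linarith [r1.1, r1.2, r2.1, r2.2, r3.1, r3.2]

end Semiparam

/-! ### Stability of the propensity; weighted moments -/

namespace Semiparam

variable {𝒲 : Type*} {m m0 : MeasurableSpace 𝒲} {P Q : Measure 𝒲} {A : Set 𝒲} {e e' : 𝒲 → ℝ}

lemma integrable_of_measurable_bounded {κ : Measure 𝒲} [IsFiniteMeasure κ] {F : 𝒲 → ℝ}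
    (hF : Measurable F) {C : ℝ} (hC : ∀ x, |F x| ≤ C) : Integrable F κ :=
  Integrable.of_bound hF.aestronglyMeasurable C (ae_of_all _ hC)

lemma IsPropensity.integral_mul_sub_indicator [IsProbabilityMeasure P]
    (he : IsPropensity m A P e) (hm : m ≤ m0) (hA : MeasurableSet A) {r : 𝒲 → ℝ}
    (hr : Measurable[m] r) {C : ℝ} (hC : ∀ x, |r x| ≤ C) :
    ∫ x, r x * (e x - A.indicator (fun _ => 1) x) ∂P = 0 := by
  have hri : Integrable r P := integrable_of_measurable_bounded (hr.mono hm le_rfl) hC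
  have h2 : ∀ x, r x * (e x - A.indicator (fun _ => 1) x) = e x * r x - A.indicator r x := by
    intro x
    by_cases hx : x ∈ A <;> simp [hx] <;> ring
  simp only [h2]
  rw [integral_sub ((he.integrableOn_iff hm hA hr).1 hri.integrableOn) (hri.indicator hA),
    integral_indicator hA, he.setIntegral_eq hm hA hr, sub_self]

/-- Add the hypotheses and use (a + b)² ≤ 2(a² + b²). -/
lemma add_le_of_sq_le {a b d : ℝ} (ha : 0 ≤ a) (hb : 0 ≤ b) (hd : 0 ≤ d) (h1 : a ^ 2 ≤ d * (a + b))
    (h2 : b ^ 2 ≤ d * (a + b)) : a + b ≤ 4 * d := by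
  by_contra hlt
  push Not at hlt
  rcases (add_nonneg ha hb).eq_or_lt with h0 | h0
  · linarith
  · nlinarith [sq_nonneg (a - b)]

/-- The distance of the propensities is controlled by the Hellinger distance. -/
lemma integral_mul_sub_sq_le_hellingerSq [IsProbabilityMeasure P] [IsProbabilityMeasure Q]
    (he : IsPropensity m A P e) (he' : IsPropensity m A Q e') (hm : m ≤ m0) (hA : MeasurableSet A)
    {w : 𝒲 → ℝ} (hw : Measurable[m] w) (hw01 : ∀ x, 0 ≤ w x ∧ w x ≤ 1) :
    ∫ x, w x * (e' x - e x) ^ 2 ∂P ≤ 16 * hellingerSq P Q w ∧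
      ∫ x, w x * (e' x - e x) ^ 2 ∂Q ≤ 16 * hellingerSq P Q w := by
  have heM := he.measurable.mono hm le_rfl
  have heM' := he'.measurable.mono hm le_rfl
  have hwM := hw.mono hm le_rfl
  have h1A : Measurable (A.indicator fun _ => (1 : ℝ)) := measurable_const.indicator hA
  have hd1 : ∀ x, |e' x - e x| ≤ 1 := fun x => by
    rw [abs_le]; constructor <;> linarith [he.pos x, he'.pos x, he.le_one x, he'.le_one x]
  have hI : ∀ {ε : 𝒲 → ℝ}, (∀ x, 0 < ε x) → (∀ x, ε x ≤ 1) → ∀ x,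
      |ε x - A.indicator (fun _ => 1) x| ≤ 1 := fun h0 h1 x => by
    rw [abs_le]
    by_cases hx : x ∈ A <;> simp [hx] <;> constructor <;> linarith [h0 x, h1 x]
  have hwd : Measurable[m] fun x => w x * (e' x - e x) := hw.mul (he'.measurable.sub he.measurable)
  have hwd1 : ∀ x, |w x * (e' x - e x)| ≤ 1 := fun x => by
    rw [abs_mul, abs_of_nonneg (hw01 x).1]
    exact mul_le_one₀ (hw01 x).2 (abs_nonneg _) (hd1 x)
  have hwsq : ∀ {κ : Measure 𝒲} [IsFiniteMeasure κ],
      Integrable (fun x => w x * (e' x - e x) ^ 2) κ := by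
    intro κ _
    refine integrable_of_measurable_bounded (hwM.mul ((heM'.sub heM).pow_const 2)) (C := 1)
      fun x => ?_
    rw [sq, ← mul_assoc, abs_mul]
    exact mul_le_one₀ (hwd1 x) (abs_nonneg _) (hd1 x)
  have key : ∀ {ε : 𝒲 → ℝ}, Measurable ε → (∀ x, 0 < ε x) → (∀ x, ε x ≤ 1) →
      |∫ x, w x * ((e' x - e x) * (ε x - A.indicator (fun _ => 1) x)) ∂Q -
        ∫ x, w x * ((e' x - e x) * (ε x - A.indicator (fun _ => 1) x)) ∂P| ≤
      √(hellingerSq P Q w) * (√(∫ x, w x * (e' x - e x) ^ 2 ∂P) +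
        √(∫ x, w x * (e' x - e x) ^ 2 ∂Q)) := by
    intro ε hε h0 h1
    have hle : ∀ x, w x * ((e' x - e x) * (ε x - A.indicator (fun _ => 1) x)) ^ 2 ≤
        w x * (e' x - e x) ^ 2 := fun x => by
      rw [mul_pow]
      exact mul_le_mul_of_nonneg_left (mul_le_of_le_one_right (sq_nonneg _)
        ((sq_le_one_iff_abs_le_one _).2 (hI h0 h1 x))) (hw01 x).1
    have hFm : Measurable fun x => (e' x - e x) * (ε x - A.indicator (fun _ => 1) x) :=
      (heM'.sub heM).mul (hε.sub h1A)
    have hFi : ∀ {κ : Measure 𝒲} [IsFiniteMeasure κ], Integrable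
        (fun x => w x * ((e' x - e x) * (ε x - A.indicator (fun _ => 1) x)) ^ 2) κ := by
      intro κ _
      refine hwsq.mono (hwM.mul (hFm.pow_const 2)).aestronglyMeasurable (ae_of_all _ fun x => ?_)
      rw [Real.norm_of_nonneg (mul_nonneg (hw01 x).1 (sq_nonneg _)),
        Real.norm_of_nonneg (mul_nonneg (hw01 x).1 (sq_nonneg _))]
      exact hle x
    refine (abs_integral_sub_integral_le_hellinger hwM hw01 hFm hFi hFi).trans ?_
    rw [add_comm (√(∫ x, w x * (e' x - e x) ^ 2 ∂P))]
    gcongr ?_ * (√?_ + √?_)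
    · exact integral_mono hFi hwsq hle
    · exact integral_mono hFi hwsq hle
  -- The difference `e' - e` equals (e' - 1_A) - (e - 1_A). Against `m`-measurable weights the first
  -- residual has mean zero under `Q` and the second under `P`, so under each law a single residual
  -- survives, and it is one with mean zero under the other law.
  have split : ∀ {κ : Measure 𝒲} [IsFiniteMeasure κ],
      ∫ x, w x * (e' x - e x) ^ 2 ∂κ =
        ∫ x, w x * ((e' x - e x) * (e' x - A.indicator (fun _ => 1) x)) ∂κ -
        ∫ x, w x * ((e' x - e x) * (e x - A.indicator (fun _ => 1) x)) ∂κ := by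
    intro κ _
    have hi : ∀ {ε : 𝒲 → ℝ}, Measurable ε → (∀ x, 0 < ε x) → (∀ x, ε x ≤ 1) →
        Integrable (fun x => w x * ((e' x - e x) * (ε x - A.indicator (fun _ => 1) x))) κ := by
      intro ε hε h0 h1
      refine integrable_of_measurable_bounded (hwM.mul ((heM'.sub heM).mul (hε.sub h1A))) (C := 1)
        fun x => ?_
      rw [← mul_assoc, abs_mul]
      exact mul_le_one₀ (hwd1 x) (abs_nonneg _) (hI h0 h1 x)
    rw [← integral_sub (hi heM' he'.pos he'.le_one) (hi heM he.pos he.le_one)]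
    congr 1 with x
    ring
  have zP : ∫ x, w x * ((e' x - e x) * (e x - A.indicator (fun _ => 1) x)) ∂P = 0 := by
    simpa only [mul_assoc] using he.integral_mul_sub_indicator hm hA hwd hwd1
  have zQ : ∫ x, w x * ((e' x - e x) * (e' x - A.indicator (fun _ => 1) x)) ∂Q = 0 := by
    simpa only [mul_assoc] using he'.integral_mul_sub_indicator hm hA hwd hwd1
  have sP := split (κ := P)
  have sQ := split (κ := Q)
  have k1 := key heM' he'.pos he'.le_one
  have k2 := key heM he.pos he.le_one
  rw [zP, sub_zero] at sP
  rw [zQ, zero_sub] at sQ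
  rw [zQ, zero_sub, abs_neg, ← sP] at k1
  rw [zP, sub_zero, ← abs_neg, ← sQ] at k2
  have nP : 0 ≤ ∫ x, w x * (e' x - e x) ^ 2 ∂P :=
    integral_nonneg fun x => mul_nonneg (hw01 x).1 (sq_nonneg _)
  have nQ : 0 ≤ ∫ x, w x * (e' x - e x) ^ 2 ∂Q :=
    integral_nonneg fun x => mul_nonneg (hw01 x).1 (sq_nonneg _)
  -- With a and b the weighted L² norms of `e' - e` under `P` and `Q`, both squares are at most √H
  -- (a + b), where H is the weighted squared Hellinger distance. Hence a + b ≤ 4√H, and squaring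
  -- gives the constant 16.
  have hsum := add_le_of_sq_le (Real.sqrt_nonneg _) (Real.sqrt_nonneg _) (Real.sqrt_nonneg _)
    (by rw [Real.sq_sqrt nP]; exact (le_abs_self _).trans k1)
    (by rw [Real.sq_sqrt nQ]; exact (le_abs_self _).trans k2)
  have hD := hellingerSq_nonneg (P := P) (Q := Q) fun x => (hw01 x).1
  have fin : ∀ {a : ℝ}, 0 ≤ a → √a ≤ 4 * √(hellingerSq P Q w) → a ≤ 16 * hellingerSq P Q w := by
    intro a ha h
    rw [← Real.sq_sqrt ha, ← Real.sq_sqrt hD]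
    calc √a ^ 2 ≤ (4 * √(hellingerSq P Q w)) ^ 2 := by gcongr
      _ = _ := by ring
  exact ⟨fin nP (by linarith [Real.sqrt_nonneg (∫ x, w x * (e' x - e x) ^ 2 ∂Q)]),
    fin nQ (by linarith [Real.sqrt_nonneg (∫ x, w x * (e' x - e x) ^ 2 ∂P)])⟩

namespace IsPropensity

variable [IsProbabilityMeasure P] (he : IsPropensity m A P e) (hm : m ≤ m0)
  (hA : MeasurableSet A) {N : 𝒲 → ℝ} (hN : Measurable N)
  (hN2 : IntegrableOn (fun x => (e x)⁻¹ * N x ^ 2) A P)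

include he hm hA

lemma integrableOn_inv : IntegrableOn (fun x => (e x)⁻¹) A P := by
  refine (he.integrableOn_iff hm hA he.measurable.inv).2 ?_
  refine (integrable_const (1 : ℝ)).congr (ae_of_all _ fun x => ?_)
  simp [mul_inv_cancel₀ (he.pos x).ne']

include hN hN2

omit [IsProbabilityMeasure P] hm hA in
lemma integrableOn_sq : IntegrableOn (fun x => N x ^ 2) A P := by
  refine Integrable.mono hN2 (hN.pow_const 2).aestronglyMeasurable (ae_of_all _ fun x => ?_)
  have h1 : 1 ≤ (e x)⁻¹ := (one_le_inv₀ (he.pos x)).2 (he.le_one x)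
  rw [norm_mul, Real.norm_of_nonneg (zero_le_one.trans h1)]
  exact le_mul_of_one_le_left (norm_nonneg _) h1

lemma integrableOn_inv_mul : IntegrableOn (fun x => (e x)⁻¹ * N x) A P := by
  have heM := he.measurable.mono hm le_rfl
  refine Integrable.mono ((he.integrableOn_inv hm hA).add hN2)
    (heM.inv.mul hN).aestronglyMeasurable (ae_of_all _ fun x => ?_)
  have h0 : 0 < (e x)⁻¹ := inv_pos.2 (he.pos x)
  have : |N x| ≤ 1 + N x ^ 2 := by nlinarith [sq_abs (N x), sq_nonneg (|N x| - 1)]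
  simp only [Pi.add_apply, Real.norm_eq_abs]
  rw [abs_mul, abs_of_pos h0]
  refine le_trans ?_ (le_abs_self _)
  nlinarith

omit hm hA in
lemma integrableOn_self : IntegrableOn N A P := by
  have : MemLp N 2 (P.restrict A) :=
    (memLp_two_iff_integrable_sq hN.aestronglyMeasurable).2 (he.integrableOn_sq hN hN2)
  exact this.integrable (by norm_num)

/-- Cauchy–Schwarz with one factor 1/√e on each side: the integral of 1/e over `A \ G` is the
probability of `Gᶜ`. This needs no lower bound on the propensity, so it also applies along a path.
-/
lemma abs_setIntegral_diff_le {G : Set 𝒲} (hG : MeasurableSet[m] G) :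
    |∫ x in A \ G, (e x)⁻¹ * N x ∂P| ≤
      √(P.real Gᶜ) * √(∫ x in A, (e x)⁻¹ * N x ^ 2 ∂P) := by
  have heM := he.measurable.mono hm le_rfl
  have hG' := hm G hG
  have hs : ∀ x, √(e x)⁻¹ * √(e x)⁻¹ = (e x)⁻¹ := fun x =>
    Real.mul_self_sqrt (inv_nonneg.2 (he.pos x).le)
  have hf2 : ∀ x, (Gᶜ.indicator (fun x => √(e x)⁻¹) x) ^ 2 = Gᶜ.indicator (fun x => (e x)⁻¹) x := by
    intro x
    by_cases hx : x ∈ Gᶜ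
    · rw [Set.indicator_of_mem hx, Set.indicator_of_mem hx, sq, hs]
    · rw [Set.indicator_of_notMem hx, Set.indicator_of_notMem hx]; simp
  have hg2 : ∀ x, (√(e x)⁻¹ * N x) ^ 2 = (e x)⁻¹ * N x ^ 2 := fun x => by
    rw [mul_pow, sq (√_), hs]
  have hf : MemLp (Gᶜ.indicator (fun x => √(e x)⁻¹)) 2 (P.restrict A) := by
    have hmeas : Measurable (Gᶜ.indicator fun x => √(e x)⁻¹) :=
      heM.inv.sqrt.indicator hG'.compl
    refine (memLp_two_iff_integrable_sq hmeas.aestronglyMeasurable).2 ?_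
    simp only [hf2]
    exact Integrable.indicator (he.integrableOn_inv hm hA) hG'.compl
  have hg : MemLp (fun x => √(e x)⁻¹ * N x) 2 (P.restrict A) := by
    have hmeas : Measurable fun x => √(e x)⁻¹ * N x := heM.inv.sqrt.mul hN
    refine (memLp_two_iff_integrable_sq hmeas.aestronglyMeasurable).2 ?_
    simp only [hg2]
    exact hN2
  have cs := abs_integral_mul_le hf hg
  simp only [hf2, hg2] at cs
  have h1 : ∫ x in A, Gᶜ.indicator (fun x => (e x)⁻¹) x ∂P = P.real Gᶜ := by
    have hmeas : Measurable[m] (Gᶜ.indicator fun x => (e x)⁻¹) :=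
      Measurable.indicator he.measurable.inv hG.compl
    rw [he.setIntegral_eq hm hA hmeas,
      ← integral_indicator_one hG'.compl]
    congr 1 with x
    by_cases hx : x ∈ Gᶜ
    · rw [Set.indicator_of_mem hx, Set.indicator_of_mem hx, mul_inv_cancel₀ (he.pos x).ne']; rfl
    · rw [Set.indicator_of_notMem hx, Set.indicator_of_notMem hx, mul_zero]
  have h2 : ∫ x in A \ G, (e x)⁻¹ * N x ∂P =
      ∫ x in A, Gᶜ.indicator (fun x => √(e x)⁻¹) x * (√(e x)⁻¹ * N x) ∂P := by
    rw [Set.sdiff_eq, ← setIntegral_indicator hG'.compl]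
    congr 1 with x
    by_cases hx : x ∈ Gᶜ
    · rw [Set.indicator_of_mem hx, Set.indicator_of_mem hx, ← mul_assoc, hs]
    · rw [Set.indicator_of_notMem hx, Set.indicator_of_notMem hx, zero_mul]
  rw [h2]
  rwa [h1] at cs

end IsPropensity

/-- The Hellinger bound for propensities accepts only `m`-measurable weights, whereas the tail event
need not lie in `m`. Against `m`-measurable integrands `ρ` replaces its indicator. -/
lemma exists_condProb_version [IsProbabilityMeasure P] (hm : m ≤ m0) {S : Set 𝒲}
    (hS : MeasurableSet S) :
    ∃ ρ : 𝒲 → ℝ, Measurable[m] ρ ∧ (∀ x, 0 ≤ ρ x ∧ ρ x ≤ 1) ∧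
      ∀ r : 𝒲 → ℝ, Measurable[m] r → ∀ C, (∀ x, |r x| ≤ C) →
        ∫ x, S.indicator (fun _ => 1) x * r x ∂P = ∫ x, ρ x * r x ∂P := by
  have hmeas : Measurable[m] (P⟦S | m⟧) := stronglyMeasurable_condExp.measurable
  have hSi : Integrable (S.indicator fun _ => (1 : ℝ)) P := (integrable_const _).indicator hS
  have h0 : 0 ≤ᵐ[P] P⟦S | m⟧ :=
    condExp_nonneg (ae_of_all _ fun x => Set.indicator_nonneg (fun _ _ => zero_le_one) x)
  have h1 : ∀ᵐ x ∂P, (P⟦S | m⟧) x ≤ 1 := by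
    have := condExp_mono (m := m) (μ := P) hSi (integrable_const (1 : ℝ))
      (ae_of_all _ fun x => Set.indicator_le_self' (by simp) x)
    rwa [condExp_const hm] at this
  refine ⟨fun x => max 0 (min 1 ((P⟦S | m⟧) x)), measurable_const.max (measurable_const.min hmeas),
    fun x => ⟨le_max_left _ _, max_le zero_le_one (min_le_left _ _)⟩, fun r hr C hC => ?_⟩
  have hri : Integrable (fun x => r x * S.indicator (fun _ => (1 : ℝ)) x) P :=
    hSi.bdd_mul (hr.mono hm le_rfl).aestronglyMeasurable (ae_of_all _ hC)
  have h := condExp_mul_of_stronglyMeasurable_left hr.stronglyMeasurable hri hSi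
  simp only [mul_comm _ (r _)]
  rw [← integral_condExp hm (f := fun x => r x * S.indicator (fun _ => (1 : ℝ)) x)]
  refine integral_congr_ae ?_
  filter_upwards [h, h0, h1] with x hx hx0 hx1
  simp only [Pi.zero_apply] at hx0
  rw [min_eq_right hx1, max_eq_right hx0]
  exact hx

end Semiparam

/-! ### Inverse weighted integrals of tails -/

namespace Semiparam

variable {𝒲 : Type*} {m m0 : MeasurableSpace 𝒲} {P Q : Measure 𝒲} {A : Set 𝒲} {e e' : 𝒲 → ℝ}

lemma sqrt_le_mul_sqrt {a b c : ℝ} (hc : 0 ≤ c) (h : a ≤ c ^ 2 * b) : √a ≤ c * √b := by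
  refine (Real.sqrt_le_sqrt h).trans ?_
  rw [Real.sqrt_mul (sq_nonneg c), Real.sqrt_sq hc]

lemma indicator_one_mem (S : Set 𝒲) (x : 𝒲) :
    0 ≤ S.indicator (fun _ => (1 : ℝ)) x ∧ S.indicator (fun _ => (1 : ℝ)) x ≤ 1 := by
  by_cases hx : x ∈ S <;> simp [hx]

/-- Where the propensity of `P` is bounded below, that of `Q` is small on a small set only. -/
lemma sqrt_measureReal_le {κ : Measure 𝒲} [IsProbabilityMeasure κ] (heM : Measurable e)
    (heM' : Measurable e') (he1 : ∀ x, e x ≤ 1) (he0 : ∀ x, 0 < e' x) {η : ℝ} (hη : 0 < η)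
    (heη : ∀ x, η ≤ e x) {D : ℝ}
    (hD : ∫ x, {x | e' x < η / 2}.indicator (fun _ => 1) x * (e' x - e x) ^ 2 ∂κ ≤ 16 * D) :
    √(κ.real {x | e' x < η / 2}) ≤ 8 / η * √D := by
  set B : Set 𝒲 := {x | e' x < η / 2} with hB
  have hBm : MeasurableSet B := measurableSet_lt heM' measurable_const
  -- Chebyshev: on `B` the propensities differ by at least `η / 2`. Then 16 D / (η/2)² = (8/η)² D.
  have h1 : (η / 2) ^ 2 * κ.real B ≤
      ∫ x, B.indicator (fun _ => 1) x * (e' x - e x) ^ 2 ∂κ := by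
    rw [← integral_indicator_one hBm, ← integral_const_mul]
    refine integral_mono_of_nonneg (ae_of_all _ fun x => ?_) ?_ (ae_of_all _ fun x => ?_)
    · exact mul_nonneg (sq_nonneg _) (indicator_one_mem B x).1
    · refine integrable_of_measurable_bounded
        ((measurable_const.indicator hBm).mul ((heM'.sub heM).pow_const 2)) (C := 1) fun x => ?_
      by_cases hx : x ∈ B
      · have hx' : e' x < η / 2 := hx
        rw [Set.indicator_of_mem hx, one_mul, abs_of_nonneg (sq_nonneg _), sq_le_one_iff_abs_le_one,
          abs_le]
        constructor <;> linarith [he1 x, he0 x, heη x]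
      · simp [hx]
    · by_cases hx : x ∈ B
      · have hx' : e' x < η / 2 := hx
        simp only [Set.indicator_of_mem hx, Pi.one_apply, mul_one, one_mul]
        nlinarith [heη x]
      · simp [hx]
  refine sqrt_le_mul_sqrt (by positivity) ?_
  have h2 := h1.trans hD
  have h3 : (8 / η) ^ 2 * D = (16 * D) / (η / 2) ^ 2 := by field_simp; ring
  rw [h3, le_div_iff₀ (by positivity)]
  linarith

/-- The inverse propensity weighted functional of a function that vanishes outside of a small
set varies little along a path. -/
lemma abs_setIntegral_inv_mul_sub_le [IsProbabilityMeasure P] [IsProbabilityMeasure Q]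
    (he : IsPropensity m A P e) (he' : IsPropensity m A Q e') (hm : m ≤ m0) (hA : MeasurableSet A)
    {η : ℝ} (hη : 0 < η) (hη1 : η ≤ 1) (heη : ∀ x, η ≤ e x) {N : 𝒲 → ℝ} (hN : Measurable N)
    {S : Set 𝒲} (hS : MeasurableSet S) (hNS : ∀ x, x ∉ S → N x = 0)
    (hP : IntegrableOn (fun x => (e x)⁻¹ * N x ^ 2) A P)
    (hQ : IntegrableOn (fun x => (e' x)⁻¹ * N x ^ 2) A Q) {C : ℝ}
    (hPC : ∫ x in A, (e x)⁻¹ * N x ^ 2 ∂P ≤ C) (hQC : ∫ x in A, (e' x)⁻¹ * N x ^ 2 ∂Q ≤ C)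
    {ρ : 𝒲 → ℝ} (hρ : Measurable[m] ρ) (hρ01 : ∀ x, 0 ≤ ρ x ∧ ρ x ≤ 1)
    (hρS : ∀ r : 𝒲 → ℝ, Measurable[m] r → ∀ C, (∀ x, |r x| ≤ C) →
        ∫ x, S.indicator (fun _ => 1) x * r x ∂P = ∫ x, ρ x * r x ∂P) :
    |∫ x in A, (e' x)⁻¹ * N x ∂Q - ∫ x in A, (e x)⁻¹ * N x ∂P| ≤
      √C * (4 / η * √(hellingerSq P Q (S.indicator fun _ => 1)) + 8 / η ^ 2 * √(hellingerSq P Q ρ) +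
        16 / η * √(hellingerSq P Q ({x | e' x < η / 2}.indicator fun _ => 1))) := by
  have heM := he.measurable.mono hm le_rfl
  have heM' := he'.measurable.mono hm le_rfl
  set B : Set 𝒲 := {x | e' x < η / 2} with hB
  have hBm : MeasurableSet[m] B := measurableSet_lt he'.measurable measurable_const
  have hGm : MeasurableSet[m] Bᶜ := hBm.compl
  have hG' : MeasurableSet Bᶜ := hm _ hGm
  have hG : ∀ {x}, x ∈ Bᶜ → (e' x)⁻¹ ≤ 2 / η := fun {x} hx => by
    have : η / 2 ≤ e' x := not_lt.1 hx
    rw [← inv_div]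
    exact inv_anti₀ (by positivity) this
  have hinv : ∀ x, 0 < (e x)⁻¹ := fun x => inv_pos.2 (he.pos x)
  have hinv' : ∀ x, 0 < (e' x)⁻¹ := fun x => inv_pos.2 (he'.pos x)
  have hinv1 : ∀ x, 1 ≤ (e x)⁻¹ := fun x => (one_le_inv₀ (he.pos x)).2 (he.le_one x)
  have hinvη : ∀ x, (e x)⁻¹ ≤ η⁻¹ := fun x => inv_anti₀ hη (heη x)
  have hC0 : 0 ≤ C := le_trans
    (integral_nonneg fun x => mul_nonneg (hinv x).le (sq_nonneg _)) hPC
  -- the bad set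
  have hDB := integral_mul_sub_sq_le_hellingerSq he he' hm hA (w := B.indicator fun _ => 1)
    (Measurable.indicator measurable_const hBm) (indicator_one_mem B)
  have t3 : |∫ x in A \ Bᶜ, (e' x)⁻¹ * N x ∂Q| ≤
      8 / η * √(hellingerSq P Q (B.indicator fun _ => 1)) * √C := by
    refine (he'.abs_setIntegral_diff_le hm hA hN hQ hGm).trans ?_
    rw [compl_compl]
    gcongr
    exact sqrt_measureReal_le heM heM' he.le_one he'.pos hη heη hDB.2
  have t4 : |∫ x in A \ Bᶜ, (e x)⁻¹ * N x ∂P| ≤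
      8 / η * √(hellingerSq P Q (B.indicator fun _ => 1)) * √C := by
    refine (he.abs_setIntegral_diff_le hm hA hN hP hGm).trans ?_
    rw [compl_compl]
    gcongr
    exact sqrt_measureReal_le heM heM' he.le_one he'.pos hη heη hDB.1
  -- change of measure on the good set
  have hNP := he.integrableOn_sq hN hP
  have t1 : |∫ x in A ∩ Bᶜ, (e' x)⁻¹ * N x ∂Q - ∫ x in A ∩ Bᶜ, (e' x)⁻¹ * N x ∂P| ≤
      √(hellingerSq P Q (S.indicator fun _ => 1)) * (2 / η * √C + 2 / η * √C) := by
    set f : 𝒲 → ℝ := (A ∩ Bᶜ).indicator fun x => (e' x)⁻¹ * N x with hf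
    have hfm : Measurable f := (heM'.inv.mul hN).indicator (hA.inter hG')
    have hSf : ∀ x, S.indicator (fun _ => 1) x * f x = f x := fun x => by
      by_cases hx : x ∈ S
      · simp [hx]
      · by_cases hx' : x ∈ A ∩ Bᶜ
        · simp [hf, Set.indicator_of_mem hx', hNS x hx]
        · simp [hf, Set.indicator_of_notMem hx']
    have hSf2 : ∀ x, S.indicator (fun _ => 1) x * f x ^ 2 = f x ^ 2 := fun x => by
      rw [sq, ← mul_assoc, hSf]
    -- Off the bad set 1/e' ≤ 2/η, and 2/η ≥ 1, so (1/e')² ≤ (2/η)² (1/e'). The crude constant gives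
    -- the same form as under `P`, so that `hfin` serves both laws.
    have hf2Q : ∀ x, f x ^ 2 ≤ A.indicator (fun x => (2 / η) ^ 2 * ((e' x)⁻¹ * N x ^ 2)) x := by
      intro x
      by_cases hx : x ∈ A
      · by_cases hxB : x ∈ Bᶜ
        · rw [hf, Set.indicator_of_mem (Set.mem_inter hx hxB), Set.indicator_of_mem hx, mul_pow]
          have h2 : (e' x)⁻¹ ^ 2 ≤ (2 / η) ^ 2 * (e' x)⁻¹ := by
            have h3 : 1 ≤ 2 / η := by rw [le_div_iff₀ hη]; linarith
            have h4 := hG hxB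
            have h5 := hinv' x
            have h6 : 2 / η ≤ (2 / η) ^ 2 := by nlinarith
            nlinarith
          nlinarith [mul_le_mul_of_nonneg_right h2 (sq_nonneg (N x))]
        · rw [hf, Set.indicator_of_notMem (fun h => hxB h.2), Set.indicator_of_mem hx]
          have := hinv' x
          rw [zero_pow two_ne_zero]
          positivity
      · rw [hf, Set.indicator_of_notMem (fun h => hx h.1), Set.indicator_of_notMem hx]
        simp
    have hf2P : ∀ x, f x ^ 2 ≤ A.indicator (fun x => (2 / η) ^ 2 * ((e x)⁻¹ * N x ^ 2)) x := by
      intro x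
      by_cases hx : x ∈ A
      · by_cases hxB : x ∈ Bᶜ
        · rw [hf, Set.indicator_of_mem (Set.mem_inter hx hxB), Set.indicator_of_mem hx, mul_pow]
          have h2 : (e' x)⁻¹ ^ 2 ≤ (2 / η) ^ 2 * (e x)⁻¹ := by
            have h4 : (e' x)⁻¹ ^ 2 ≤ (2 / η) ^ 2 := by
              have := hG hxB
              have := hinv' x
              gcongr
            exact h4.trans (le_mul_of_one_le_right (by positivity) (hinv1 x))
          nlinarith [mul_le_mul_of_nonneg_right h2 (sq_nonneg (N x))]
        · rw [hf, Set.indicator_of_notMem (fun h => hxB h.2), Set.indicator_of_mem hx]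
          have := hinv x
          rw [zero_pow two_ne_zero]
          positivity
      · rw [hf, Set.indicator_of_notMem (fun h => hx h.1), Set.indicator_of_notMem hx]
        simp
    have hfin : ∀ {κ : Measure 𝒲} {ε : 𝒲 → ℝ},
        IntegrableOn (fun x => (ε x)⁻¹ * N x ^ 2) A κ → ∫ x in A, (ε x)⁻¹ * N x ^ 2 ∂κ ≤ C →
        (∀ x, f x ^ 2 ≤ A.indicator (fun x => (2 / η) ^ 2 * ((ε x)⁻¹ * N x ^ 2)) x) →
        Integrable (fun x => f x ^ 2) κ ∧ √(∫ x, f x ^ 2 ∂κ) ≤ 2 / η * √C := by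
      intro κ ε hi hiC hle
      have hi' : Integrable (A.indicator fun x => (2 / η) ^ 2 * ((ε x)⁻¹ * N x ^ 2)) κ :=
        (integrable_indicator_iff hA).2 (Integrable.const_mul hi _)
      have hf2i : Integrable (fun x => f x ^ 2) κ := by
        refine hi'.mono (hfm.pow_const 2).aestronglyMeasurable (ae_of_all _ fun x => ?_)
        rw [Real.norm_of_nonneg (sq_nonneg _)]
        exact (hle x).trans (le_abs_self _)
      refine ⟨hf2i, sqrt_le_mul_sqrt (by positivity) ?_⟩
      refine (integral_mono hf2i hi' hle).trans ?_
      rw [integral_indicator hA, integral_const_mul]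
      gcongr
    obtain ⟨i1, b1⟩ := hfin hQ hQC hf2Q
    obtain ⟨i2, b2⟩ := hfin hP hPC hf2P
    have := abs_integral_sub_integral_le_hellinger (P := P) (Q := Q)
      (w := S.indicator fun _ => 1) (measurable_const.indicator hS) (indicator_one_mem S) hfm
      (by simpa only [hSf2] using i2) (by simpa only [hSf2] using i1)
    simp only [hSf, hSf2] at this
    rw [← integral_indicator (hA.inter hG'), ← integral_indicator (hA.inter hG')]
    exact this.trans (by gcongr)
  -- change of propensity on the good set
  have t2 : |∫ x in A ∩ Bᶜ, ((e' x)⁻¹ * N x - (e x)⁻¹ * N x) ∂P| ≤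
      √C * (8 / η ^ 2 * √(hellingerSq P Q ρ)) := by
    -- Since `N` vanishes off `S`, the indicator of `S` can be inserted in the other Cauchy–Schwarz
    -- factor; this localizes the propensity error to the tail.
    set g : 𝒲 → ℝ := fun x => S.indicator (fun _ => 1) x *
      Bᶜ.indicator (fun x => (e' x)⁻¹ - (e x)⁻¹) x with hg
    have hgm : Measurable g :=
      (measurable_const.indicator hS).mul ((heM'.inv.sub heM.inv).indicator hG')
    have hg2 : ∀ x, g x ^ 2 ≤
        (2 / η ^ 2) ^ 2 * (S.indicator (fun _ => 1) x * (e' x - e x) ^ 2) := fun x => by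
      by_cases hxS : x ∈ S
      · by_cases hx : x ∈ Bᶜ
        · simp only [hg, Set.indicator_of_mem hxS, Set.indicator_of_mem hx, one_mul]
          have h1 : (e' x)⁻¹ - (e x)⁻¹ = -((e' x)⁻¹ * (e x)⁻¹ * (e' x - e x)) := by
            have := (he.pos x).ne'
            have := (he'.pos x).ne'
            field_simp
            ring
          have h2 : (e' x)⁻¹ * (e x)⁻¹ ≤ 2 / η ^ 2 := by
            calc (e' x)⁻¹ * (e x)⁻¹ ≤ 2 / η * η⁻¹ :=
                  mul_le_mul (hG hx) (hinvη x) (hinv x).le (by positivity)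
              _ = 2 / η ^ 2 := by field_simp
          have h3 := mul_pos (hinv' x) (hinv x)
          rw [h1, neg_sq, mul_pow]
          gcongr
        · simp only [hg, Set.indicator_of_mem hxS, Set.indicator_of_notMem hx, mul_zero, one_mul,
            zero_pow two_ne_zero]
          positivity
      · simp [hg, hxS]
    have hSe : Integrable (fun x => S.indicator (fun _ => 1) x * (e' x - e x) ^ 2) P := by
      refine integrable_of_measurable_bounded
        ((measurable_const.indicator hS).mul ((heM'.sub heM).pow_const 2)) (C := 1) fun x => ?_
      rw [abs_mul, abs_of_nonneg (indicator_one_mem S x).1, abs_of_nonneg (sq_nonneg _)]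
      refine mul_le_one₀ (indicator_one_mem S x).2 (sq_nonneg _) ?_
      rw [sq_le_one_iff_abs_le_one, abs_le]
      constructor <;> linarith [he.pos x, he'.pos x, he.le_one x, he'.le_one x]
    have hg2i : Integrable (fun x => g x ^ 2) P := by
      refine (hSe.const_mul ((2 / η ^ 2) ^ 2)).mono (hgm.pow_const 2).aestronglyMeasurable
        (ae_of_all _ fun x => ?_)
      rw [Real.norm_of_nonneg (sq_nonneg _)]
      exact (hg2 x).trans (le_abs_self _)
    have hgL : MemLp g 2 (P.restrict A) :=
      (memLp_two_iff_integrable_sq hgm.aestronglyMeasurable).2 hg2i.integrableOn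
    have hNL : MemLp N 2 (P.restrict A) :=
      (memLp_two_iff_integrable_sq hN.aestronglyMeasurable).2 hNP
    have hgb : √(∫ x in A, g x ^ 2 ∂P) ≤ 8 / η ^ 2 * √(hellingerSq P Q ρ) := by
      refine sqrt_le_mul_sqrt (by positivity) ?_
      calc ∫ x in A, g x ^ 2 ∂P ≤ ∫ x, g x ^ 2 ∂P :=
            setIntegral_le_integral hg2i (ae_of_all _ fun x => sq_nonneg _)
        _ ≤ (2 / η ^ 2) ^ 2 * ∫ x, S.indicator (fun _ => 1) x * (e' x - e x) ^ 2 ∂P := by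
            rw [← integral_const_mul]
            exact integral_mono hg2i (hSe.const_mul _) hg2
        -- The factor `(e' - e)²` is `m`-measurable, so `ρ` may take the place of the indicator of
        -- `S`.
        _ = (2 / η ^ 2) ^ 2 * ∫ x, ρ x * (e' x - e x) ^ 2 ∂P := by
            rw [hρS (fun x => (e' x - e x) ^ 2) ((he'.measurable.sub he.measurable).pow_const 2) 1
              fun x => ?_]
            rw [abs_of_nonneg (sq_nonneg _), sq_le_one_iff_abs_le_one, abs_le]
            constructor <;> linarith [he.pos x, he'.pos x, he.le_one x, he'.le_one x]
        _ ≤ (2 / η ^ 2) ^ 2 * (16 * hellingerSq P Q ρ) := by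
            gcongr
            exact (integral_mul_sub_sq_le_hellingerSq he he' hm hA hρ hρ01).1
        _ = _ := by ring
    have hNC : ∫ x in A, N x ^ 2 ∂P ≤ C := by
      refine (integral_mono hNP hP fun x => ?_).trans hPC
      exact le_mul_of_one_le_left (sq_nonneg _) (hinv1 x)
    have hint : ∫ x in A ∩ Bᶜ, ((e' x)⁻¹ * N x - (e x)⁻¹ * N x) ∂P = ∫ x in A, N x * g x ∂P := by
      rw [← setIntegral_indicator hG']
      congr 1 with x
      by_cases hxS : x ∈ S
      · by_cases hx : x ∈ Bᶜ
        · simp only [hg, Set.indicator_of_mem hxS, Set.indicator_of_mem hx, one_mul]; ring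
        · simp only [hg, Set.indicator_of_notMem hx, mul_zero]
      · by_cases hx : x ∈ Bᶜ
        · simp only [Set.indicator_of_mem hx, hNS x hxS]; ring
        · simp only [Set.indicator_of_notMem hx, hNS x hxS]; ring
    rw [hint]
    exact (abs_integral_mul_le hNL hgL).trans (by gcongr)
  have iP := he.integrableOn_inv_mul hm hA hN hP
  have iQ := he'.integrableOn_inv_mul hm hA hN hQ
  have iP' : IntegrableOn (fun x => (e' x)⁻¹ * N x) (A ∩ Bᶜ) P := by
    have hNi : IntegrableOn N (A ∩ Bᶜ) P :=
      (he.integrableOn_self hN hP).mono_set Set.inter_subset_left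
    refine Integrable.mono (Integrable.const_mul hNi (2 / η)) (heM'.inv.mul hN).aestronglyMeasurable
      ((ae_restrict_iff' (hA.inter hG')).2 (ae_of_all _ fun x hx => ?_))
    rw [norm_mul, norm_mul, Real.norm_of_nonneg (hinv' x).le,
      Real.norm_of_nonneg (show 0 ≤ 2 / η by positivity)]
    exact mul_le_mul_of_nonneg_right (hG hx.2) (norm_nonneg _)
  have hsub := integral_sub iP' (iP.mono_set Set.inter_subset_left)
  -- On the good set the increment splits into change of law (4/η) and change of propensity (8/η²).
  -- The bad set contributes 8/η under each law, hence 16/η.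
  rw [← integral_inter_add_sdiff hG' iP, ← integral_inter_add_sdiff hG' iQ]
  rw [hsub] at t2
  rw [abs_le] at t1 t2 t3 t4 ⊢
  constructor <;> ring_nf at t1 t2 t3 t4 ⊢ <;> linarith [t1.1, t1.2, t2.1, t2.2, t3.1, t3.2, t4.1, t4.2]

end Semiparam

/-! ### L² bounds for the `aipw` score; bounded pathwise derivatives -/

namespace Semiparam

variable {𝒲 : Type*} {m m0 : MeasurableSpace 𝒲} {P : Measure 𝒲} {A : Set 𝒲} {e : 𝒲 → ℝ}

lemma measurable_aipw (hm : m ≤ m0) (hA : MeasurableSet A) (he : Measurable[m] e) {f : 𝒲 → ℝ}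
    (hf : Measurable f) : Measurable (aipw m A P e f) := by
  have h1 : Measurable ((P[|A])[f | m]) := (stronglyMeasurable_condExp.mono hm).measurable
  exact (((he.mono hm le_rfl).inv.mul (hf.sub h1)).indicator hA).add h1

section

variable [IsProbabilityMeasure P] (he : IsPropensity m A P e) (hm : m ≤ m0) (hA : MeasurableSet A)

include he hm hA

lemma IsPropensity.ae_eq_of_ae_eq_cond {f g : 𝒲 → ℝ} (hf : Measurable[m] f) (hg : Measurable[m] g)
    (h : f =ᵐ[P[|A]] g) : f =ᵐ[P] g := by
  have hs : MeasurableSet[m] {x | ¬ f x = g x} := (measurableSet_eq_fun hf hg).compl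
  refine he.measure_eq_zero hm hA hs ?_
  have : P[|A] {x | ¬ f x = g x} = 0 := h
  rw [cond_apply hA, mul_eq_zero, Set.inter_comm] at this
  exact this.resolve_left (ENNReal.inv_ne_zero.2 (measure_ne_top _ _))

/-- Linearity of the regression holds `P[|A]`-a.e. and must be carried over to `P`, because off `A`
the score is the regression itself. -/
lemma aipw_sub {f g : 𝒲 → ℝ} (hf : IntegrableOn f A P) (hg : IntegrableOn g A P) :
    aipw m A P e (fun x => f x - g x) =ᵐ[P] fun x => aipw m A P e f x - aipw m A P e g x := by
  have hprob := he.isProbabilityMeasure_cond hm hA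
  rw [← he.integrable_cond_iff hm hA] at hf hg
  have h1 := he.ae_eq_of_ae_eq_cond hm hA stronglyMeasurable_condExp.measurable
    (stronglyMeasurable_condExp.measurable.sub stronglyMeasurable_condExp.measurable)
    (condExp_sub hf hg m)
  filter_upwards [h1] with x hx
  have hx' : (P[|A])[fun x => f x - g x | m] x = (P[|A])[f | m] x - (P[|A])[g | m] x := hx
  unfold aipw
  by_cases hxA : x ∈ A
  · simp only [Set.indicator_of_mem hxA, hx']; ring
  · simp only [Set.indicator_of_notMem hxA, hx']; ring

/-- With ν the regression of `N`, orthogonality of the residual gives ∫ ν² = ∫ νN ≤ ½∫ ν² + ½∫ N²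
over `A`. -/
lemma memLp_condExp_cond {N : 𝒲 → ℝ} (hN : Measurable N) (hN2 : IntegrableOn (fun x => N x ^ 2) A P) :
    IntegrableOn (fun x => (P[|A])[N | m] x ^ 2) A P ∧
      ∫ x in A, (P[|A])[N | m] x ^ 2 ∂P ≤ ∫ x in A, N x ^ 2 ∂P := by
  have hprob := he.isProbabilityMeasure_cond hm hA
  have hν : Measurable[m] ((P[|A])[N | m]) := stronglyMeasurable_condExp.measurable
  have hν' := hν.mono hm le_rfl
  have hNL : MemLp N 2 (P[|A]) := (memLp_two_iff_integrable_sq hN.aestronglyMeasurable).2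
    ((he.integrable_cond_iff hm hA).2 hN2)
  have hνL := hNL.condExp (m := m) (by norm_num)
  have hν2 : IntegrableOn (fun x => (P[|A])[N | m] x ^ 2) A P :=
    (he.integrable_cond_iff hm hA).1 hνL.integrable_sq
  have hνN : IntegrableOn (fun x => (P[|A])[N | m] x * N x) A P :=
    (he.integrable_cond_iff hm hA).1 (hνL.integrable_mul hNL)
  have hNi : IntegrableOn N A P := (he.integrable_cond_iff hm hA).1 (hNL.integrable (by norm_num))
  obtain ⟨-, h2⟩ := he.integrableOn_mul_condExp hm hA hν hNi hνN
  refine ⟨hν2, ?_⟩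
  have h3 : ∫ x in A, (P[|A])[N | m] x * N x ∂P ≤
      ∫ x in A, (1 / 2 * (P[|A])[N | m] x ^ 2 + 1 / 2 * N x ^ 2) ∂P := by
    refine integral_mono hνN ((Integrable.const_mul hν2 _).add (Integrable.const_mul hN2 _))
      fun x => ?_
    simp only
    nlinarith [sq_nonneg ((P[|A])[N | m] x - N x)]
  rw [integral_add (Integrable.const_mul hν2 _) (Integrable.const_mul hN2 _), integral_const_mul,
    integral_const_mul, ← h2] at h3
  simp only [← sq] at h3
  linarith

/-- Leaving `A` costs a factor 1/η, since `e ≥ η`. -/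
lemma integral_condExp_cond_sq_le {η : ℝ} (hη : 0 < η) (heη : ∀ x, η ≤ e x) {N : 𝒲 → ℝ}
    (hN : Measurable N) (hN2 : IntegrableOn (fun x => N x ^ 2) A P) :
    Integrable (fun x => (P[|A])[N | m] x ^ 2) P ∧
      ∫ x, (P[|A])[N | m] x ^ 2 ∂P ≤ η⁻¹ * ∫ x in A, (P[|A])[N | m] x ^ 2 ∂P := by
  obtain ⟨h1, -⟩ := memLp_condExp_cond he hm hA hN hN2
  have hν : Measurable[m] ((P[|A])[N | m]) := stronglyMeasurable_condExp.measurable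
  have hν2 : Measurable[m] fun x => (P[|A])[N | m] x ^ 2 := hν.pow_const 2
  have hee := (he.integrableOn_iff hm hA hν2).1 h1
  have hle : ∀ x, (P[|A])[N | m] x ^ 2 ≤ η⁻¹ * (e x * (P[|A])[N | m] x ^ 2) := fun x => by
    rw [← mul_assoc]
    refine le_mul_of_one_le_left (sq_nonneg _) ?_
    rw [inv_mul_eq_div, one_le_div hη]
    exact heη x
  have hνP : Integrable (fun x => (P[|A])[N | m] x ^ 2) P := by
    refine (hee.const_mul η⁻¹).mono (hν2.mono hm le_rfl).aestronglyMeasurable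
      (ae_of_all _ fun x => ?_)
    rw [Real.norm_of_nonneg (sq_nonneg _)]
    exact (hle x).trans (le_abs_self _)
  refine ⟨hνP, ?_⟩
  rw [he.setIntegral_eq hm hA hν2, ← integral_const_mul]
  exact integral_mono hνP (hee.const_mul η⁻¹) hle

/-- Continuity of f ↦ `aipw` in L², which allows truncation. The constant is 10 = 4 + 4 + 2: twice
(1/e)²(N - ν)² is at most 4/η² times N² + ν² on `A`, and the outer ν² enters twice, with 1/η ≤ 1/η².
-/
lemma integral_aipw_sq_le {η : ℝ} (hη : 0 < η) (hη1 : η ≤ 1) (heη : ∀ x, η ≤ e x) {N : 𝒲 → ℝ}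
    (hN : Measurable N) (hN2 : IntegrableOn (fun x => N x ^ 2) A P) :
    Integrable (fun x => aipw m A P e N x ^ 2) P ∧
      ∫ x, aipw m A P e N x ^ 2 ∂P ≤ 10 / η ^ 2 * ∫ x in A, N x ^ 2 ∂P := by
  obtain ⟨h1, h2⟩ := memLp_condExp_cond he hm hA hN hN2
  obtain ⟨hνP, hνi⟩ := integral_condExp_cond_sq_le he hm hA hη heη hN hN2
  set ν := (P[|A])[N | m] with hνdef
  have hNA : Integrable (A.indicator fun x => N x ^ 2) P := (integrable_indicator_iff hA).2 hN2
  have hνA : Integrable (A.indicator fun x => ν x ^ 2) P := (integrable_indicator_iff hA).2 h1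
  have hle : ∀ x, aipw m A P e N x ^ 2 ≤ 4 / η ^ 2 * A.indicator (fun x => N x ^ 2) x +
      4 / η ^ 2 * A.indicator (fun x => ν x ^ 2) x + 2 * ν x ^ 2 := fun x => by
    unfold aipw
    rw [← hνdef]
    by_cases hx : x ∈ A
    · simp only [Set.indicator_of_mem hx]
      have h3 : ((e x)⁻¹ * (N x - ν x) + ν x) ^ 2 ≤
          2 * ((e x)⁻¹ ^ 2 * (N x - ν x) ^ 2) + 2 * ν x ^ 2 := by
        nlinarith [sq_nonneg ((e x)⁻¹ * (N x - ν x) - ν x)]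
      have h4 : (e x)⁻¹ ^ 2 ≤ η⁻¹ ^ 2 := by
        have := he.pos x
        have := heη x
        gcongr
      have h5 : (N x - ν x) ^ 2 ≤ 2 * N x ^ 2 + 2 * ν x ^ 2 := by
        nlinarith [sq_nonneg (N x + ν x)]
      have h6 := mul_le_mul h4 h5 (sq_nonneg _) (sq_nonneg _)
      have h7 : 4 / η ^ 2 = 4 * η⁻¹ ^ 2 := by field_simp
      rw [h7]
      linarith
    · simp only [Set.indicator_of_notMem hx]
      nlinarith [sq_nonneg (ν x)]
  have hbi : Integrable (fun x => 4 / η ^ 2 * A.indicator (fun x => N x ^ 2) x +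
      4 / η ^ 2 * A.indicator (fun x => ν x ^ 2) x) P :=
    (hNA.const_mul _).add (hνA.const_mul _)
  have hb : Integrable (fun x => 4 / η ^ 2 * A.indicator (fun x => N x ^ 2) x +
      4 / η ^ 2 * A.indicator (fun x => ν x ^ 2) x + 2 * ν x ^ 2) P := hbi.add (hνP.const_mul 2)
  have hi : Integrable (fun x => aipw m A P e N x ^ 2) P := by
    refine hb.mono ((measurable_aipw hm hA he.measurable hN).pow_const 2).aestronglyMeasurable
      (ae_of_all _ fun x => ?_)
    rw [Real.norm_of_nonneg (sq_nonneg _)]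
    exact (hle x).trans (le_abs_self _)
  refine ⟨hi, (integral_mono hi hb hle).trans ?_⟩
  rw [integral_add hbi (hνP.const_mul 2), integral_add (hNA.const_mul _) (hνA.const_mul _),
    integral_const_mul, integral_const_mul, integral_const_mul, integral_indicator hA,
    integral_indicator hA]
  have h0 : 0 ≤ ∫ x in A, N x ^ 2 ∂P := integral_nonneg fun x => sq_nonneg _
  have h8 : ∫ x, ν x ^ 2 ∂P ≤ 1 / η ^ 2 * ∫ x in A, N x ^ 2 ∂P := by
    refine hνi.trans (mul_le_mul ?_ h2 (integral_nonneg fun x => sq_nonneg _) (by positivity))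
    rw [inv_eq_one_div]
    exact one_div_le_one_div_of_le (by positivity) (by nlinarith)
  have h9 : 4 / η ^ 2 * ∫ x in A, ν x ^ 2 ∂P ≤ 4 / η ^ 2 * ∫ x in A, N x ^ 2 ∂P := by gcongr
  have h10 : 10 / η ^ 2 * ∫ x in A, N x ^ 2 ∂P = 4 / η ^ 2 * ∫ x in A, N x ^ 2 ∂P +
    4 / η ^ 2 * ∫ x in A, N x ^ 2 ∂P + 2 * (1 / η ^ 2 * ∫ x in A, N x ^ 2 ∂P) := by ring
  linarith

end

lemma tendsto_setIntegral_tail_sq {μ : Measure 𝒲} {f : 𝒲 → ℝ} (hf : Measurable f)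
    (hf2 : Integrable (fun x => f x ^ 2) μ) :
    Tendsto (fun K : ℕ => ∫ x, ({x | (K : ℝ) < |f x|}.indicator f x) ^ 2 ∂μ) atTop (𝓝 0) := by
  have h0 : ∫ _ : 𝒲, (0 : ℝ) ∂μ = 0 := by simp
  rw [← h0]
  refine tendsto_integral_of_dominated_convergence (fun x => f x ^ 2) (fun K => ?_) hf2
    (fun K => ae_of_all _ fun x => ?_) (ae_of_all _ fun x => ?_)
  · exact ((hf.indicator (measurableSet_lt measurable_const hf.abs)).pow_const 2).aestronglyMeasurable
  · by_cases hx : x ∈ {x | (K : ℝ) < |f x|} <;> simp [hx, sq_nonneg]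
  · obtain ⟨N, hN⟩ := exists_nat_ge |f x|
    refine tendsto_const_nhds.congr' ?_
    filter_upwards [eventually_ge_atTop N] with n hn
    rw [Set.indicator_of_notMem, zero_pow two_ne_zero]
    exact not_lt.2 (hN.trans (by exact_mod_cast hn))

lemma tendsto_measureReal_tail [IsFiniteMeasure P] {f : 𝒲 → ℝ} (hf : Measurable f) :
    Tendsto (fun K : ℕ => ∫ x, {x | (K : ℝ) < |f x|}.indicator (fun _ => (1 : ℝ)) x ∂P) atTop
      (𝓝 0) := by
  have h0 : ∫ _ : 𝒲, (0 : ℝ) ∂P = 0 := by simp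
  rw [← h0]
  refine tendsto_integral_of_dominated_convergence (fun x => 1) (fun K => ?_)
    (integrable_const _) (fun K => ae_of_all _ fun x => ?_) (ae_of_all _ fun x => ?_)
  · exact (measurable_const.indicator
      (measurableSet_lt measurable_const hf.abs)).aestronglyMeasurable
  · rw [Real.norm_of_nonneg (indicator_one_mem _ x).1]; exact (indicator_one_mem _ x).2
  · obtain ⟨N, hN⟩ := exists_nat_ge |f x|
    refine tendsto_const_nhds.congr' ?_
    filter_upwards [eventually_ge_atTop N] with n hn
    rw [Set.indicator_of_notMem]
    exact not_lt.2 (hN.trans (by exact_mod_cast hn))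

/-- Pathwise derivative for a bounded function. -/
lemma tendsto_of_bounded [IsProbabilityMeasure P] (he : IsPropensity m A P e) (hm : m ≤ m0)
    (hA : MeasurableSet A) {η : ℝ} (hη : 0 < η) (heη : ∀ x, η ≤ e x)
    {γ : ℝ → Measure 𝒲} {h : 𝒲 → ℝ} (hh : Measurable h) (hh2 : Integrable (fun x => h x ^ 2) P)
    (hγ : ∀ᶠ t in 𝓝[>] 0, IsProbabilityMeasure (γ t) ∧ ∃ e', IsPropensity m A (γ t) e')
    (hd : Tendsto (fun t => dqmError P (γ t) h t) (𝓝[>] 0) (𝓝 0))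
    {f : 𝒲 → ℝ} (hf : Measurable f) {K : ℝ} (hK : ∀ x, |f x| ≤ K) :
    Tendsto (fun t => (∫ x, ((γ t)[|A])[f | m] x ∂(γ t) - ∫ x, (P[|A])[f | m] x ∂P) / t) (𝓝[>] 0)
      (𝓝 (∫ x, aipw m A P e f x * h x ∂P)) := by
  set H := ∫ x, h x ^ 2 ∂P
  set H1 := ∫ x, |h x| ∂P
  -- The remainder of the bounded expansion divided by `t`, as a continuous function of the
  -- quadratic mean error and `t` vanishing at the origin.
  set bnd : ℝ × ℝ → ℝ := fun p =>
    (η⁻¹ * (2 * K) + K) * (2 * √p.1 + p.2 * (2 * p.1 + 1 / 2 * H)) +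
    (2 * K * (1 + η⁻¹) * (2 * √p.1 + p.2 * (2 * p.1 + 1 / 2 * H)) +
      √(2 * K * (1 + η⁻¹) * ((1 + η⁻¹) * (η⁻¹ *
        (2 * K * (p.2 * (2 * √p.1 + p.2 * (2 * p.1 + 1 / 2 * H))) + p.2 * (2 * K * H1))))) *
        √H) with hbnd
  have hc : Continuous bnd := by fun_prop
  have ht : Tendsto (fun t : ℝ => t) (𝓝[>] 0) (𝓝 0) := tendsto_nhdsWithin_of_tendsto_nhds tendsto_id
  have hlim : Tendsto (fun t => bnd (dqmError P (γ t) h t, t)) (𝓝[>] 0) (𝓝 0) := by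
    have := (hc.tendsto (0, 0)).comp (hd.prodMk_nhds ht)
    have h00 : bnd (0, 0) = 0 := by simp [hbnd]
    rw [h00] at this
    exact this
  rw [tendsto_iff_norm_sub_tendsto_zero]
  refine squeeze_zero' (Eventually.of_forall fun t => norm_nonneg _) ?_ hlim
  filter_upwards [hγ, self_mem_nhdsWithin] with t ⟨hprob, e', he'⟩ ht0
  have ht0 : 0 < t := ht0
  have key := abs_integral_condExp_sub_le he he' hm hA hη heη hh hh2 ht0 hf hK
  simp only [pathRemainder] at key
  have e1 : (∫ x, ((γ t)[|A])[f | m] x ∂(γ t) - ∫ x, (P[|A])[f | m] x ∂P) / t -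
      ∫ x, aipw m A P e f x * h x ∂P =
      (∫ x, ((γ t)[|A])[f | m] x ∂(γ t) - ∫ x, (P[|A])[f | m] x ∂P -
        t * ∫ x, aipw m A P e f x * h x ∂P) / t := by field_simp
  rw [e1, Real.norm_eq_abs, abs_div, abs_of_pos ht0, div_le_iff₀ ht0]
  refine key.trans (le_of_eq ?_)
  simp only [hbnd]
  ring

end Semiparam

/-! ### Pathwise derivative for functions with bounded second moments -/

namespace Semiparam

variable {𝒲 : Type*} {m m0 : MeasurableSpace 𝒲} {P : Measure 𝒲} {A : Set 𝒲} {e : 𝒲 → ℝ}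

/-- The inverse propensity weighted functional is pathwise differentiable along paths with bounded
second moments, and the augmented inverse propensity weighted score is its gradient. -/
theorem tendsto_integral_condExp_div [IsProbabilityMeasure P] (he : IsPropensity m A P e)
    (hm : m ≤ m0) (hA : MeasurableSet A) {η : ℝ} (hη : 0 < η) (hη1 : η ≤ 1) (heη : ∀ x, η ≤ e x)
    {γ : ℝ → Measure 𝒲} {h : 𝒲 → ℝ} (hh : Measurable h) (hh2 : Integrable (fun x => h x ^ 2) P)
    {f : 𝒲 → ℝ} (hf : Measurable f) {C : ℝ}
    (hP : IntegrableOn (fun x => (e x)⁻¹ * f x ^ 2) A P)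
    (hPC : ∫ x in A, (e x)⁻¹ * f x ^ 2 ∂P ≤ C)
    (hγ : ∀ᶠ t in 𝓝[>] 0, IsProbabilityMeasure (γ t) ∧ ∃ e', IsPropensity m A (γ t) e' ∧
      IntegrableOn (fun x => (e' x)⁻¹ * f x ^ 2) A (γ t) ∧
      ∫ x in A, (e' x)⁻¹ * f x ^ 2 ∂(γ t) ≤ C)
    (hd : Tendsto (fun t => dqmError P (γ t) h t) (𝓝[>] 0) (𝓝 0)) :
    Tendsto (fun t => (∫ x, ((γ t)[|A])[f | m] x ∂(γ t) - ∫ x, (P[|A])[f | m] x ∂P) / t) (𝓝[>] 0)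
      (𝓝 (∫ x, aipw m A P e f x * h x ∂P)) := by
  set S : ℕ → Set 𝒲 := fun K => {x | (K : ℝ) < |f x|} with hSdef
  set N : ℕ → 𝒲 → ℝ := fun K => (S K).indicator f with hNdef
  set b : ℕ → 𝒲 → ℝ := fun K x => f x - N K x with hbdef
  have hS : ∀ K, MeasurableSet (S K) := fun K => measurableSet_lt measurable_const hf.abs
  have hN : ∀ K, Measurable (N K) := fun K => hf.indicator (hS K)
  have hNS : ∀ K x, x ∉ S K → N K x = 0 := fun K x hx => Set.indicator_of_notMem hx _
  have hNf : ∀ K x, N K x ^ 2 ≤ f x ^ 2 := fun K x => by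
    by_cases hx : x ∈ S K <;> simp [hNdef, hx, sq_nonneg]
  have hb : ∀ K, Measurable (b K) := fun K => hf.sub (hN K)
  have hbK : ∀ K x, |b K x| ≤ K := fun K x => by
    by_cases hx : x ∈ S K
    · simp [hbdef, hNdef, hx]
    · have : |f x| ≤ K := not_lt.1 hx
      simpa [hbdef, hNdef, hx] using this
  have hf2 := he.integrableOn_sq hf hP
  have hfA := he.integrableOn_self hf hP
  have hdom : ∀ {κ : Measure 𝒲} {ε : 𝒲 → ℝ}, IsPropensity m A κ ε →
      IntegrableOn (fun x => (ε x)⁻¹ * f x ^ 2) A κ → ∫ x in A, (ε x)⁻¹ * f x ^ 2 ∂κ ≤ C → ∀ K,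
      IntegrableOn (fun x => (ε x)⁻¹ * N K x ^ 2) A κ ∧
      ∫ x in A, (ε x)⁻¹ * N K x ^ 2 ∂κ ≤ C := by
    intro κ ε hε hi hC K
    have hle : ∀ x, (ε x)⁻¹ * N K x ^ 2 ≤ (ε x)⁻¹ * f x ^ 2 := fun x =>
      mul_le_mul_of_nonneg_left (hNf K x) (inv_nonneg.2 (hε.pos x).le)
    have hi' : IntegrableOn (fun x => (ε x)⁻¹ * N K x ^ 2) A κ := by
      refine Integrable.mono hi (((hε.measurable.mono hm le_rfl).inv.mul
        ((hN K).pow_const 2)).aestronglyMeasurable) (ae_of_all _ fun x => ?_)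
      rw [Real.norm_of_nonneg (mul_nonneg (inv_nonneg.2 (hε.pos x).le) (sq_nonneg _))]
      exact (hle x).trans (le_abs_self _)
    exact ⟨hi', (integral_mono hi' hi hle).trans hC⟩
  have hC0 : 0 ≤ C := le_trans
    (integral_nonneg fun x => mul_nonneg (inv_nonneg.2 (he.pos x).le) (sq_nonneg _)) hPC
  have hhL : MemLp h 2 P := (memLp_two_iff_integrable_sq hh.aestronglyMeasurable).2 hh2
  set H := ∫ x, h x ^ 2 ∂P
  have hH0 : 0 ≤ H := integral_nonneg fun x => sq_nonneg _
  have hNsq : ∀ K, IntegrableOn (fun x => N K x ^ 2) A P := fun K =>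
    he.integrableOn_sq (hN K) (hdom he hP hPC K).1
  have hNA : ∀ K, IntegrableOn (N K) A P := fun K => he.integrableOn_self (hN K) (hdom he hP hPC K).1
  -- the gradients of the truncated functions converge
  have hL : Tendsto (fun K => √(10 / η ^ 2 * ∫ x in A, N K x ^ 2 ∂P) * √H) atTop (𝓝 0) := by
    have h1 := tendsto_setIntegral_tail_sq (μ := P.restrict A) hf hf2
    have h2 := ((h1.const_mul (10 / η ^ 2)).sqrt).mul_const (√H)
    simpa using h2
  have hLK : ∀ K, |∫ x, aipw m A P e f x * h x ∂P - ∫ x, aipw m A P e (b K) x * h x ∂P| ≤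
      √(10 / η ^ 2 * ∫ x in A, N K x ^ 2 ∂P) * √H := by
    intro K
    obtain ⟨i1, i2⟩ := integral_aipw_sq_le he hm hA hη hη1 heη (hN K) (hNsq K)
    have hAL : MemLp (aipw m A P e (N K)) 2 P := (memLp_two_iff_integrable_sq
      (measurable_aipw hm hA he.measurable (hN K)).aestronglyMeasurable).2 i1
    have hAf : MemLp (aipw m A P e f) 2 P := (memLp_two_iff_integrable_sq
      (measurable_aipw hm hA he.measurable hf).aestronglyMeasurable).2
      (integral_aipw_sq_le he hm hA hη hη1 heη hf hf2).1
    have j1 : Integrable (fun x => aipw m A P e (N K) x * h x) P := hAL.integrable_mul hhL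
    have j2 : Integrable (fun x => aipw m A P e f x * h x) P := hAf.integrable_mul hhL
    have h3 : ∫ x, aipw m A P e (b K) x * h x ∂P =
        ∫ x, aipw m A P e f x * h x ∂P - ∫ x, aipw m A P e (N K) x * h x ∂P := by
      rw [← integral_sub j2 j1]
      refine integral_congr_ae ?_
      filter_upwards [aipw_sub he hm hA hfA (hNA K)] with x hx
      rw [hbdef, hx, sub_mul]
    rw [h3, sub_sub_cancel]
    refine (abs_integral_mul_le hAL hhL).trans ?_
    gcongr
  rw [Metric.tendsto_nhds]
  intro ε hε
  set c := √C * (4 / η + 8 / η ^ 2 + 16 / η) with hcdef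
  have hc0 : 0 ≤ c := by positivity
  -- The error has three parts of size `ε / 3`: truncating the gradient, the bounded part, and the
  -- tail, which is at most `c * √ε1`.
  set ε1 := (ε / (3 * (c + 1))) ^ 2 with hε1def
  have hε1 : 0 < ε1 := by positivity
  have hcε : c * √ε1 < ε / 3 := by
    rw [hε1def, Real.sqrt_sq (by positivity), mul_div_assoc', div_lt_div_iff₀ (by positivity)
      (by norm_num)]
    nlinarith
  -- Any weight of `P`-mass below `δ` carries less than `ε1` of the integral of h². Choosing `δ`,
  -- then `K`, before `t` gives uniformity over the bad sets, which move with `t`.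
  obtain ⟨δ, hδ, hUI⟩ := exists_forall_integral_weight_mul_lt hh2 (fun x => sq_nonneg _) hε1
  obtain ⟨K, hK1, hK2⟩ := (((hL.eventually (gt_mem_nhds (show 0 < ε / 3 by positivity))).and
    ((tendsto_measureReal_tail (P := P) hf).eventually (gt_mem_nhds hδ)))).exists
  obtain ⟨ρ, hρ, hρ01, hρS⟩ := exists_condProb_version (P := P) hm (hS K)
  have hρ1 : ∫ x, ρ x ∂P < δ := by
    have := hρS (fun _ => 1) measurable_const 1 (by simp)
    simp only [mul_one] at this
    rw [← this]
    exact hK2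
  have hw1 := hUI ((S K).indicator fun _ => 1)
    (measurable_const.indicator (hS K)).aestronglyMeasurable
    (ae_of_all _ (indicator_one_mem _)) hK2
  have hw2 := hUI ρ (hρ.mono hm le_rfl).aestronglyMeasurable (ae_of_all _ hρ01) hρ1
  have hbdd := tendsto_of_bounded he hm hA hη heη hh hh2
    (hγ.mono fun t ⟨h1, e', h2, _⟩ => ⟨h1, e', h2⟩) hd (hb K) (hbK K)
  rw [Metric.tendsto_nhds] at hbdd
  have ht : Tendsto (fun t : ℝ => t) (𝓝[>] 0) (𝓝 0) := tendsto_nhdsWithin_of_tendsto_nhds tendsto_id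
  -- This bounds the square root of the `P`-mass of the moving set where e' < η/2, so that mass
  -- eventually falls below `δ`.
  have hBlim : Tendsto (fun t => 8 / η * (t * √(2 * dqmError P (γ t) h t + 1 / 2 * H))) (𝓝[>] 0)
      (𝓝 0) := by
    have := (ht.mul (((hd.const_mul 2).add_const (1 / 2 * H)).sqrt)).const_mul (8 / η)
    simpa using this
  filter_upwards [hγ, self_mem_nhdsWithin, hbdd (ε / 3) (by positivity),
    hd.eventually (gt_mem_nhds (show 0 < ε1 / 4 by positivity)),
    hBlim.eventually (gt_mem_nhds (Real.sqrt_pos.2 hδ))]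
    with t ⟨hprob, e', he', hQ, hQC⟩ ht0 hb1 hd1 hB1
  have ht0 : 0 < t := ht0
  have heM := he.measurable.mono hm le_rfl
  have heM' := he'.measurable.mono hm le_rfl
  set B : Set 𝒲 := {x | e' x < η / 2} with hB
  have hBm : MeasurableSet[m] B := measurableSet_lt he'.measurable measurable_const
  have hIB : Measurable[m] (B.indicator fun _ => (1 : ℝ)) :=
    Measurable.indicator measurable_const hBm
  have hw3 : ∫ x, B.indicator (fun _ => 1) x * h x ^ 2 ∂P < ε1 := by
    refine hUI _ (hIB.mono hm le_rfl).aestronglyMeasurable (ae_of_all _ (indicator_one_mem _)) ?_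
    have h1 := integral_mul_sub_sq_le_hellingerSq he he' hm hA hIB (indicator_one_mem B)
    have h2 := sqrt_measureReal_le heM heM' he.le_one he'.pos hη heη h1.1
    have h3 := hellingerSq_le (Q := γ t) hh hh2 ht0 (hIB.mono hm le_rfl) (indicator_one_mem B)
    have h4 : ∫ x, B.indicator (fun _ => 1) x * h x ^ 2 ∂P ≤ H := by
      refine integral_mono_of_nonneg (ae_of_all _ fun x =>
        mul_nonneg (indicator_one_mem B x).1 (sq_nonneg _)) hh2 (ae_of_all _ fun x =>
        mul_le_of_le_one_left (sq_nonneg _) (indicator_one_mem B x).2)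
    have h5 : √(hellingerSq P (γ t) (B.indicator fun _ => 1)) ≤
        t * √(2 * dqmError P (γ t) h t + 1 / 2 * H) :=
      sqrt_le_mul_sqrt ht0.le (h3.trans (by gcongr))
    have h6 : √(P.real B) < √δ :=
      (h2.trans (mul_le_mul_of_nonneg_left h5 (by positivity))).trans_lt hB1
    have h7 : P.real B < δ := (Real.sqrt_lt_sqrt_iff measureReal_nonneg).1 h6
    rwa [← integral_indicator_one (hm B hBm)] at h7
  -- An error below `ε1 / 4` and a weighted score mass below `ε1` combine to 2 · ε1/4 + ½ · ε1 = ε1.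
  have hsq : ∀ {w : 𝒲 → ℝ}, Measurable w → (∀ x, 0 ≤ w x ∧ w x ≤ 1) →
      ∫ x, w x * h x ^ 2 ∂P < ε1 → √(hellingerSq P (γ t) w) ≤ t * √ε1 := by
    intro w hw hw01 hwε
    refine sqrt_le_mul_sqrt ht0.le ((hellingerSq_le (Q := γ t) hh hh2 ht0 hw hw01).trans ?_)
    gcongr
    linarith
  have s1 := hsq (measurable_const.indicator (hS K)) (indicator_one_mem _) hw1
  have s2 := hsq (hρ.mono hm le_rfl) hρ01 hw2
  have s3 := hsq (hIB.mono hm le_rfl) (indicator_one_mem _) hw3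
  have tail := abs_setIntegral_inv_mul_sub_le he he' hm hA hη hη1 heη (hN K) (hS K) (hNS K)
    (hdom he hP hPC K).1 (hdom he' hQ hQC K).1 (hdom he hP hPC K).2 (hdom he' hQ hQC K).2
    hρ hρ01 hρS
  have tail' : |∫ x in A, (e' x)⁻¹ * N K x ∂(γ t) - ∫ x in A, (e x)⁻¹ * N K x ∂P| ≤
      t * (c * √ε1) := by
    refine tail.trans ?_
    calc _ ≤ √C * (4 / η * (t * √ε1) + 8 / η ^ 2 * (t * √ε1) + 16 / η * (t * √ε1)) := by gcongr
      _ = _ := by rw [hcdef]; ring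
  -- The tail is kept in inverse weighted form because its increment is estimated through the
  -- propensities.
  have split : ∀ {κ : Measure 𝒲} [IsProbabilityMeasure κ] {ε : 𝒲 → ℝ}, IsPropensity m A κ ε →
      IntegrableOn (fun x => (ε x)⁻¹ * f x ^ 2) A κ → ∫ x in A, (ε x)⁻¹ * f x ^ 2 ∂κ ≤ C →
      ∫ x, (κ[|A])[f | m] x ∂κ =
        ∫ x, (κ[|A])[b K | m] x ∂κ + ∫ x in A, (ε x)⁻¹ * N K x ∂κ := by
    intro κ _ ε hε hi hC
    have i1 := hε.integrableOn_inv_mul hm hA hf hi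
    have i2 := hε.integrableOn_inv_mul hm hA (hN K) (hdom hε hi hC K).1
    have i3 : IntegrableOn (fun x => (ε x)⁻¹ * b K x) A κ := by
      refine (Integrable.sub i1 i2).congr (ae_of_all _ fun x => ?_)
      simp only [Pi.sub_apply, hbdef]
      ring
    have i4 : IntegrableOn (b K) A κ :=
      (integrable_of_measurable_bounded (hb K) (hbK K)).integrableOn
    rw [(hε.integral_condExp_eq hm hA (hε.integrableOn_self hf hi) i1).2,
      (hε.integral_condExp_eq hm hA i4 i3).2, ← integral_add i3 i2]
    congr 1 with x
    simp only [hbdef]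
    ring
  rw [split he hP hPC, split he' hQ hQC]
  rw [Real.dist_eq] at hb1 ⊢
  have hLK' := (hLK K).trans_lt hK1
  have tail2 : |(∫ x in A, (e' x)⁻¹ * N K x ∂(γ t) - ∫ x in A, (e x)⁻¹ * N K x ∂P) / t| < ε / 3 := by
    rw [abs_div, abs_of_pos ht0, div_lt_iff₀ ht0]
    nlinarith
  have e1 : ∀ a1 a2 b1 b2 L : ℝ, (a1 + a2 - (b1 + b2)) / t - L =
      (a1 - b1) / t + (a2 - b2) / t - L := fun a1 a2 b1 b2 L => by ring
  rw [e1]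
  rw [abs_lt] at hb1 tail2 hLK' ⊢
  constructor <;> linarith [hb1.1, hb1.2, tail2.1, tail2.2, hLK'.1, hLK'.2]

end Semiparam

/-! ### Linear paths and scores that preserve the propensity -/

namespace Semiparam

variable {𝒲 : Type*} {m m0 : MeasurableSpace 𝒲} {P : Measure 𝒲} {A : Set 𝒲} {e : 𝒲 → ℝ}

/-- The linear path `(1 + t k) dP` with bounded score `k`. -/
noncomputable def linearPath (P : Measure 𝒲) (k : 𝒲 → ℝ) (t : ℝ) : Measure 𝒲 :=
  P.withDensity fun x => ENNReal.ofReal (1 + t * k x)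

lemma linearPath_absolutelyContinuous (P : Measure 𝒲) (k : 𝒲 → ℝ) (t : ℝ) :
    linearPath P k t ≪ P := withDensity_absolutelyContinuous _ _

section

variable {k : 𝒲 → ℝ} {b t : ℝ} (hk : Measurable k) (hb : ∀ x, |k x| ≤ b) (ht : 0 < t)
  (htb : t * b ≤ 1 / 2)

include hb ht htb

lemma abs_mul_le_half (x : 𝒲) : |t * k x| ≤ 1 / 2 := by
  rw [abs_mul, abs_of_pos ht]
  exact (mul_le_mul_of_nonneg_left (hb x) ht.le).trans htb

lemma linearPath_le : linearPath P k t ≤ (2 : ℝ≥0∞) • P := by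
  rw [← withDensity_const]
  refine withDensity_mono (ae_of_all _ fun x => ?_)
  rw [show (2 : ℝ≥0∞) = ENNReal.ofReal 2 by simp]
  refine ENNReal.ofReal_le_ofReal ?_
  linarith [(abs_le.1 (abs_mul_le_half hb ht htb x)).2]

include hk

lemma integral_linearPath (F : 𝒲 → ℝ) :
    ∫ x, F x ∂(linearPath P k t) = ∫ x, (1 + t * k x) * F x ∂P := by
  rw [linearPath, integral_withDensity_eq_integral_toReal_smul (by fun_prop)
    (ae_of_all _ fun x => ENNReal.ofReal_lt_top)]
  congr 1 with x
  rw [ENNReal.toReal_ofReal (by linarith [(abs_le.1 (abs_mul_le_half hb ht htb x)).1]), smul_eq_mul]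

lemma isProbabilityMeasure_linearPath [IsProbabilityMeasure P] (hk0 : ∫ x, k x ∂P = 0) :
    IsProbabilityMeasure (linearPath P k t) := by
  constructor
  have hi : Integrable (fun x => t * k x) P := (integrable_of_measurable_bounded hk hb).const_mul t
  have hi' : Integrable (fun x => 1 + t * k x) P := (integrable_const _).add hi
  rw [linearPath, withDensity_apply _ .univ, setLIntegral_univ, ← ofReal_integral_eq_lintegral_ofReal
    hi' (ae_of_all _ fun x => by
      have := (abs_le.1 (abs_mul_le_half hb ht htb x)).1
      simp only [Pi.zero_apply]; linarith),
    integral_add (integrable_const _) hi, integral_const_mul, hk0]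
  simp

/-- Scores orthogonal to the annotation mechanism leave the propensity unchanged. -/
lemma isPropensity_linearPath [IsProbabilityMeasure P] (he : IsPropensity m A P e) (hm : m ≤ m0)
    (hA : MeasurableSet A) (hk0 : ∫ x, k x ∂P = 0)
    (horth : ∀ s, MeasurableSet[m] s →
      ∫ x in s, k x * (e x - A.indicator (fun _ => 1) x) ∂P = 0) :
    IsPropensity m A (linearPath P k t) e := by
  have hprob := isProbabilityMeasure_linearPath hk hb ht htb hk0
  have heM := he.measurable.mono hm le_rfl
  refine ⟨he.measurable, he.pos, he.le_one, ?_⟩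
  have he1 : ∀ x, |e x| ≤ 1 := fun x => by rw [abs_of_pos (he.pos x)]; exact he.le_one x
  have h1A : Measurable (A.indicator fun _ => (1 : ℝ)) := measurable_const.indicator hA
  have h1A1 : ∀ x, |A.indicator (fun _ => (1 : ℝ)) x| ≤ 1 := fun x => by
    rw [abs_of_nonneg (indicator_one_mem A x).1]; exact (indicator_one_mem A x).2
  refine (ae_eq_condExp_of_forall_setIntegral_eq hm (integrable_of_measurable_bounded h1A h1A1)
    (fun s _ _ => (integrable_of_measurable_bounded heM he1).integrableOn) (fun s hs _ => ?_)
    he.measurable.stronglyMeasurable.aestronglyMeasurable).symm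
  have hs' := hm s hs
  have hd : Measurable fun x => e x - A.indicator (fun _ => (1 : ℝ)) x := heM.sub h1A
  have hd1 : ∀ x, |e x - A.indicator (fun _ => (1 : ℝ)) x| ≤ 1 := fun x => by
    rw [abs_le]
    by_cases hx : x ∈ A <;> simp [hx] <;> constructor <;> linarith [he.pos x, he.le_one x]
  have i1 : Integrable (s.indicator fun x => e x - A.indicator (fun _ => (1 : ℝ)) x) P :=
    (integrable_of_measurable_bounded hd hd1).indicator hs'
  have i2 : Integrable (s.indicator fun x => k x * (e x - A.indicator (fun _ => (1 : ℝ)) x)) P :=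
    ((integrable_of_measurable_bounded hd hd1).bdd_mul hk.aestronglyMeasurable
      (ae_of_all _ hb)).indicator hs'
  rw [← sub_eq_zero, ← integral_sub (integrable_of_measurable_bounded heM he1).integrableOn
    (integrable_of_measurable_bounded h1A h1A1).integrableOn, ← integral_indicator hs',
    integral_linearPath hk hb ht htb]
  -- The residual `e - 1_A` over `s` has `P`-mean zero, and its first-order change along the path
  -- vanishes by `horth`.
  have hsplit : ∀ x, (1 + t * k x) *
      s.indicator (fun x => e x - A.indicator (fun _ => (1 : ℝ)) x) x =
      s.indicator (fun x => e x - A.indicator (fun _ => (1 : ℝ)) x) x +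
      t * s.indicator (fun x => k x * (e x - A.indicator (fun _ => (1 : ℝ)) x)) x := fun x => by
    by_cases hx : x ∈ s
    · simp only [Set.indicator_of_mem hx]; ring
    · simp only [Set.indicator_of_notMem hx]; ring
  simp only [hsplit]
  rw [integral_add i1 (i2.const_mul t), integral_const_mul, integral_indicator hs',
    integral_indicator hs', horth s hs, mul_zero, add_zero]
  have hr : Measurable[m] (s.indicator fun _ => (1 : ℝ)) := Measurable.indicator measurable_const hs
  have := he.integral_mul_sub_indicator hm hA hr (C := 1) fun x => by
    rw [abs_of_nonneg (indicator_one_mem s x).1]; exact (indicator_one_mem s x).2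
  rw [← integral_indicator hs', ← this]
  congr 1 with x
  by_cases hx : x ∈ s <;> simp [hx]

/-- The density relative to `P` is 1 + u with u = t k. Since √(1+u) - 1 - u/2 = -(√(1+u) - 1)²/2 and
|√(1+u) - 1| ≤ |u|, the error in the difference quotient is at most t b²/2. -/
lemma dqmError_linearPath_le [IsProbabilityMeasure P] (hk0 : ∫ x, k x ∂P = 0) {h : 𝒲 → ℝ}
    (hh : h =ᵐ[P] k) : dqmError P (linearPath P k t) h t ≤ t ^ 2 * b ^ 4 := by
  have hprob := isProbabilityMeasure_linearPath hk hb ht htb hk0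
  have hPν := absolutelyContinuous_add_left P (linearPath P k t)
  have hb0 : 0 ≤ b := by
    obtain ⟨x⟩ := P.nonempty_of_neZero
    exact (abs_nonneg _).trans (hb x)
  have hden := Measure.rnDeriv_withDensity_left_of_absolutelyContinuous hPν
    (f := fun x => ENNReal.ofReal (1 + t * k x)) (by fun_prop)
  have e1 : dqmError P (linearPath P k t) h t =
      ∫ x, ((√(1 + t * k x) - 1) / t - 1 / 2 * h x) ^ 2 ∂P := by
    rw [dqmError, ← integral_mul_rootDensity_sq hPν]
    refine integral_congr_ae ?_
    filter_upwards [hden] with x hx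
    have h1 : rootDensity (linearPath P k t) (P + linearPath P k t) x =
        √(1 + t * k x) * rootDensity P (P + linearPath P k t) x := by
      rw [rootDensity, rootDensity, linearPath] at *
      rw [hx, ENNReal.toReal_mul, ENNReal.toReal_ofReal, Real.sqrt_mul]
      all_goals linarith [(abs_le.1 (abs_mul_le_half hb ht htb x)).1]
    rw [h1]
    ring
  rw [e1]
  calc ∫ x, ((√(1 + t * k x) - 1) / t - 1 / 2 * h x) ^ 2 ∂P ≤ ∫ _, t ^ 2 * b ^ 4 ∂P := by
        refine integral_mono_of_nonneg (ae_of_all _ fun x => sq_nonneg _) (integrable_const _) ?_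
        filter_upwards [hh] with x hx
        rw [hx]
        have hu := abs_le.1 (abs_mul_le_half hb ht htb x)
        set u := t * k x with hudef
        have hs0 := Real.sqrt_nonneg (1 + u)
        have hs : √(1 + u) ^ 2 = 1 + u := Real.sq_sqrt (by linarith)
        have e2 : (√(1 + u) - 1) / t - 1 / 2 * k x = -((√(1 + u) - 1) ^ 2 / 2) / t := by
          have hkx : k x = u / t := by rw [hudef]; field_simp
          rw [hkx]
          field_simp
          linarith
        have h3 : (√(1 + u) - 1) ^ 2 ≤ u ^ 2 := by
          have h4 : (√(1 + u) - 1) * (√(1 + u) + 1) = u := by ring_nf; rw [hs]; ring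
          have h5 : u ^ 2 = (√(1 + u) - 1) ^ 2 * (√(1 + u) + 1) ^ 2 := by
            rw [← mul_pow, h4]
          rw [h5]
          exact le_mul_of_one_le_right (sq_nonneg _) (by nlinarith)
        have h6 : u ^ 2 ≤ t ^ 2 * b ^ 2 := by
          rw [hudef, mul_pow]
          refine mul_le_mul_of_nonneg_left ?_ (sq_nonneg t)
          rw [← sq_abs]
          have := hb x
          gcongr
        rw [e2, div_pow, neg_sq, div_le_iff₀ (by positivity), div_pow]
        have h7 : ((√(1 + u) - 1) ^ 2) ^ 2 ≤ (t ^ 2 * b ^ 2) ^ 2 := by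
          have := h3.trans h6
          gcongr
        have h8 : t ^ 2 * b ^ 4 * t ^ 2 = (t ^ 2 * b ^ 2) ^ 2 := by ring
        rw [h8]
        have := sq_nonneg ((√(1 + u) - 1) ^ 2)
        linarith
    _ = _ := by simp

end

lemma eventually_mul_le_half (b : ℝ) : ∀ᶠ t : ℝ in 𝓝[>] 0, 0 < t ∧ t * b ≤ 1 / 2 := by
  have h1 : Tendsto (fun t : ℝ => t * b) (𝓝 0) (𝓝 (0 * b)) := tendsto_id.mul_const b
  rw [zero_mul] at h1
  filter_upwards [self_mem_nhdsWithin,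
    nhdsWithin_le_nhds (h1.eventually (ge_mem_nhds (show (0 : ℝ) < 1 / 2 by norm_num)))]
    with t h1 h2 using ⟨h1, h2⟩

lemma isDQM_linearPath [IsProbabilityMeasure P] {k : 𝒲 → ℝ} {b : ℝ} (hk : Measurable k)
    (hb : ∀ x, |k x| ≤ b) (hk0 : ∫ x, k x ∂P = 0) {h : Lp ℝ 2 P} (hh : h =ᵐ[P] k) :
    IsDQM P (linearPath P k) h := by
  rw [isDQM_iff]
  have ht : Tendsto (fun t : ℝ => t ^ 2 * b ^ 4) (𝓝[>] 0) (𝓝 0) := by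
    have : Tendsto (fun t : ℝ => t ^ 2 * b ^ 4) (𝓝 0) (𝓝 (0 ^ 2 * b ^ 4)) :=
      (tendsto_id.pow 2).mul_const _
    simpa using this.mono_left nhdsWithin_le_nhds
  refine squeeze_zero' (Eventually.of_forall fun t => dqmError_nonneg _ _ _ _) ?_ ht
  filter_upwards [eventually_mul_le_half b] with t ⟨h1, h2⟩
  exact dqmError_linearPath_le hk hb h1 h2 hk0 hh

/-- The centered augmented inverse propensity weighted score of a bounded function is the score of
a linear path that leaves the propensity unchanged. -/
lemma exists_score_of_bounded [IsProbabilityMeasure P] (he : IsPropensity m A P e) (hm : m ≤ m0)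
    (hA : MeasurableSet A) {η : ℝ} (hη : 0 < η) (heη : ∀ x, η ≤ e x) {f : 𝒲 → ℝ}
    (hf : Measurable f) {K : ℝ} (hK : ∀ x, |f x| ≤ K) :
    ∃ (k : 𝒲 → ℝ) (b : ℝ), Measurable k ∧ (∀ x, |k x| ≤ b) ∧ ∫ x, k x ∂P = 0 ∧
      (k =ᵐ[P] fun x => aipw m A P e f x - ∫ x, (P[|A])[f | m] x ∂P) ∧
      ∀ s, MeasurableSet[m] s → ∫ x in s, k x * (e x - A.indicator (fun _ => 1) x) ∂P = 0 := by
  obtain ⟨μ, hμ, hμK, hμe, hμ0⟩ := he.exists_bounded_condExp hm hA hf hK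
  have hμ' := hμ.mono hm le_rfl
  have heM := he.measurable.mono hm le_rfl
  have hK0 : 0 ≤ K := by
    obtain ⟨x⟩ := P.nonempty_of_neZero
    exact (abs_nonneg _).trans (hK x)
  have hη' : 0 ≤ η⁻¹ := by positivity
  have hinv : ∀ x, |(e x)⁻¹| ≤ η⁻¹ := fun x => by
    rw [abs_of_nonneg (inv_nonneg.2 (he.pos x).le)]
    exact inv_anti₀ hη (heη x)
  set θ := ∫ x, (P[|A])[f | m] x ∂P with hθ
  have hI : Measurable (A.indicator fun x => (e x)⁻¹ * (f x - μ x)) :=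
    (heM.inv.mul (hf.sub hμ')).indicator hA
  have hIK : ∀ x, |A.indicator (fun x => (e x)⁻¹ * (f x - μ x)) x| ≤ η⁻¹ * (2 * K) := fun x => by
    by_cases hx : x ∈ A
    · rw [Set.indicator_of_mem hx, abs_mul]
      exact mul_le_mul (hinv x) ((abs_sub _ _).trans (by linarith [hK x, hμK x])) (abs_nonneg _) hη'
    · rw [Set.indicator_of_notMem hx, abs_zero]; positivity
  have hc : Measurable fun x => μ x - θ := hμ'.sub_const θ
  have hcK : ∀ x, |μ x - θ| ≤ K + |θ| := fun x =>
    (abs_sub _ _).trans (by linarith [hμK x])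
  refine ⟨fun x => A.indicator (fun x => (e x)⁻¹ * (f x - μ x)) x + (μ x - θ),
    η⁻¹ * (2 * K) + (K + |θ|), hI.add hc, fun x => (abs_add_le _ _).trans
    (add_le_add (hIK x) (hcK x)), ?_, ?_, fun s hs => ?_⟩
  · have h0 := hμ0 _ he.measurable.inv _ hinv
    simp only [Pi.inv_apply] at h0
    rw [integral_add (integrable_of_measurable_bounded hI hIK)
      (integrable_of_measurable_bounded hc hcK), integral_indicator hA, h0, zero_add,
      integral_sub (integrable_of_measurable_bounded hμ' hμK) (integrable_const _),
      integral_congr_ae hμe]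
    simp [hθ]
  · filter_upwards [hμe] with x hx
    unfold aipw
    by_cases hxA : x ∈ A
    · simp only [Set.indicator_of_mem hxA, hx]; ring
    · simp only [Set.indicator_of_notMem hxA, hx]; ring
  · have hs' := hm s hs
    -- On `s`, k (e - 1_A) = 1_A (1/e)(e - 1)(f - μ) + (μ - θ)(e - 1_A). The first term vanishes in
    -- mean because `μ` is the regression on `A`, the second because `e` is the propensity.
    set g : 𝒲 → ℝ := s.indicator fun x => (e x)⁻¹ * (e x - 1) with hg
    have hgm : Measurable[m] g :=
      Measurable.indicator (he.measurable.inv.mul (he.measurable.sub measurable_const)) hs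
    have hgK : ∀ x, |g x| ≤ η⁻¹ := fun x => by
      by_cases hx : x ∈ s
      · rw [hg, Set.indicator_of_mem hx, abs_mul]
        have : |e x - 1| ≤ 1 := by
          rw [abs_le]; constructor <;> linarith [he.pos x, he.le_one x]
        exact (mul_le_of_le_one_right (abs_nonneg _) this).trans (hinv x)
      · rw [hg, Set.indicator_of_notMem hx, abs_zero]; exact hη'
    set r : 𝒲 → ℝ := s.indicator fun x => μ x - θ with hr
    have hrm : Measurable[m] r := Measurable.indicator (hμ.sub measurable_const) hs
    have hrK : ∀ x, |r x| ≤ K + |θ| := fun x => by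
      by_cases hx : x ∈ s
      · rw [hr, Set.indicator_of_mem hx]; exact hcK x
      · rw [hr, Set.indicator_of_notMem hx, abs_zero]; positivity
    have h1 := hμ0 g hgm _ hgK
    have h2 := he.integral_mul_sub_indicator hm hA hrm hrK
    rw [← integral_indicator hA] at h1
    have i1 : Integrable (fun x => A.indicator (fun x => g x * (f x - μ x)) x) P := by
      refine integrable_of_measurable_bounded (((hgm.mono hm le_rfl).mul (hf.sub hμ')).indicator hA)
        (C := η⁻¹ * (2 * K)) fun x => ?_
      by_cases hx : x ∈ A
      · rw [Set.indicator_of_mem hx, abs_mul]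
        exact mul_le_mul (hgK x) ((abs_sub _ _).trans (by linarith [hK x, hμK x])) (abs_nonneg _)
          hη'
      · rw [Set.indicator_of_notMem hx, abs_zero]; positivity
    have i2 : Integrable (fun x => r x * (e x - A.indicator (fun _ => 1) x)) P := by
      refine integrable_of_measurable_bounded ((hrm.mono hm le_rfl).mul
        (heM.sub (measurable_const.indicator hA))) (C := (K + |θ|) * 1) fun x => ?_
      rw [abs_mul]
      refine mul_le_mul (hrK x) ?_ (abs_nonneg _) (by positivity)
      rw [abs_le]
      by_cases hx : x ∈ A <;> simp [hx] <;> constructor <;> linarith [he.pos x, he.le_one x]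
    rw [← integral_indicator hs', ← add_zero (0 : ℝ)]
    nth_rw 1 [← h1]
    rw [← h2, ← integral_add i1 i2]
    congr 1 with x
    by_cases hx : x ∈ s
    · by_cases hxA : x ∈ A
      · simp only [hg, hr, Set.indicator_of_mem hx, Set.indicator_of_mem hxA]; ring
      · simp only [hr, Set.indicator_of_mem hx, Set.indicator_of_notMem hxA]; ring
    · by_cases hxA : x ∈ A <;> simp [hg, hr, hx, hxA]

end Semiparam

/-! ### Density of bounded scores; uniqueness of efficient influence functions -/

namespace Semiparam

variable {𝒲 : Type*} {m m0 : MeasurableSpace 𝒲} {P : Measure 𝒲} {A : Set 𝒲} {e : 𝒲 → ℝ}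

lemma norm_sq_eq_integral_sq (φ : Lp ℝ 2 P) : ‖φ‖ ^ 2 = ∫ x, φ x ^ 2 ∂P := by
  rw [← real_inner_self_eq_norm_sq, L2.inner_def]
  congr 1 with x
  simp [sq]

lemma inner_eq_integral_mul (φ ψ : Lp ℝ 2 P) : inner ℝ φ ψ = ∫ x, φ x * ψ x ∂P := by
  rw [L2.inner_def]
  congr 1 with x
  simp [mul_comm]

lemma memLp_aipw [IsProbabilityMeasure P] (he : IsPropensity m A P e) (hm : m ≤ m0)
    (hA : MeasurableSet A) {η : ℝ} (hη : 0 < η) (hη1 : η ≤ 1) (heη : ∀ x, η ≤ e x) {f : 𝒲 → ℝ}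
    (hf : Measurable f) (hf2 : IntegrableOn (fun x => f x ^ 2) A P) :
    MemLp (aipw m A P e f) 2 P := (memLp_two_iff_integrable_sq
      (measurable_aipw hm hA he.measurable hf).aestronglyMeasurable).2
      (integral_aipw_sq_le he hm hA hη hη1 heη hf hf2).1

/-- The centered augmented inverse propensity weighted score is a limit of bounded scores that
leave the propensity unchanged. -/
lemma aipw_sub_mem_closure [IsProbabilityMeasure P] (he : IsPropensity m A P e) (hm : m ≤ m0)
    (hA : MeasurableSet A) {η : ℝ} (hη : 0 < η) (hη1 : η ≤ 1) (heη : ∀ x, η ≤ e x) {f : 𝒲 → ℝ}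
    (hf : Measurable f) (hP : IntegrableOn (fun x => (e x)⁻¹ * f x ^ 2) A P) {T : Set (Lp ℝ 2 P)}
    (hT : ∀ (φ : Lp ℝ 2 P) (k : 𝒲 → ℝ) (b : ℝ), Measurable k → (∀ x, |k x| ≤ b) →
      ∫ x, k x ∂P = 0 →
      (∀ s, MeasurableSet[m] s → ∫ x in s, k x * (e x - A.indicator (fun _ => 1) x) ∂P = 0) →
      φ =ᵐ[P] k → φ ∈ T)
    {φ : Lp ℝ 2 P} (hφ : φ =ᵐ[P] fun x => aipw m A P e f x - ∫ x, (P[|A])[f | m] x ∂P) :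
    φ ∈ closure T := by
  set S : ℕ → Set 𝒲 := fun K => {x | (K : ℝ) < |f x|} with hSdef
  set N : ℕ → 𝒲 → ℝ := fun K => (S K).indicator f with hNdef
  set b : ℕ → 𝒲 → ℝ := fun K x => f x - N K x with hbdef
  have hS : ∀ K, MeasurableSet (S K) := fun K => measurableSet_lt measurable_const hf.abs
  have hN : ∀ K, Measurable (N K) := fun K => hf.indicator (hS K)
  have hb : ∀ K, Measurable (b K) := fun K => hf.sub (hN K)
  have hbK : ∀ K x, |b K x| ≤ K := fun K x => by
    by_cases hx : x ∈ S K
    · simp [hbdef, hNdef, hx]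
    · have : |f x| ≤ K := not_lt.1 hx
      simpa [hbdef, hNdef, hx] using this
  have hf2 := he.integrableOn_sq hf hP
  have hNf : ∀ K x, N K x ^ 2 ≤ f x ^ 2 := fun K x => by
    by_cases hx : x ∈ S K <;> simp [hNdef, hx, sq_nonneg]
  have hinv : ∀ x, 0 < (e x)⁻¹ := fun x => inv_pos.2 (he.pos x)
  have hinvη : ∀ x, (e x)⁻¹ ≤ η⁻¹ := fun x => inv_anti₀ hη (heη x)
  have hN2 : ∀ K, IntegrableOn (fun x => (e x)⁻¹ * N K x ^ 2) A P := fun K => by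
    refine Integrable.mono hP (((he.measurable.mono hm le_rfl).inv.mul
      ((hN K).pow_const 2)).aestronglyMeasurable) (ae_of_all _ fun x => ?_)
    rw [Real.norm_of_nonneg (mul_nonneg (hinv x).le (sq_nonneg _))]
    exact (mul_le_mul_of_nonneg_left (hNf K x) (hinv x).le).trans (le_abs_self _)
  have hNsq := fun K => he.integrableOn_sq (hN K) (hN2 K)
  have hNA := fun K => he.integrableOn_self (hN K) (hN2 K)
  have hfA := he.integrableOn_self hf hP
  set θ := ∫ x, (P[|A])[f | m] x ∂P with hθ
  have hθK : ∀ K, |θ - ∫ x, (P[|A])[b K | m] x ∂P| ≤ √(η⁻¹ * ∫ x in A, N K x ^ 2 ∂P) := by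
    intro K
    have i1 := he.integrableOn_inv_mul hm hA hf hP
    have i2 := he.integrableOn_inv_mul hm hA (hN K) (hN2 K)
    have i3 : IntegrableOn (fun x => (e x)⁻¹ * b K x) A P := by
      refine (Integrable.sub i1 i2).congr (ae_of_all _ fun x => ?_)
      simp only [Pi.sub_apply, hbdef]
      ring
    have i4 : IntegrableOn (b K) A P :=
      (integrable_of_measurable_bounded (hb K) (hbK K)).integrableOn
    rw [hθ, (he.integral_condExp_eq hm hA hfA i1).2, (he.integral_condExp_eq hm hA i4 i3).2,
      ← integral_sub i1 i3]
    -- With `G = ∅` this is the plain weighted Cauchy–Schwarz bound over all of `A`.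
    have h1 := he.abs_setIntegral_diff_le hm hA (hN K) (hN2 K) (G := ∅) (@MeasurableSet.empty _ m)
    simp only [Set.sdiff_empty, Set.compl_empty, probReal_univ, Real.sqrt_one, one_mul] at h1
    have h2 : ∀ x, (e x)⁻¹ * f x - (e x)⁻¹ * b K x = (e x)⁻¹ * N K x := fun x => by
      simp only [hbdef]; ring
    simp only [h2]
    refine h1.trans (Real.sqrt_le_sqrt ?_)
    rw [← integral_const_mul]
    exact integral_mono (hN2 K) (Integrable.const_mul (hNsq K) _) fun x =>
      mul_le_mul_of_nonneg_right (hinvη x) (sq_nonneg _)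
  -- The approximation error is `d - aipw (N K)`, with `d` the change of centering. Its square is at
  -- most twice the sum of squares, which gives the constants 2 · 10/η² and 2/η.
  have hex : ∀ K : ℕ, ∃ ψ ∈ T, ‖ψ - φ‖ ^ 2 ≤
      (2 * (10 / η ^ 2) + 2 * η⁻¹) * ∫ x in A, N K x ^ 2 ∂P := by
    intro K
    obtain ⟨k, B, hk, hkB, hk0, hke, horth⟩ := exists_score_of_bounded he hm hA hη heη (hb K) (hbK K)
    have hkL : MemLp k 2 P := MemLp.of_bound hk.aestronglyMeasurable B (ae_of_all _ hkB)
    refine ⟨hkL.toLp k, hT _ k B hk hkB hk0 horth hkL.coeFn_toLp, ?_⟩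
    obtain ⟨i1, i2⟩ := integral_aipw_sq_le he hm hA hη hη1 heη (hN K) (hNsq K)
    rw [norm_sq_eq_integral_sq]
    set d := θ - ∫ x, (P[|A])[b K | m] x ∂P with hd
    have hd2 : d ^ 2 ≤ η⁻¹ * ∫ x in A, N K x ^ 2 ∂P := by
      have hnn : 0 ≤ η⁻¹ * ∫ x in A, N K x ^ 2 ∂P :=
        mul_nonneg (by positivity) (integral_nonneg fun x => sq_nonneg _)
      rw [← sq_abs, ← Real.sq_sqrt hnn]
      exact pow_le_pow_left₀ (abs_nonneg _) (hθK K) 2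
    calc ∫ x, (hkL.toLp k - φ : Lp ℝ 2 P) x ^ 2 ∂P
        ≤ ∫ x, (2 * aipw m A P e (N K) x ^ 2 + 2 * d ^ 2) ∂P := by
          refine integral_mono_of_nonneg (ae_of_all _ fun x => sq_nonneg _)
            ((i1.const_mul 2).add (integrable_const _)) ?_
          filter_upwards [Lp.coeFn_sub (hkL.toLp k) φ, hkL.coeFn_toLp, hφ, hke,
            aipw_sub he hm hA hfA (hNA K)] with x h1 h2 h3 h4 h5
          rw [h1, Pi.sub_apply, h2, h3, h4]
          simp only [hbdef] at h5 ⊢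
          rw [h5]
          have h6 : aipw m A P e f x - aipw m A P e (N K) x -
              ∫ x, (P[|A])[fun x => f x - N K x | m] x ∂P - (aipw m A P e f x - θ) =
              d - aipw m A P e (N K) x := by rw [hd]; ring
          rw [h6]
          nlinarith [sq_nonneg (d + aipw m A P e (N K) x)]
      _ = 2 * ∫ x, aipw m A P e (N K) x ^ 2 ∂P + 2 * d ^ 2 := by
          rw [integral_add (i1.const_mul 2) (integrable_const _), integral_const_mul]
          simp
      _ ≤ _ := by linarith
  have hlim : Tendsto (fun K : ℕ => (2 * (10 / η ^ 2) + 2 * η⁻¹) * ∫ x in A, N K x ^ 2 ∂P) atTop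
      (𝓝 0) := by
    simpa using (tendsto_setIntegral_tail_sq (μ := P.restrict A) hf hf2).const_mul
      (2 * (10 / η ^ 2) + 2 * η⁻¹)
  rw [Metric.mem_closure_iff]
  intro ε hε
  obtain ⟨K, hK⟩ := (hlim.eventually (gt_mem_nhds (show 0 < ε ^ 2 by positivity))).exists
  obtain ⟨ψ, hψ, hle⟩ := hex K
  refine ⟨ψ, hψ, ?_⟩
  rw [dist_comm, dist_eq_norm]
  exact lt_of_pow_lt_pow_left₀ 2 hε.le (hle.trans_lt hK)

/-! ### General facts on scores and efficient influence functions -/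

section

variable {𝒬 𝒬' : Set (Measure 𝒲)} {τ : Measure 𝒲 → ℝ≥0∞}
  {θ : Measure 𝒲 → ℝ}

/-- Apply the first-order expansion to the constant one: total mass does not move, so t |∫ h| =
o(t). -/
lemma integral_score_eq_zero [IsProbabilityMeasure P] {γ : ℝ → Measure 𝒲} {h : Lp ℝ 2 P}
    (hγ : ∀ᶠ t in 𝓝[>] 0, IsProbabilityMeasure (γ t)) (hd : IsDQM P γ h) : ∫ x, h x ∂P = 0 := by
  rw [isDQM_iff] at hd
  have ht : Tendsto (fun t : ℝ => t) (𝓝[>] 0) (𝓝 0) := tendsto_nhdsWithin_of_tendsto_nhds tendsto_id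
  have hlim : Tendsto (fun t => 2 * √(dqmError P (γ t) h t) +
      t * (2 * dqmError P (γ t) h t + 1 / 2 * ∫ x, h x ^ 2 ∂P)) (𝓝[>] 0) (𝓝 0) := by
    have := (hd.sqrt.const_mul 2).add (ht.mul ((hd.const_mul 2).add_const
      (1 / 2 * ∫ x, h x ^ 2 ∂P)))
    simpa using this
  have hle : |∫ x, h x ∂P| ≤ 0 := by
    refine ge_of_tendsto hlim ?_
    filter_upwards [hγ, self_mem_nhdsWithin] with t hprob ht0
    have ht0 : 0 < t := ht0
    have := abs_integral_sub_sub_le (Q := γ t) (Lp.stronglyMeasurable h).measurable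
      (Lp.memLp h).integrable_sq ht0 (f := fun _ => 1) measurable_const (K := 1) (by simp)
    simp only [integral_const, probReal_univ, smul_eq_mul, mul_one, sub_self, zero_sub, one_mul,
      abs_neg, abs_mul, abs_of_pos ht0] at this
    exact le_of_mul_le_mul_left this ht0
  exact abs_eq_zero.1 (le_antisymm hle (abs_nonneg _))

lemma IsRegularSubmodel.mono (hsub : 𝒬 ⊆ 𝒬') {γ : ℝ → Measure 𝒲} {h : Lp ℝ 2 P}
    (hγ : IsRegularSubmodel 𝒬 τ P γ h) : IsRegularSubmodel 𝒬' τ P γ h :=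
  ⟨hγ.mem.mono fun _ ht => hsub ht, hγ.dqm, hγ.moment⟩

lemma tangentSpace_mono (hsub : 𝒬 ⊆ 𝒬') : tangentSpace 𝒬 τ P ≤ tangentSpace 𝒬' τ P :=
  Submodule.topologicalClosure_mono (Submodule.span_mono fun _ ⟨γ, hγ⟩ => ⟨γ, hγ.mono hsub⟩)

lemma IsInfluenceFunction.anti (hsub : 𝒬 ⊆ 𝒬') {φ : Lp ℝ 2 P}
    (hφ : IsInfluenceFunction 𝒬' τ θ P φ) : IsInfluenceFunction 𝒬 τ θ P φ :=
  fun γ h hγ => hφ γ h (hγ.mono hsub)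

/-- The difference is orthogonal to every score, hence to the closed span of the scores, which
contains it. -/
lemma IsEIF.unique {φ ψ : Lp ℝ 2 P} (hφ : IsEIF 𝒬 τ θ P φ) (hψ : IsEIF 𝒬 τ θ P ψ) : φ = ψ := by
  have hle : tangentSpace 𝒬 τ P ≤ (Submodule.span ℝ {φ - ψ})ᗮ := by
    refine Submodule.topologicalClosure_minimal _ (Submodule.span_le.2 ?_)
      (Submodule.isClosed_orthogonal _)
    rintro h ⟨γ, hγ⟩
    rw [SetLike.mem_coe, Submodule.mem_orthogonal_singleton_iff_inner_right, inner_sub_left,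
      inner_eq_integral_mul, inner_eq_integral_mul, sub_eq_zero]
    exact tendsto_nhds_unique (hφ.1 γ h hγ) (hψ.1 γ h hγ)
  have h1 := hle (sub_mem hφ.2 hψ.2)
  rw [Submodule.mem_orthogonal_singleton_iff_inner_right, inner_self_eq_zero, sub_eq_zero] at h1
  exact h1

lemma closure_tangentSet_subset_tangentSpace :
    closure (tangentSet 𝒬 τ P) ⊆ (tangentSpace 𝒬 τ P : Set (Lp ℝ 2 P)) := by
  rw [tangentSpace, Submodule.topologicalClosure_coe]
  exact closure_mono Submodule.subset_span

end

end Semiparam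

namespace Semiparam

/-! ### Consequences of conditional independence -/

section

variable {Ω ζ β β' : Type*} [MeasurableSpace Ω] [StandardBorelSpace Ω] [mζ : MeasurableSpace ζ]
  [MeasurableSpace β] [MeasurableSpace β'] {ρ : Measure Ω} [IsProbabilityMeasure ρ]
  {Z : Ω → ζ} {f : Ω → β} {g : Ω → β'} {q : ζ → ℝ}

/-- If `f` is independent of `g` given `Z`, then the conditional probability of `g ∈ R` given
`(Z, f)` is that given `Z`. -/
lemma map_restrict_eq_map_withDensity (hZ : Measurable Z) (hf : Measurable f) (hg : Measurable g)
    (hind : CondIndepFun (MeasurableSpace.comap Z inferInstance) hZ.comap_le f g ρ)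
    {R : Set β'} (hR : MeasurableSet R) (hq : Measurable q) (hq01 : ∀ z, 0 ≤ q z ∧ q z ≤ 1)
    (hqR : ρ⟦g ⁻¹' R | MeasurableSpace.comap Z inferInstance⟧ =ᵐ[ρ] fun ω => q (Z ω)) :
    (ρ.restrict (g ⁻¹' R)).map (fun ω => (Z ω, f ω)) =
      (ρ.withDensity fun ω => ENNReal.ofReal (q (Z ω))).map fun ω => (Z ω, f ω) := by
  have hqZ : Measurable fun ω => q (Z ω) := hq.comp hZ
  have hqi : Integrable (fun ω => q (Z ω)) ρ :=
    integrable_of_measurable_bounded hqZ (C := 1) fun ω => by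
      rw [abs_of_nonneg (hq01 _).1]; exact (hq01 _).2
  have : IsFiniteMeasure (ρ.withDensity fun ω => ENNReal.ofReal (q (Z ω))) :=
    isFiniteMeasure_withDensity_ofReal hqi.2
  have : IsFiniteMeasure ((ρ.restrict (g ⁻¹' R)).map fun ω => (Z ω, f ω)) :=
    Measure.isFiniteMeasure_map _ _
  -- Both measures are finite, so rectangles suffice. There the product formula for conditional
  -- probabilities and pulling out `q ∘ Z` give the identity.
  refine Measure.ext_prod fun {s t} hs ht => ?_
  have hs' : MeasurableSet[MeasurableSpace.comap Z inferInstance] (Z ⁻¹' s) := ⟨s, hs, rfl⟩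
  have hZs := hZ hs
  have hft := hf ht
  have hgR := hg hR
  have hpre : (fun ω => (Z ω, f ω)) ⁻¹' (s ×ˢ t) = Z ⁻¹' s ∩ f ⁻¹' t := rfl
  rw [Measure.map_apply (hZ.prodMk hf) (hs.prod ht), Measure.map_apply (hZ.prodMk hf) (hs.prod ht),
    hpre, Measure.restrict_apply (hZs.inter hft), withDensity_apply _ (hZs.inter hft),
    ← ofReal_integral_eq_lintegral_ofReal hqi.integrableOn (ae_of_all _ fun ω => (hq01 _).1)]
  have h1 := (condIndepFun_iff_condExp_inter_preimage_eq_mul hf hg).1 hind t R ht hR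
  have hti : Integrable ((f ⁻¹' t).indicator fun _ => (1 : ℝ)) ρ := (integrable_const _).indicator hft
  have hqt : Integrable (fun ω => q (Z ω) * (f ⁻¹' t).indicator (fun _ => (1 : ℝ)) ω) ρ :=
    hti.bdd_mul hqZ.aestronglyMeasurable (c := 1) (ae_of_all _ fun ω => by
      rw [Real.norm_of_nonneg (hq01 _).1]; exact (hq01 _).2)
  have hqm : StronglyMeasurable[MeasurableSpace.comap Z inferInstance] fun ω => q (Z ω) :=
    (hq.comp (comap_measurable Z)).stronglyMeasurable
  have h2 := condExp_mul_of_stronglyMeasurable_left hqm hqt hti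
  have h3 : ∫ ω in Z ⁻¹' s, (f ⁻¹' t ∩ g ⁻¹' R).indicator (fun _ => (1 : ℝ)) ω ∂ρ =
      ∫ ω in Z ⁻¹' s, q (Z ω) * (f ⁻¹' t).indicator (fun _ => (1 : ℝ)) ω ∂ρ := by
    rw [← setIntegral_condExp hZ.comap_le ((integrable_const _).indicator (hft.inter hgR)) hs',
      ← setIntegral_condExp hZ.comap_le hqt hs']
    refine setIntegral_congr_ae hZs ?_
    filter_upwards [h1, h2, hqR] with ω e1 e2 e3 _
    rw [e1, e3]
    refine Eq.trans ?_ e2.symm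
    simp [mul_comm]
  have h4 : ∀ ω, q (Z ω) * (f ⁻¹' t).indicator (fun _ => (1 : ℝ)) ω =
      (f ⁻¹' t).indicator (fun ω => q (Z ω)) ω := fun ω => by
    by_cases hω : ω ∈ f ⁻¹' t <;> simp [hω]
  simp only [h4] at h3
  rw [setIntegral_indicator (hft.inter hgR), setIntegral_indicator hft, setIntegral_const, smul_eq_mul,
    mul_one] at h3
  rw [← h3, ofReal_measureReal, Set.inter_assoc]

-- Converts equality of laws back into a conditional probability given the enlarged variable, the
-- form in which the next conditional independence consumes it.
omit [StandardBorelSpace Ω] in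
lemma condProb_eq_of_map_eq (hZ : Measurable Z) (hf : Measurable f) {E : Set Ω}
    (hE : MeasurableSet E) (hq : Measurable q) (hq01 : ∀ z, 0 ≤ q z ∧ q z ≤ 1)
    (h : (ρ.restrict E).map (fun ω => (Z ω, f ω)) =
      (ρ.withDensity fun ω => ENNReal.ofReal (q (Z ω))).map fun ω => (Z ω, f ω)) :
    ρ⟦E | MeasurableSpace.comap (fun ω => (Z ω, f ω)) inferInstance⟧ =ᵐ[ρ] fun ω => q (Z ω) := by
  have hZf := hZ.prodMk hf
  have hqZ : Measurable fun ω => q (Z ω) := hq.comp hZ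
  have hqi : Integrable (fun ω => q (Z ω)) ρ :=
    integrable_of_measurable_bounded hqZ (C := 1) fun ω => by
      rw [abs_of_nonneg (hq01 _).1]; exact (hq01 _).2
  refine (ae_eq_condExp_of_forall_setIntegral_eq hZf.comap_le ((integrable_const _).indicator hE)
    (fun s _ _ => hqi.integrableOn) ?_
    ((hq.comp measurable_fst).comp (comap_measurable fun ω => (Z ω, f ω))).stronglyMeasurable.aestronglyMeasurable).symm
  rintro _ ⟨T, hT, rfl⟩ -
  have h1 := congrArg (fun κ => κ T) h
  rw [Measure.map_apply hZf hT, Measure.map_apply hZf hT, Measure.restrict_apply (hZf hT),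
    withDensity_apply _ (hZf hT), ← ofReal_integral_eq_lintegral_ofReal hqi.integrableOn
      (ae_of_all _ fun ω => (hq01 _).1)] at h1
  rw [setIntegral_indicator hE, setIntegral_const, smul_eq_mul, mul_one, Measure.real, h1,
    ENNReal.toReal_ofReal (integral_nonneg fun ω => (hq01 _).1)]

end

lemma isPropensity_of_setLIntegral {𝒲 : Type*} {m m0 : MeasurableSpace 𝒲} {Q : Measure 𝒲}
    [IsProbabilityMeasure Q] {A : Set 𝒲} {e : 𝒲 → ℝ} (hm : m ≤ m0) (hA : MeasurableSet A)
    (he : Measurable[m] e) (hpos : ∀ x, 0 < e x) (hle : ∀ x, e x ≤ 1)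
    (h : ∀ s, MeasurableSet[m] s → Q (s ∩ A) = ∫⁻ x in s, ENNReal.ofReal (e x) ∂Q) :
    IsPropensity m A Q e := by
  have hei : Integrable e Q := integrable_of_measurable_bounded (he.mono hm le_rfl) (C := 1)
    fun x => by rw [abs_of_pos (hpos x)]; exact hle x
  refine ⟨he, hpos, hle, (ae_eq_condExp_of_forall_setIntegral_eq hm ((integrable_const _).indicator
    hA) (fun s _ _ => hei.integrableOn) (fun s hs _ => ?_)
    he.stronglyMeasurable.aestronglyMeasurable).symm⟩
  have h1 := h s hs
  rw [← ofReal_integral_eq_lintegral_ofReal hei.integrableOn (ae_of_all _ fun x => (hpos x).le)] at h1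
  rw [setIntegral_indicator hA, setIntegral_const, smul_eq_mul, mul_one, Measure.real, h1,
    ENNReal.toReal_ofReal (integral_nonneg fun x => (hpos x).le)]

end Semiparam

/-! ### Gradient and tangent space in the missing-at-random models -/

namespace MARS

open Semiparam

variable {𝓜 𝒳 𝒰 𝒱 : Type*} [MeasurableSpace 𝓜] [MeasurableSpace 𝒳] [MeasurableSpace 𝒰]
  [MeasurableSpace 𝒱]

lemma sigmaX_le : (sigmaX : MeasurableSpace (Obs 𝓜 𝒳 𝒰 𝒱)) ≤
    (inferInstance : MeasurableSpace (Obs 𝓜 𝒳 𝒰 𝒱)) :=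
  (measurable_snd.comp measurable_snd).comap_le

lemma measurableSet_annotated : MeasurableSet (annotated : Set (Obs 𝓜 𝒳 𝒰 𝒱)) :=
  (measurable_fst.comp measurable_snd) (measurableSet_singleton true)

variable {g : 𝓜 → 𝒱 → ℝ} {Q P : Measure (Obs 𝓜 𝒳 𝒰 𝒱)} {e : Obs 𝓜 𝒳 𝒰 𝒱 → ℝ}

lemma measurable_tildeM (hg : Measurable (Function.uncurry g)) :
    Measurable (tildeM g : Obs 𝓜 𝒳 𝒰 𝒱 → ℝ) :=
  hg.comp (measurable_fst.prodMk
    (measurable_snd.comp (measurable_snd.comp (measurable_snd.comp measurable_snd))))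

/-- In this form a bound on τ is the uniform weighted moment bound that the derivative theorem asks
for. -/
lemma secondMoment_eq [IsProbabilityMeasure Q] (hg : Measurable (Function.uncurry g))
    (he : IsPropensity sigmaX annotated Q e) :
    secondMoment g Q = ∫⁻ w in annotated, ENNReal.ofReal ((e w)⁻¹ * tildeM g w ^ 2) ∂Q := by
  rw [secondMoment, he.lintegral_condLExp_eq sigmaX_le measurableSet_annotated
    ((measurable_tildeM hg).pow_const 2).ennreal_ofReal]
  refine lintegral_congr fun w => ?_
  rw [ENNReal.ofReal_mul (inv_nonneg.2 (he.pos w).le)]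

lemma integrableOn_of_secondMoment_lt_top [IsProbabilityMeasure Q]
    (hg : Measurable (Function.uncurry g)) (he : IsPropensity sigmaX annotated Q e)
    (h : secondMoment g Q < ∞) :
    IntegrableOn (fun w => (e w)⁻¹ * tildeM g w ^ 2) annotated Q ∧
      ∫ w in annotated, (e w)⁻¹ * tildeM g w ^ 2 ∂Q = (secondMoment g Q).toReal := by
  have hmeas : Measurable fun w => (e w)⁻¹ * tildeM g w ^ 2 :=
    (he.measurable.mono sigmaX_le le_rfl).inv.mul ((measurable_tildeM hg).pow_const 2)
  have hnn : ∀ w, 0 ≤ (e w)⁻¹ * tildeM g w ^ 2 := fun w =>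
    mul_nonneg (inv_nonneg.2 (he.pos w).le) (sq_nonneg _)
  rw [secondMoment_eq hg he] at h ⊢
  exact ⟨(lintegral_ofReal_ne_top_iff_integrable hmeas.aestronglyMeasurable
    (ae_of_all _ hnn)).1 h.ne,
    integral_eq_lintegral_of_nonneg_ae (ae_of_all _ hnn) hmeas.aestronglyMeasurable⟩

variable {η : ℝ}

/-- The gradient of the functional in the nonparametric model. -/
lemma hasPathwiseDeriv_theta [Zero 𝓜] [IsProbabilityMeasure P]
    (hg : Measurable (Function.uncurry g))
    (he : IsPropensity sigmaX annotated P e) (hη : 0 < η) (hη1 : η ≤ 1) (heη : ∀ w, η ≤ e w)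
    (hP : secondMoment g P < ∞) {γ : ℝ → Measure (Obs 𝓜 𝒳 𝒰 𝒱)} {h : Lp ℝ 2 P}
    (hγ : IsRegularSubmodel (nonparametricModel g) (secondMoment g) P γ h) :
    HasPathwiseDeriv (theta g) P γ
      (∫ w, aipw sigmaX annotated P e (tildeM g) w * h w ∂P) := by
  obtain ⟨hP1, hP2⟩ := integrableOn_of_secondMoment_lt_top hg he hP
  obtain ⟨C, hC, hCt⟩ := hγ.moment
  refine tendsto_integral_condExp_div he sigmaX_le measurableSet_annotated hη hη1 heη
    (Lp.stronglyMeasurable h).measurable (Lp.memLp h).integrable_sq (measurable_tildeM hg)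
    (C := max C.toReal (secondMoment g P).toReal) hP1 (hP2.le.trans (le_max_right _ _)) ?_
    (isDQM_iff.1 hγ.dqm)
  filter_upwards [hγ.mem, hCt] with t ht htC
  obtain ⟨hprob, -, hpos, hfin⟩ := ht
  obtain ⟨e', he'⟩ := exists_isPropensity measurableSet_annotated hpos
  obtain ⟨h1, h2⟩ := integrableOn_of_secondMoment_lt_top hg he' hfin
  exact ⟨hprob, e', he', h1, h2.le.trans
    ((ENNReal.toReal_mono hC.ne htC).trans (le_max_left _ _))⟩

/-- Linear paths that leave the propensity unchanged are regular submodels. -/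
lemma isRegularSubmodel_linearPath [Zero 𝓜] [MeasurableSingletonClass 𝓜]
    [IsProbabilityMeasure P] {π : 𝒳 → ℝ} (hg : Measurable (Function.uncurry g))
    (he : IsPropensity sigmaX annotated P e) (heπ : ∀ w, e w = π w.2.2.1)
    (hP : P ∈ nonparametricModel g) {k : Obs 𝓜 𝒳 𝒰 𝒱 → ℝ} {b : ℝ} (hk : Measurable k)
    (hb : ∀ w, |k w| ≤ b) (hk0 : ∫ w, k w ∂P = 0)
    (horth : ∀ s, MeasurableSet[sigmaX] s →
      ∫ w in s, k w * (e w - annotated.indicator (fun _ => 1) w) ∂P = 0)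
    {h : Lp ℝ 2 P} (hh : h =ᵐ[P] k) :
    IsRegularSubmodel (knownScoreModel g π) (secondMoment g) P (linearPath P k) h := by
  -- The propensity does not move and the density is at most 2, so the weighted second moment at
  -- most doubles.
  have hτ : ∀ {t : ℝ}, 0 < t → t * b ≤ 1 / 2 →
      secondMoment g (linearPath P k t) ≤ 2 * secondMoment g P := fun {t} h1 h2 => by
    have hprob := isProbabilityMeasure_linearPath hk hb h1 h2 hk0
    rw [secondMoment_eq hg he, secondMoment_eq hg (isPropensity_linearPath hk hb h1 h2 he sigmaX_le
      measurableSet_annotated hk0 horth)]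
    refine (lintegral_mono' (Measure.restrict_mono le_rfl (linearPath_le hb h1 h2)) le_rfl).trans ?_
    rw [Measure.restrict_smul, lintegral_smul_measure, smul_eq_mul]
  refine ⟨?_, isDQM_linearPath hk hb hk0 hh, 2 * secondMoment g P,
    ENNReal.mul_lt_top (by simp) hP.2.2.2, ?_⟩
  · filter_upwards [eventually_mul_le_half b] with t ⟨h1, h2⟩
    have hprop := isPropensity_linearPath hk hb h1 h2 he sigmaX_le measurableSet_annotated hk0 horth
    have hae : annotationProb (linearPath P k t) =ᵐ[linearPath P k t] e := hprop.condExp_eq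
    refine ⟨⟨isProbabilityMeasure_linearPath hk hb h1 h2 hk0,
      (linearPath_absolutelyContinuous P k t).ae_le hP.2.1, ?_,
      (hτ h1 h2).trans_lt (ENNReal.mul_lt_top (by simp) hP.2.2.2)⟩, ?_⟩
    · filter_upwards [hae] with w hw
      rw [hw]; exact he.pos w
    · filter_upwards [hae] with w hw
      rw [hw, heπ]
  · filter_upwards [eventually_mul_le_half b] with t ⟨h1, h2⟩ using hτ h1 h2

/-- The gradient is orthogonal to the annotation-mechanism scores. -/
lemma integral_aipw_mul_annotationScore [IsProbabilityMeasure P]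
    (hg : Measurable (Function.uncurry g)) (he : IsPropensity sigmaX annotated P e) (hη : 0 < η)
    (heη : ∀ w, η ≤ e w) (hP : secondMoment g P < ∞) {h : Lp ℝ 2 P} (hh : h ∈ annotationScores P) :
    ∫ w, aipw sigmaX annotated P e (tildeM g) w * h w ∂P = 0 := by
  have hm : (sigmaX : MeasurableSpace (Obs 𝓜 𝒳 𝒰 𝒱)) ≤
    (inferInstance : MeasurableSpace (Obs 𝓜 𝒳 𝒰 𝒱)) := sigmaX_le
  have hA : MeasurableSet (annotated : Set (Obs 𝓜 𝒳 𝒰 𝒱)) := measurableSet_annotated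
  have hf : Measurable (tildeM g : Obs 𝓜 𝒳 𝒰 𝒱 → ℝ) := measurable_tildeM hg
  obtain ⟨hP1, -⟩ := integrableOn_of_secondMoment_lt_top hg he hP
  have hf2 := he.integrableOn_sq hf hP1
  obtain ⟨hmeas, hcond⟩ := hh
  -- Factor the score through (A, X̃). On `annotated` it then agrees with `h1`, a function of X̃
  -- alone, so the regression residual is orthogonal to it.
  obtain ⟨H, hH, hHeq⟩ := hmeas.stronglyMeasurable_mk.measurable.exists_eq_measurable_comp
  have hhH : h =ᵐ[P] fun w => H w.2 := by
    filter_upwards [hmeas.ae_eq_mk] with w hw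
    rw [hw, hHeq]; rfl
  set h1 : Obs 𝓜 𝒳 𝒰 𝒱 → ℝ := fun w => H (true, w.2.2) with hh1
  have hh1m : Measurable[sigmaX] h1 :=
    (hH.comp (measurable_const.prodMk measurable_id)).comp (comap_measurable _)
  have hh1A : ∀ᵐ w ∂P.restrict annotated, h1 w = h w := by
    filter_upwards [ae_restrict_of_ae hhH, ae_restrict_mem hA] with w hw hwA
    have hwA' : w.2.1 = true := hwA
    rw [hw, hh1]
    simp only [← hwA']
  have hhL := Lp.memLp h
  have hfL : MemLp (tildeM g) 2 (P.restrict annotated) :=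
    (memLp_two_iff_integrable_sq hf.aestronglyMeasurable).2 hf2
  set μ := (P[|annotated])[tildeM g | sigmaX] with hμdef
  have hμ : Measurable[sigmaX] μ := stronglyMeasurable_condExp.measurable
  have hμL : MemLp μ 2 P := (memLp_two_iff_integrable_sq
    (hμ.mono hm le_rfl).aestronglyMeasurable).2
    (integral_condExp_cond_sq_le he hm hA hη heη hf hf2).1
  have hμh : Integrable (fun w => μ w * h w) P := hμL.integrable_mul hhL
  -- The regression depends on X̃ only, and the score has conditional mean zero given X̃.
  have z1 : ∫ w, μ w * h w ∂P = 0 := by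
    have := condExp_mul_of_stronglyMeasurable_left hμ.stronglyMeasurable hμh
      (hhL.integrable (by norm_num))
    refine (integral_condExp hm (f := μ * (h : Obs 𝓜 𝒳 𝒰 𝒱 → ℝ))).symm.trans ?_
    rw [integral_congr_ae this, ← integral_zero (Obs 𝓜 𝒳 𝒰 𝒱) ℝ (μ := P)]
    refine integral_congr_ae ?_
    filter_upwards [hcond] with w hw
    rw [Pi.mul_apply, hw, Pi.zero_apply, mul_zero]
  have hinv : ∀ {F : Obs 𝓜 𝒳 𝒰 𝒱 → ℝ}, IntegrableOn F annotated P →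
      IntegrableOn (fun w => (e w)⁻¹ * F w) annotated P := fun hF =>
    hF.bdd_mul (he.measurable.mono hm le_rfl).inv.aestronglyMeasurable (c := η⁻¹)
      (ae_of_all _ fun w => by
        rw [Real.norm_of_nonneg (inv_nonneg.2 (he.pos w).le)]
        exact inv_anti₀ hη (heη w))
  have hfh : IntegrableOn (fun w => h w * tildeM g w) annotated P :=
    (hhL.restrict _).integrable_mul hfL
  have hgm : Measurable[sigmaX] fun w => (e w)⁻¹ * h1 w := he.measurable.inv.mul hh1m
  have hgf : IntegrableOn (fun w => (e w)⁻¹ * h1 w * tildeM g w) annotated P := by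
    refine Integrable.congr (hinv hfh) ?_
    filter_upwards [hh1A] with w hw
    rw [hw, mul_assoc]
  obtain ⟨i1, i2⟩ := he.integrableOn_mul_condExp hm hA hgm (he.integrableOn_self hf hP1) hgf
  have z2 : ∫ w in annotated, (e w)⁻¹ * (tildeM g w - μ w) * h w ∂P = 0 := by
    rw [← sub_self (∫ w in annotated, (e w)⁻¹ * h1 w * tildeM g w ∂P)]
    nth_rw 2 [← i2]
    rw [← integral_sub hgf i1]
    refine integral_congr_ae ?_
    filter_upwards [hh1A] with w hw
    rw [hw]; ring
  have i3 : IntegrableOn (fun w => (e w)⁻¹ * (tildeM g w - μ w) * h w) annotated P := by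
    refine (Integrable.sub hgf i1).congr ?_
    filter_upwards [hh1A] with w hw
    rw [Pi.sub_apply, hw]; ring
  have hsplit : ∀ w, aipw sigmaX annotated P e (tildeM g) w * h w =
      annotated.indicator (fun w => (e w)⁻¹ * (tildeM g w - μ w) * h w) w + μ w * h w := fun w => by
    unfold aipw
    by_cases hw : w ∈ annotated
    · simp only [Set.indicator_of_mem hw, ← hμdef]; ring
    · simp only [Set.indicator_of_notMem hw, ← hμdef]; ring
  simp only [hsplit]
  rw [integral_add ((integrable_indicator_iff hA).2 i3) hμh, integral_indicator hA, z1, z2, add_zero]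

/-- The efficient influence function exists, is unique and is the same in both models. -/
theorem exists_isEIF [Zero 𝓜] [MeasurableSingletonClass 𝓜] {π : 𝒳 → ℝ}
    (hg : Measurable (Function.uncurry g)) (hP : P ∈ nonparametricModel g)
    (he : IsPropensity sigmaX annotated P e) (heπ : ∀ w, e w = π w.2.2.1) (hη : 0 < η)
    (hη1 : η ≤ 1) (heη : ∀ w, η ≤ e w) :
    ∃ φ : Lp ℝ 2 P, IsEIF (nonparametricModel g) (secondMoment g) (theta g) P φ ∧
      IsEIF (knownScoreModel g π) (secondMoment g) (theta g) P φ := by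
  have hprob : IsProbabilityMeasure P := hP.1
  have hf : Measurable (tildeM g : Obs 𝓜 𝒳 𝒰 𝒱 → ℝ) := measurable_tildeM hg
  obtain ⟨hP1, -⟩ := integrableOn_of_secondMoment_lt_top hg he hP.2.2.2
  have hf2 := he.integrableOn_sq hf hP1
  have hAL := memLp_aipw he sigmaX_le measurableSet_annotated hη hη1 heη hf hf2
  have hL : MemLp (fun w => aipw sigmaX annotated P e (tildeM g) w - theta g P) 2 P :=
    hAL.sub (memLp_const _)
  obtain ⟨φ, hφ⟩ : ∃ φ : Lp ℝ 2 P,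
      φ =ᵐ[P] fun w => aipw sigmaX annotated P e (tildeM g) w - theta g P :=
    ⟨hL.toLp _, hL.coeFn_toLp⟩
  have hsub : (knownScoreModel g π : Set (Measure (Obs 𝓜 𝒳 𝒰 𝒱))) ⊆ nonparametricModel g :=
    fun _ h => h.1
  -- Centering by `theta g P` does not change the pairing, as scores have mean zero.
  have hIF : IsInfluenceFunction (nonparametricModel g) (secondMoment g) (theta g) P
      φ := by
    intro γ h hγ
    have h0 : ∫ w, h w ∂P = 0 := integral_score_eq_zero (hγ.mem.mono fun t ht => ht.1) hγ.dqm
    have h1 : ∫ w, φ w * h w ∂P =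
        ∫ w, aipw sigmaX annotated P e (tildeM g) w * h w ∂P := by
      have hhL := Lp.memLp h
      have j1 : Integrable (fun w => aipw sigmaX annotated P e (tildeM g) w * h w) P :=
        hAL.integrable_mul hhL
      have j2 : Integrable (fun w => theta g P * h w) P :=
        (hhL.integrable (by norm_num)).const_mul _
      rw [← sub_zero (∫ w, aipw sigmaX annotated P e (tildeM g) w * h w ∂P),
        ← mul_zero (theta g P), ← h0, ← integral_const_mul, ← integral_sub j1 j2]
      refine integral_congr_ae ?_
      filter_upwards [hφ] with w hw
      rw [hw, sub_mul]
    rw [h1]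
    exact hasPathwiseDeriv_theta hg he hη hη1 heη hP.2.2.2 hγ
  -- Membership is shown in the tangent space of the smaller model; the larger one inherits it by
  -- monotonicity, while the influence function property restricts the other way.
  have hT : φ ∈ tangentSpace (knownScoreModel g π) (secondMoment g) P := by
    refine closure_tangentSet_subset_tangentSpace ?_
    refine aipw_sub_mem_closure he sigmaX_le measurableSet_annotated hη hη1 heη hf hP1
      (fun ψ k b hk hb hk0 horth hψ => ?_) hφ
    exact ⟨linearPath P k, isRegularSubmodel_linearPath hg he heπ hP hk hb hk0 horth hψ⟩
  exact ⟨φ, ⟨hIF, tangentSpace_mono hsub hT⟩, ⟨hIF.anti hsub, hT⟩⟩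

end MARS

/-! ### From the latent law to the law of the observed data -/

theorem mainTheorem3
    {𝓜 𝒳 𝒰 𝒱 Ω : Type*}
    [AddCommGroup 𝓜] [Module ℝ 𝓜] [MeasurableSpace 𝓜] [MeasurableSingletonClass 𝓜]
    [MeasurableSpace 𝒳] [MeasurableSpace 𝒰] [MeasurableSpace 𝒱]
    [MeasurableSpace Ω] [StandardBorelSpace Ω]
    (ρ : Measure Ω) [IsProbabilityMeasure ρ]
    -- ground truth `M*`, structured data `M`, annotation `A`, and `X`, `U`, `V`
    (Mstar M : Ω → 𝓜) (A : Ω → Bool) (X : Ω → 𝒳) (U : Ω → 𝒰) (V : Ω → 𝒱)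
    (hMstar : Measurable Mstar) (hM : Measurable M) (hA : Measurable A)
    (hX : Measurable X) (hU : Measurable U) (hV : Measurable V)
    -- consistency: `M = A M*`
    (hcons : ∀ᵐ ω ∂ρ, M ω = if A ω = true then Mstar ω else 0)
    -- missing at random: `(U, M*) ⫫ A ∣ X`
    (hMAR : CondIndepFun (MeasurableSpace.comap X inferInstance) hX.comap_le
      (fun ω => (U ω, Mstar ω)) A ρ)
    -- `V ⫫ A ∣ (X, U, M*)`
    (hVA : CondIndepFun
      (MeasurableSpace.comap (fun ω => (X ω, U ω, Mstar ω)) inferInstance)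
      (hX.prodMk (hU.prodMk hMstar)).comap_le V A ρ)
    -- the annotation score function, bounded away from zero
    (π : 𝒳 → ℝ) (hπ : Measurable π) (η : ℝ) (hη0 : 0 < η) (hη1 : η < 1)
    (hπη : ∀ x, η ≤ π x ∧ π x ≤ 1)
    (hscore : ρ⟦A ⁻¹' {true} | MeasurableSpace.comap X inferInstance⟧ =ᵐ[ρ] fun ω => π (X ω))
    -- the MAR-S mean functional: `M̃* = g(M*, V)`, `g` homogeneous of degree one in `M*`
    (g : 𝓜 → 𝒱 → ℝ) (hg : Measurable (Function.uncurry g))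
    (hghom : ∀ (c : ℝ) (m : 𝓜) (v : 𝒱), 0 < c → g (c • m) v = c * g m v)
    (hL2 : MemLp (fun ω => g (Mstar ω) (V ω)) 2 ρ)
    -- the law of the observed data
    (P : Measure (MARS.Obs 𝓜 𝒳 𝒰 𝒱))
    (hP : P = ρ.map (fun ω => (M ω, A ω, X ω, U ω, V ω))) :
    -- `P` lies in both models and the functional is point identified
    P ∈ MARS.knownScoreModel g π ∧
    MARS.theta g P = ∫ ω, g (Mstar ω) (V ω) ∂ρ ∧
    -- the pathwise derivative vanishes along annotation-mechanism scores
    (∀ (γ : ℝ → Measure (MARS.Obs 𝓜 𝒳 𝒰 𝒱)) (h : Lp ℝ 2 P),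
      Semiparam.IsRegularSubmodel (MARS.nonparametricModel g) (MARS.secondMoment g) P γ h →
      h ∈ MARS.annotationScores P →
      Semiparam.HasPathwiseDeriv (MARS.theta g) P γ 0) ∧
    -- the efficient influence function exists, is unique, and is the same in both models
    (∃! φ : Lp ℝ 2 P,
      Semiparam.IsEIF (MARS.nonparametricModel g) (MARS.secondMoment g) (MARS.theta g) P φ) ∧
    (∀ φ : Lp ℝ 2 P,
      Semiparam.IsEIF (MARS.nonparametricModel g) (MARS.secondMoment g) (MARS.theta g) P φ ↔
      Semiparam.IsEIF (MARS.knownScoreModel g π) (MARS.secondMoment g) (MARS.theta g) P φ) := by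
  set W : Ω → MARS.Obs 𝓜 𝒳 𝒰 𝒱 := fun ω => (M ω, A ω, X ω, U ω, V ω) with hWdef
  have hW : Measurable W := hM.prodMk (hA.prodMk (hX.prodMk (hU.prodMk hV)))
  have hPprob : IsProbabilityMeasure P := by
    rw [hP]; exact Measure.isProbabilityMeasure_map hW.aemeasurable
  set E : Set Ω := A ⁻¹' {true} with hEdef
  have hE : MeasurableSet E := hA (measurableSet_singleton true)
  have hWE : W ⁻¹' MARS.annotated = E := rfl
  have hπ01 : ∀ x, 0 ≤ π x ∧ π x ≤ 1 := fun x => ⟨hη0.le.trans (hπη x).1, (hπη x).2⟩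
  have hπpos : ∀ x, 0 < π x := fun x => hη0.trans_le (hπη x).1
  -- the annotation is independent of `(U, M*, V)` given `X`
  have key1 := Semiparam.map_restrict_eq_map_withDensity hX (hU.prodMk hMstar) hA hMAR
    (measurableSet_singleton true) hπ hπ01 hscore
  have c1 := Semiparam.condProb_eq_of_map_eq hX (hU.prodMk hMstar) hE hπ hπ01 key1
  have hπ1 : Measurable fun z : 𝒳 × 𝒰 × 𝓜 => π z.1 := hπ.comp measurable_fst
  -- The score found given (X, U, M*) is still π(X), so the second independence adds V to the
  -- conditioning.
  have key2 := Semiparam.map_restrict_eq_map_withDensity (hX.prodMk (hU.prodMk hMstar)) hV hA hVA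
    (measurableSet_singleton true) hπ1 (fun z => hπ01 z.1) c1
  set Z : Ω → (𝒳 × 𝒰 × 𝓜) × 𝒱 := fun ω => ((X ω, U ω, Mstar ω), V ω) with hZdef
  have hZ : Measurable Z := (hX.prodMk (hU.prodMk hMstar)).prodMk hV
  have key : (ρ.restrict E).map Z =
      (ρ.withDensity fun ω => ENNReal.ofReal (π (X ω))).map Z := key2
  have hπX : Measurable fun ω => ENNReal.ofReal (π (X ω)) := (hπ.comp hX).ennreal_ofReal
  have keyL : ∀ F : (𝒳 × 𝒰 × 𝓜) × 𝒱 → ℝ≥0∞, Measurable F →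
      ∫⁻ ω in E, F (Z ω) ∂ρ = ∫⁻ ω, ENNReal.ofReal (π (X ω)) * F (Z ω) ∂ρ := by
    intro F hF
    rw [← lintegral_map hF hZ, key, lintegral_map hF hZ]
    exact lintegral_withDensity_eq_lintegral_mul ρ hπX (hF.comp hZ)
  have keyI : ∀ F : (𝒳 × 𝒰 × 𝓜) × 𝒱 → ℝ, Measurable F →
      ∫ ω in E, F (Z ω) ∂ρ = ∫ ω, π (X ω) * F (Z ω) ∂ρ := by
    intro F hF
    rw [← integral_map hZ.aemeasurable hF.aestronglyMeasurable, key,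
      integral_map hZ.aemeasurable hF.aestronglyMeasurable,
      integral_withDensity_eq_integral_toReal_smul hπX (ae_of_all _ fun _ => ENNReal.ofReal_lt_top)]
    simp [ENNReal.toReal_ofReal (hπpos _).le]
  set e : MARS.Obs 𝓜 𝒳 𝒰 𝒱 → ℝ := fun w => π w.2.2.1 with hedef
  have heX : Measurable[MARS.sigmaX] e :=
    (hπ.comp measurable_fst).comp (comap_measurable fun w : MARS.Obs 𝓜 𝒳 𝒰 𝒱 => w.2.2)
  have heM : Measurable e := heX.mono MARS.sigmaX_le le_rfl
  -- Forgetting M* in `key` leaves X̃ = (X, U, V), and the conditional probability stays π(X) since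
  -- it depends on X only.
  have he : Semiparam.IsPropensity MARS.sigmaX MARS.annotated P e := by
    refine Semiparam.isPropensity_of_setLIntegral MARS.sigmaX_le MARS.measurableSet_annotated heX
      (fun w => hπpos _) (fun w => (hπη _).2) ?_
    rintro _ ⟨T, hT, rfl⟩
    have hT' : MeasurableSet ((fun w : MARS.Obs 𝓜 𝒳 𝒰 𝒱 => w.2.2) ⁻¹' T) :=
      (measurable_snd.comp measurable_snd) hT
    set T2 : Set ((𝒳 × 𝒰 × 𝓜) × 𝒱) := {z | (z.1.1, z.1.2.1, z.2) ∈ T} with hT2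
    have hT2m : MeasurableSet T2 := by
      have : Measurable fun z : (𝒳 × 𝒰 × 𝓜) × 𝒱 => (z.1.1, z.1.2.1, z.2) := by fun_prop
      exact this hT
    have hpre : W ⁻¹' ((fun w => w.2.2) ⁻¹' T) = Z ⁻¹' T2 := rfl
    have h1 := keyL (T2.indicator fun _ => 1) (measurable_const.indicator hT2m)
    have h2 : ∀ ω, T2.indicator (fun _ => (1 : ℝ≥0∞)) (Z ω) =
        (Z ⁻¹' T2).indicator (fun _ => 1) ω := fun ω => rfl
    simp only [h2] at h1
    rw [lintegral_indicator_const (hZ hT2m), one_mul, Measure.restrict_apply (hZ hT2m)] at h1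
    rw [hP, Measure.map_apply hW (hT'.inter MARS.measurableSet_annotated),
      setLIntegral_map hT' heM.ennreal_ofReal hW, Set.preimage_inter, hpre, hWE, h1,
      ← lintegral_indicator (hZ hT2m)]
    refine lintegral_congr fun ω => ?_
    by_cases hω : ω ∈ Z ⁻¹' T2 <;> simp [hω, hedef, hWdef]
  have hgM : Measurable fun ω => g (Mstar ω) (V ω) := hg.comp (hMstar.prodMk hV)
  have hgZ : Measurable fun z : (𝒳 × 𝒰 × 𝓜) × 𝒱 => g z.1.2.2 z.2 := by
    exact hg.comp (by fun_prop : Measurable fun z : (𝒳 × 𝒰 × 𝓜) × 𝒱 => (z.1.2.2, z.2))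
  have hπZ : Measurable fun z : (𝒳 × 𝒰 × 𝓜) × 𝒱 => (π z.1.1)⁻¹ := by
    exact (hπ.comp (by fun_prop : Measurable fun z : (𝒳 × 𝒰 × 𝓜) × 𝒱 => z.1.1)).inv
  have hf := MARS.measurable_tildeM (𝒳 := 𝒳) (𝒰 := 𝒰) hg
  -- On annotated units the observed and latent variables agree, so weighted integrals over `E` may
  -- be rewritten in M*, and `keyL` or `keyI` then cancels π.
  have hME : ∀ᵐ ω ∂ρ.restrict E, M ω = Mstar ω := by
    filter_upwards [ae_restrict_of_ae hcons, ae_restrict_mem hE] with ω h1 h2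
    have h2' : A ω = true := h2
    rw [h1, if_pos h2']
  have hsm : MARS.secondMoment g P < ∞ := by
    rw [MARS.secondMoment_eq hg he]
    have hmeas : Measurable fun w : MARS.Obs 𝓜 𝒳 𝒰 𝒱 =>
      ENNReal.ofReal ((e w)⁻¹ * MARS.tildeM g w ^ 2) := (heM.inv.mul (hf.pow_const 2)).ennreal_ofReal
    have h1 : ∫⁻ w in MARS.annotated, ENNReal.ofReal ((e w)⁻¹ * MARS.tildeM g w ^ 2) ∂P =
        ∫⁻ ω, ENNReal.ofReal (g (Mstar ω) (V ω) ^ 2) ∂ρ := by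
      rw [hP, setLIntegral_map MARS.measurableSet_annotated hmeas hW, hWE]
      have h2 : ∫⁻ ω in E, ENNReal.ofReal ((e (W ω))⁻¹ * MARS.tildeM g (W ω) ^ 2) ∂ρ =
          ∫⁻ ω in E, ENNReal.ofReal ((π (X ω))⁻¹ * g (Mstar ω) (V ω) ^ 2) ∂ρ := by
        refine lintegral_congr_ae ?_
        filter_upwards [hME] with ω hω
        simp only [hedef, hWdef, MARS.tildeM, hω]
      rw [h2, keyL (fun z => ENNReal.ofReal ((π z.1.1)⁻¹ * g z.1.2.2 z.2 ^ 2))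
        (hπZ.mul (hgZ.pow_const 2)).ennreal_ofReal]
      refine lintegral_congr fun ω => ?_
      rw [← ENNReal.ofReal_mul (hπpos _).le, ← mul_assoc, mul_inv_cancel₀ (hπpos _).ne', one_mul]
    rw [h1]
    have h3 := hL2.integrable_sq
    rw [← ofReal_integral_eq_lintegral_ofReal h3 (ae_of_all _ fun _ => sq_nonneg _)]
    exact ENNReal.ofReal_lt_top
  have hPmem : P ∈ MARS.nonparametricModel g := by
    refine ⟨hPprob, ?_, ?_, hsm⟩
    · have hset : MeasurableSet {w : MARS.Obs 𝓜 𝒳 𝒰 𝒱 | w.2.1 = false → w.1 = 0} := by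
        have h1 : MeasurableSet {w : MARS.Obs 𝓜 𝒳 𝒰 𝒱 | w.2.1 = false} :=
          (measurable_fst.comp measurable_snd) (measurableSet_singleton false)
        have h2 : MeasurableSet {w : MARS.Obs 𝓜 𝒳 𝒰 𝒱 | w.1 = 0} :=
          measurable_fst (measurableSet_singleton 0)
        exact h1.imp h2
      rw [hP, ae_map_iff hW.aemeasurable hset]
      filter_upwards [hcons] with ω h1 h2
      have h2' : A ω = false := h2
      simp only [hWdef, h1, h2']
      simp
    · filter_upwards [he.condExp_eq] with w hw
      have hw' : MARS.annotationProb P w = e w := hw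
      rw [hw']
      exact he.pos w
  have hθ : MARS.theta g P = ∫ ω, g (Mstar ω) (V ω) ∂ρ := by
    obtain ⟨h1, -⟩ := MARS.integrableOn_of_secondMoment_lt_top hg he hsm
    have h2 := (he.integral_condExp_eq MARS.sigmaX_le MARS.measurableSet_annotated
      (he.integrableOn_self hf h1)
      (he.integrableOn_inv_mul MARS.sigmaX_le MARS.measurableSet_annotated hf h1)).2
    have hmeas : Measurable fun w : MARS.Obs 𝓜 𝒳 𝒰 𝒱 => (e w)⁻¹ * MARS.tildeM g w := heM.inv.mul hf
    have h3 : ∫ w in MARS.annotated, (e w)⁻¹ * MARS.tildeM g w ∂P =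
        ∫ ω, g (Mstar ω) (V ω) ∂ρ := by
      rw [hP, setIntegral_map MARS.measurableSet_annotated hmeas.aestronglyMeasurable
        hW.aemeasurable, hWE]
      have h2 : ∫ ω in E, (e (W ω))⁻¹ * MARS.tildeM g (W ω) ∂ρ =
          ∫ ω in E, (π (X ω))⁻¹ * g (Mstar ω) (V ω) ∂ρ := by
        refine integral_congr_ae ?_
        filter_upwards [hME] with ω hω
        simp only [hedef, hWdef, MARS.tildeM, hω]
      rw [h2, keyI (fun z => (π z.1.1)⁻¹ * g z.1.2.2 z.2) (hπZ.mul hgZ)]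
      congr 1 with ω
      rw [← mul_assoc, mul_inv_cancel₀ (hπpos _).ne', one_mul]
    exact h2.trans h3
  have heη : ∀ w, η ≤ e w := fun w => (hπη _).1
  obtain ⟨φ, hφ, hφ'⟩ := MARS.exists_isEIF (π := π) hg hPmem he (fun _ => rfl) hη0 hη1.le heη
  -- Any EIF of either model equals `φ` by uniqueness in that model, and `φ` is the EIF of the
  -- other.
  refine ⟨⟨hPmem, he.condExp_eq⟩, hθ, fun γ h hγ hh => ?_, ⟨φ, hφ, fun ψ hψ => hψ.unique hφ⟩,
    fun ψ => ⟨fun hψ => hψ.unique hφ ▸ hφ', fun hψ => hψ.unique hφ' ▸ hφ⟩⟩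
  have := MARS.hasPathwiseDeriv_theta hg he hη0 hη1.le heη hsm hγ
  rwa [MARS.integral_aipw_mul_annotationScore hg he hη0 heη hsm hh] at this
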